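/- Let $M$ be a connected pseudo-Riemannian spin manifold of signature $(p,q)$, with a fixed spin structure in the strong sense, i.e. a $\mathrm{Spin}_0(p,q)$-equivariant two-fold covering of the bundle of strongly oriented orthonormal frames. Let $S$ be its real spinor bundle, associated with an irreducible real module of the Clifford algebra $C\ell_{p,q}$ (with the convention $vw+wv=-2\langle v,w\rangle$), let $N$ be the rank of $S$, and let $k$ be the dimension of the space of parallel spinors, i.e. of smooth sections $s$ of $S$ with $\nabla s=0$ for the connection induced by the Levi-Civita connection. Put $\kappa(M):=k/N$. Let $(M_1,g_1)$, $(M_2,g_2)$ be connected pseudo-Riemannian spin manifolds, and let $M=M_1\times M_2$ carry the product metric $g_1\oplus g_2$ and the product spin structure. Then $$\kappa(M)=\kappa(M_1)\,\kappa(M_2).$$ In particular: if $\kappa(M_1)\neq 0$ and $\kappa(M)=\kappa(M_1)$, then $M_2$ is flat; conversely, if $M_2$ is flat and simply connected, then $\kappa(M)=\kappa(M_1)$. (So for $\kappa(M_1)\neq 0$ and $M_2$ simply connected, $\kappa(M)=\kappa(M_1)$ if and only if $M_2$ is flat.) -/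

import Mathlib

open scoped Manifold ContDiff

noncomputable section

/-! ### Pseudo-Riemannian metrics, the Levi-Civita connection and flatness -/

section Metric

variable {E : Type*} [NormedAddCommGroup E] [NormedSpace ℝ E]
  {H : Type*} [TopologicalSpace H]

/-- A smooth pseudo-Riemannian metric on `M`: a nondegenerate symmetric bilinear form on every
tangent space, depending smoothly on the point.  Smoothness is expressed by saying that the
quadratic form `v ↦ g(v, v)` is a smooth function on the total space of the tangent bundle. -/
structure PseudoRiemannianMetric (I : ModelWithCorners ℝ E H) (M : Type*) [TopologicalSpace M]
    [ChartedSpace H M] [IsManifold I ∞ M] where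
  val : ∀ x : M, LinearMap.BilinForm ℝ (TangentSpace I x)
  symm : ∀ (x : M) (v w : TangentSpace I x), val x v w = val x w v
  nondegenerate : ∀ x : M, (val x).Nondegenerate
  smooth : ContMDiff I.tangent 𝓘(ℝ, ℝ) ∞
    (fun v : TangentBundle I M => val v.proj v.snd v.snd)

variable {I : ModelWithCorners ℝ E H} {M : Type*} [TopologicalSpace M]
  [ChartedSpace H M] [IsManifold I ∞ M]

namespace PseudoRiemannianMetric

/-- The right-hand side of the Koszul formula for `g(∇_X Y, Z)` at the point `x`. -/
def koszul (g : PseudoRiemannianMetric I M) (X Y Z : ∀ x : M, TangentSpace I x) (x : M) : ℝ :=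
  (1 / 2 : ℝ) *
    (mvfderiv I (fun y => g.val y (Y y) (Z y)) x (X x)
      + mvfderiv I (fun y => g.val y (Z y) (X y)) x (Y x)
      - mvfderiv I (fun y => g.val y (X y) (Y y)) x (Z x)
      + g.val x (VectorField.mlieBracket I X Y x) (Z x)
      - g.val x (VectorField.mlieBracket I Y Z x) (X x)
      + g.val x (VectorField.mlieBracket I Z X x) (Y x))

instance finiteDimensional_tangentSpace [FiniteDimensional ℝ E] (x : M) :
    FiniteDimensional ℝ (TangentSpace I x) :=
  inferInstanceAs (FiniteDimensional ℝ E)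

/-- The Levi-Civita covariant derivative `∇_v Y` of a vector field `Y` (differentiable near `x`)
in the direction of a tangent vector `v` at `x`: the tangent vector at `x` characterised by the
Koszul formula, `g(∇_v Y, w) = koszul g X Y Z x`, where `X`, `Z` are vector fields, smooth near
`x`, with `X x = v` and `Z x = w`; `FiberBundle.extend` provides such fields, and `w` runs through
a basis of the tangent space. -/
def nabla [FiniteDimensional ℝ E] (g : PseudoRiemannianMetric I M) {x : M}
    (v : TangentSpace I x) (Y : ∀ x : M, TangentSpace I x) : TangentSpace I x :=
  ((g.val x).toDual (g.nondegenerate x)).symm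
    ((Module.finBasis ℝ (TangentSpace I x)).constr ℝ fun i =>
      g.koszul (FiberBundle.extend E v) Y
        (FiberBundle.extend E (Module.finBasis ℝ (TangentSpace I x) i)) x)

/-- The curvature `R(X, Y) Z = ∇_X ∇_Y Z - ∇_Y ∇_X Z - ∇_[X, Y] Z` of the Levi-Civita
connection at the point `x`. -/
def curvature [FiniteDimensional ℝ E] (g : PseudoRiemannianMetric I M)
    (X Y Z : ∀ x : M, TangentSpace I x) (x : M) : TangentSpace I x :=
  g.nabla (X x) (fun y => g.nabla (Y y) Z) - g.nabla (Y x) (fun y => g.nabla (X y) Z)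
    - g.nabla (VectorField.mlieBracket I X Y x) Z

/-- A metric is flat if the curvature of its Levi-Civita connection vanishes, on all locally
defined smooth vector fields. -/
def IsFlat [FiniteDimensional ℝ E] (g : PseudoRiemannianMetric I M) : Prop :=
  ∀ (U : Set M) (X Y Z : ∀ x : M, TangentSpace I x), IsOpen U →
    ContMDiffOn I I.tangent ∞ (fun x => (⟨x, X x⟩ : TangentBundle I M)) U →
    ContMDiffOn I I.tangent ∞ (fun x => (⟨x, Y x⟩ : TangentBundle I M)) U →
    ContMDiffOn I I.tangent ∞ (fun x => (⟨x, Z x⟩ : TangentBundle I M)) U →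
    ∀ x ∈ U, g.curvature X Y Z x = 0

end PseudoRiemannianMetric

end Metric

section ProductMetric

variable {E₁ : Type*} [NormedAddCommGroup E₁] [NormedSpace ℝ E₁]
  {H₁ : Type*} [TopologicalSpace H₁] {I₁ : ModelWithCorners ℝ E₁ H₁}
  {M₁ : Type*} [TopologicalSpace M₁] [ChartedSpace H₁ M₁] [IsManifold I₁ ∞ M₁]
  {E₂ : Type*} [NormedAddCommGroup E₂] [NormedSpace ℝ E₂]
  {H₂ : Type*} [TopologicalSpace H₂] {I₂ : ModelWithCorners ℝ E₂ H₂}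
  {M₂ : Type*} [TopologicalSpace M₂] [ChartedSpace H₂ M₂] [IsManifold I₂ ∞ M₂]

/-- The identification `T_(x₁, x₂) (M₁ × M₂) = T_x₁ M₁ × T_x₂ M₂`. -/
def tangentProd (I₁ : ModelWithCorners ℝ E₁ H₁) (I₂ : ModelWithCorners ℝ E₂ H₂) (x : M₁ × M₂) :
    TangentSpace (I₁.prod I₂) x ≃ₗ[ℝ] TangentSpace I₁ x.1 × TangentSpace I₂ x.2 :=
  LinearEquiv.refl ℝ (E₁ × E₂)

/-- The product metric `g₁ ⊕ g₂` on `M₁ × M₂`. -/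
def PseudoRiemannianMetric.prod (g₁ : PseudoRiemannianMetric I₁ M₁)
    (g₂ : PseudoRiemannianMetric I₂ M₂) :
    PseudoRiemannianMetric (I₁.prod I₂) (M₁ × M₂) where
  val x :=
    (g₁.val x.1).comp
        (LinearMap.fst ℝ _ _ ∘ₗ (tangentProd I₁ I₂ x).toLinearMap)
        (LinearMap.fst ℝ _ _ ∘ₗ (tangentProd I₁ I₂ x).toLinearMap)
      + (g₂.val x.2).comp
        (LinearMap.snd ℝ _ _ ∘ₗ (tangentProd I₁ I₂ x).toLinearMap)
        (LinearMap.snd ℝ _ _ ∘ₗ (tangentProd I₁ I₂ x).toLinearMap)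
  symm x v w := by
    simp only [LinearMap.add_apply, LinearMap.BilinForm.comp_apply]
    rw [g₁.symm, g₂.symm]
  nondegenerate x := by
    refine ⟨fun v hv => ?_, fun v hv => ?_⟩
    all_goals
      refine (tangentProd I₁ I₂ x).injective (Prod.ext ?_ ?_)
    · refine (g₁.nondegenerate x.1).1 _ fun w => ?_
      simpa using hv ((tangentProd I₁ I₂ x).symm (w, 0))
    · refine (g₂.nondegenerate x.2).1 _ fun w => ?_
      simpa using hv ((tangentProd I₁ I₂ x).symm (0, w))
    · refine (g₁.nondegenerate x.1).2 _ fun w => ?_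
      simpa using hv ((tangentProd I₁ I₂ x).symm (w, 0))
    · refine (g₂.nondegenerate x.2).2 _ fun w => ?_
      simpa using hv ((tangentProd I₁ I₂ x).symm (0, w))
  smooth := by
    have h := contMDiff_equivTangentBundleProd (n := ∞) (I := I₁) (M := M₁) (I' := I₂) (M' := M₂)
    exact (g₁.smooth.comp (contMDiff_fst.comp h)).add (g₂.smooth.comp (contMDiff_snd.comp h))

theorem PseudoRiemannianMetric.prod_val (g₁ : PseudoRiemannianMetric I₁ M₁)
    (g₂ : PseudoRiemannianMetric I₂ M₂) (x : M₁ × M₂) (v w : TangentSpace (I₁.prod I₂) x) :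
    (g₁.prod g₂).val x v w =
      g₁.val x.1 (tangentProd I₁ I₂ x v).1 (tangentProd I₁ I₂ x w).1
        + g₂.val x.2 (tangentProd I₁ I₂ x v).2 (tangentProd I₁ I₂ x w).2 :=
  rfl

end ProductMetric

/-! ### Clifford algebra and spin group of a signature -/

section Clifford

variable {ι ι₁ ι₂ : Type*} [Fintype ι] [Fintype ι₁] [Fintype ι₂]

/-- The quadratic form `v ↦ -∑ εᵢ vᵢ²` on `ℝ^ι`, the negative of the standard scalar product with
signs `εᵢ = ±1`.  With this sign, Clifford multiplication obeys `vw + wv = -2 ⟨v, w⟩`. -/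
def cliffordForm (ε : ι → ℤˣ) : QuadraticForm ℝ (ι → ℝ) :=
  QuadraticMap.weightedSumSquares ℝ fun i => -((ε i : ℤ) : ℝ)

/-- The isometric inclusion of the first summand of `ℝ^ι₁ ⊕ ℝ^ι₂`. -/
def cliffordInl (ε₁ : ι₁ → ℤˣ) (ε₂ : ι₂ → ℤˣ) :
    cliffordForm ε₁ →qᵢ cliffordForm (Sum.elim ε₁ ε₂) where
  toFun v := Sum.elim v 0
  map_add' v w := by ext (i | i) <;> simp
  map_smul' c v := by ext (i | i) <;> simp
  map_app' v := by simp [cliffordForm]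

/-- The isometric inclusion of the second summand of `ℝ^ι₁ ⊕ ℝ^ι₂`. -/
def cliffordInr (ε₁ : ι₁ → ℤˣ) (ε₂ : ι₂ → ℤˣ) :
    cliffordForm ε₂ →qᵢ cliffordForm (Sum.elim ε₁ ε₂) where
  toFun v := Sum.elim 0 v
  map_add' v w := by ext (i | i) <;> simp
  map_smul' c v := by ext (i | i) <;> simp
  map_app' v := by simp [cliffordForm]

theorem cliffordInl_isOrtho_cliffordInr (ε₁ : ι₁ → ℤˣ) (ε₂ : ι₂ → ℤˣ) (v : ι₁ → ℝ) (w : ι₂ → ℝ) :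
    QuadraticMap.IsOrtho (cliffordForm (Sum.elim ε₁ ε₂))
      (cliffordInl ε₁ ε₂ v) (cliffordInr ε₁ ε₂ w) := by
  have h₁ : cliffordInl ε₁ ε₂ v = (Sum.elim v 0 : ι₁ ⊕ ι₂ → ℝ) := rfl
  have h₂ : cliffordInr ε₁ ε₂ w = (Sum.elim 0 w : ι₁ ⊕ ι₂ → ℝ) := rfl
  rw [QuadraticMap.isOrtho_def, h₁, h₂]
  simp [cliffordForm, add_comm]

theorem exteriorAlgebra_finite (V : Type*) [AddCommGroup V] [Module ℝ V]
    [FiniteDimensional ℝ V] : Module.Finite ℝ (ExteriorAlgebra ℝ V) := by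
  have h : (⨆ n : Fin (Module.finrank ℝ V + 1), (⋀[ℝ]^(n : ℕ) V)) =
      (⊤ : Submodule ℝ (ExteriorAlgebra ℝ V)) := by
    rw [eq_top_iff, ← (DirectSum.Decomposition.isInternal
      (fun n : ℕ => ⋀[ℝ]^n V)).submodule_iSup_eq_top]
    refine iSup_le fun n => ?_
    by_cases hn : n < Module.finrank ℝ V + 1
    · exact le_iSup (fun n : Fin (Module.finrank ℝ V + 1) => (⋀[ℝ]^(n : ℕ) V)) ⟨n, hn⟩
    · have : Module.finrank ℝ (⋀[ℝ]^n V) = 0 := by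
        rw [exteriorPower.finrank_eq, Nat.choose_eq_zero_iff]; omega
      rw [Submodule.finrank_eq_zero.1 this]
      exact bot_le
  rw [Module.finite_def, ← h]
  exact Submodule.fg_iSup _ fun n => Module.Finite.iff_fg.1 inferInstance

theorem cliffordAlgebra_finite {V : Type*} [AddCommGroup V] [Module ℝ V] [FiniteDimensional ℝ V]
    (Q : QuadraticForm ℝ V) : Module.Finite ℝ (CliffordAlgebra Q) :=
  haveI := exteriorAlgebra_finite V
  Module.Finite.equiv (CliffordAlgebra.equivExterior Q).symm

theorem map_mem_even {V W : Type*} [AddCommGroup V] [Module ℝ V] [AddCommGroup W] [Module ℝ W]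
    {Q : QuadraticForm ℝ V} {Q' : QuadraticForm ℝ W} (f : Q →qᵢ Q') {a : CliffordAlgebra Q}
    (ha : a ∈ CliffordAlgebra.even Q) : CliffordAlgebra.map f a ∈ CliffordAlgebra.even Q' := by
  change a ∈ CliffordAlgebra.evenOdd Q 0 at ha
  change CliffordAlgebra.map f a ∈ CliffordAlgebra.evenOdd Q' 0
  induction a, ha using CliffordAlgebra.even_induction with
  | algebraMap r =>
    rw [AlgHom.commutes]
    exact (CliffordAlgebra.even Q').algebraMap_mem r
  | add x y _ _ hx hy => rw [map_add]; exact add_mem hx hy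
  | ι_mul_ι_mul m₁ m₂ x _ hx =>
    rw [map_mul, map_mul, CliffordAlgebra.map_apply_ι, CliffordAlgebra.map_apply_ι]
    exact (CliffordAlgebra.even Q').mul_mem (CliffordAlgebra.ι_mul_ι_mem_evenOdd_zero Q' _ _) hx

theorem star_map {V W : Type*} [AddCommGroup V] [Module ℝ V] [AddCommGroup W]
    [Module ℝ W] {Q : QuadraticForm ℝ V} {Q' : QuadraticForm ℝ W} (f : Q →qᵢ Q')
    (a : CliffordAlgebra Q) :
    star (CliffordAlgebra.map f a) = CliffordAlgebra.map f (star a) := by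
  induction a using CliffordAlgebra.induction with
  | algebraMap r => simp
  | ι v => simp
  | mul x y hx hy => simp [hx, hy]
  | add x y hx hy => simp [hx, hy]

theorem map_mem_spinGroup {V W : Type*} [AddCommGroup V] [Module ℝ V] [AddCommGroup W]
    [Module ℝ W] {Q : QuadraticForm ℝ V} {Q' : QuadraticForm ℝ W} (f : Q →qᵢ Q')
    {a : CliffordAlgebra Q} (ha : a ∈ spinGroup Q) : CliffordAlgebra.map f a ∈ spinGroup Q' := by
  obtain ⟨⟨⟨u, hu, rfl⟩, hs⟩, he⟩ := ha
  refine ⟨⟨⟨Units.map (CliffordAlgebra.map f : CliffordAlgebra Q →* CliffordAlgebra Q') u,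
    ?_, rfl⟩, ?_⟩, map_mem_even f he⟩
  · have h : lipschitzGroup Q ≤ (lipschitzGroup Q').comap
        (Units.map (CliffordAlgebra.map f : CliffordAlgebra Q →* CliffordAlgebra Q')) := by
      refine (Subgroup.closure_le _).2 ?_
      rintro x ⟨v, hv⟩
      refine Subgroup.subset_closure ⟨f v, ?_⟩
      rw [← CliffordAlgebra.map_apply_ι, hv]
      rfl
    exact h hu
  · change CliffordAlgebra.map f (u : CliffordAlgebra Q) ∈ unitary (CliffordAlgebra Q')
    change (u : CliffordAlgebra Q) ∈ unitary (CliffordAlgebra Q) at hs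
    rw [Unitary.mem_iff] at hs ⊢
    rw [star_map, ← map_mul, ← map_mul]
    exact ⟨by rw [hs.1, map_one], by rw [hs.2, map_one]⟩

/-- The homomorphism `Spin(V₁) × Spin(V₂) → Spin(V₁ ⊕ V₂)`, `(a, b) ↦ ab`. -/
def spinProd {ε₁ : ι₁ → ℤˣ} {ε₂ : ι₂ → ℤˣ} (a : spinGroup (cliffordForm ε₁))
    (b : spinGroup (cliffordForm ε₂)) : spinGroup (cliffordForm (Sum.elim ε₁ ε₂)) :=
  ⟨CliffordAlgebra.map (cliffordInl ε₁ ε₂) a, map_mem_spinGroup _ a.2⟩ *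
    ⟨CliffordAlgebra.map (cliffordInr ε₁ ε₂) b, map_mem_spinGroup _ b.2⟩

theorem coe_spinProd {ε₁ : ι₁ → ℤˣ} {ε₂ : ι₂ → ℤˣ} (a : spinGroup (cliffordForm ε₁))
    (b : spinGroup (cliffordForm ε₂)) :
    (spinProd a b : CliffordAlgebra (cliffordForm (Sum.elim ε₁ ε₂))) =
      CliffordAlgebra.map (cliffordInl ε₁ ε₂) a * CliffordAlgebra.map (cliffordInr ε₁ ε₂) b :=
  rfl

theorem spinProd_mul {ε₁ : ι₁ → ℤˣ} {ε₂ : ι₂ → ℤˣ} (a a' : spinGroup (cliffordForm ε₁))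
    (b b' : spinGroup (cliffordForm ε₂)) :
    spinProd a b * spinProd a' b' = spinProd (a * a') (b * b') := by
  have h : Commute (CliffordAlgebra.map (cliffordInl ε₁ ε₂) (a' : CliffordAlgebra _))
      (CliffordAlgebra.map (cliffordInr ε₁ ε₂) (b : CliffordAlgebra _)) :=
    CliffordAlgebra.commute_map_mul_map_of_isOrtho_of_mem_evenOdd_zero_left _ _
      (cliffordInl_isOrtho_cliffordInr ε₁ ε₂) _ _ (i₂ := 0)
      (spinGroup.mem_even a'.2) (spinGroup.mem_even b.2)
  refine Subtype.ext ?_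
  rw [Submonoid.coe_mul, coe_spinProd, coe_spinProd, coe_spinProd, Submonoid.coe_mul,
    Submonoid.coe_mul, map_mul, map_mul, mul_assoc, mul_assoc, ← mul_assoc _ _
      (CliffordAlgebra.map (cliffordInr ε₁ ε₂) (b' : CliffordAlgebra _)), ← h.eq, mul_assoc]

theorem spinProd_conj {ε₁ : ι₁ → ℤˣ} {ε₂ : ι₂ → ℤˣ} (a : spinGroup (cliffordForm ε₁))
    (b : spinGroup (cliffordForm ε₂)) {v v' : ι₁ → ℝ} {w w' : ι₂ → ℝ}
    (hv : (a : CliffordAlgebra (cliffordForm ε₁)) * CliffordAlgebra.ι (cliffordForm ε₁) v =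
      CliffordAlgebra.ι (cliffordForm ε₁) v' * (a : CliffordAlgebra (cliffordForm ε₁)))
    (hw : (b : CliffordAlgebra (cliffordForm ε₂)) * CliffordAlgebra.ι (cliffordForm ε₂) w =
      CliffordAlgebra.ι (cliffordForm ε₂) w' * (b : CliffordAlgebra (cliffordForm ε₂))) :
    (spinProd a b : CliffordAlgebra (cliffordForm (Sum.elim ε₁ ε₂))) *
        CliffordAlgebra.ι (cliffordForm (Sum.elim ε₁ ε₂)) (Sum.elim v w) =
      CliffordAlgebra.ι (cliffordForm (Sum.elim ε₁ ε₂)) (Sum.elim v' w') *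
        (spinProd a b : CliffordAlgebra (cliffordForm (Sum.elim ε₁ ε₂))) := by
  have hι : ∀ (x : ι₁ → ℝ) (y : ι₂ → ℝ),
      CliffordAlgebra.ι (cliffordForm (Sum.elim ε₁ ε₂)) (Sum.elim x y) =
        CliffordAlgebra.map (cliffordInl ε₁ ε₂) (CliffordAlgebra.ι _ x) +
          CliffordAlgebra.map (cliffordInr ε₁ ε₂) (CliffordAlgebra.ι _ y) := by
    intro x y
    have h₁ : cliffordInl ε₁ ε₂ x = (Sum.elim x 0 : ι₁ ⊕ ι₂ → ℝ) := rfl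
    have h₂ : cliffordInr ε₁ ε₂ y = (Sum.elim 0 y : ι₁ ⊕ ι₂ → ℝ) := rfl
    rw [CliffordAlgebra.map_apply_ι, CliffordAlgebra.map_apply_ι, h₁, h₂, ← map_add]
    congr 1
    ext (i | i) <;> simp
  have c₁ : Commute (CliffordAlgebra.map (cliffordInl ε₁ ε₂) (CliffordAlgebra.ι _ v))
      (CliffordAlgebra.map (cliffordInr ε₁ ε₂) (b : CliffordAlgebra _)) :=
    CliffordAlgebra.commute_map_mul_map_of_isOrtho_of_mem_evenOdd_zero_right _ _
      (cliffordInl_isOrtho_cliffordInr ε₁ ε₂) _ _ (i₁ := 1)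
      (CliffordAlgebra.ι_mem_evenOdd_one _ _) (spinGroup.mem_even b.2)
  have c₂ : Commute (CliffordAlgebra.map (cliffordInl ε₁ ε₂) (a : CliffordAlgebra _))
      (CliffordAlgebra.map (cliffordInr ε₁ ε₂) (CliffordAlgebra.ι _ w')) :=
    CliffordAlgebra.commute_map_mul_map_of_isOrtho_of_mem_evenOdd_zero_left _ _
      (cliffordInl_isOrtho_cliffordInr ε₁ ε₂) _ _ (i₂ := 1)
      (spinGroup.mem_even a.2) (CliffordAlgebra.ι_mem_evenOdd_one _ _)
  rw [coe_spinProd, hι, hι, mul_add, add_mul]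
  congr 1
  · rw [mul_assoc, ← c₁.eq, ← mul_assoc, ← map_mul, hv, map_mul, mul_assoc]
  · rw [mul_assoc, ← map_mul, hw, map_mul, ← mul_assoc, ← mul_assoc, c₂.eq]

end Clifford

/-! ### Spin structures, spinors and the invariant `κ` -/

section Spin

variable {E : Type*} [NormedAddCommGroup E] [NormedSpace ℝ E]
  {H : Type*} [TopologicalSpace H] {I : ModelWithCorners ℝ E H}
  {M : Type*} [TopologicalSpace M] [ChartedSpace H M] [IsManifold I ∞ M]
  {ι : Type*} [Fintype ι] [DecidableEq ι]

/-- A (strong) spin structure on the pseudo-Riemannian manifold `(M, g)`, where `g` has the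
signature of `⟨v, w⟩ = ∑ εᵢ vᵢ wᵢ`, given by its transition functions: an open cover `U a`, a
smooth orthonormal frame of `TM` over every `U a`, and smooth transition functions
`lift a b : U a ∩ U b → Spin` satisfying the cocycle condition, such that the image of
`lift a b x` in `SO₀` is the change of frame from `b` to `a`.
Mathlib's `spinGroup` is the subgroup of the even products `v₁ ⋯ v₂ₖ` of nonisotropic vectors with
`Q(v₁) ⋯ Q(v₂ₖ) = 1`; it is the twofold covering group `Spin₀` of the group `SO₀`
of orthogonal transformations that preserve both the orientation of maximal positive and of maximal
negative definite subspaces.  So the frames are strongly oriented with respect to each other. -/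
structure SpinStructure (g : PseudoRiemannianMetric I M) (ε : ι → ℤˣ) (A : Type*) where
  U : A → Set M
  isOpen_U : ∀ a, IsOpen (U a)
  cover : ∀ x, ∃ a, x ∈ U a
  frame : A → ι → ∀ x : M, TangentSpace I x
  smooth_frame : ∀ a i,
    ContMDiffOn I I.tangent ∞ (fun x => (⟨x, frame a i x⟩ : TangentBundle I M)) (U a)
  orthonormal : ∀ a, ∀ x ∈ U a, ∀ i j,
    g.val x (frame a i x) (frame a j x) = if i = j then ((ε i : ℤ) : ℝ) else 0
  span_frame : ∀ a, ∀ x ∈ U a, Submodule.span ℝ (Set.range fun i => frame a i x) = ⊤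
  lift : A → A → M → spinGroup (cliffordForm ε)
  smooth_lift : ∀ a b (φ : CliffordAlgebra (cliffordForm ε) →ₗ[ℝ] ℝ),
    ContMDiffOn I 𝓘(ℝ, ℝ) ∞ (fun x => φ (lift a b x)) (U a ∩ U b)
  /-- If `v` is a tangent vector with coordinate vectors `vᵃ`, `vᵇ` in the two frames,
  then `h vᵇ h⁻¹ = vᵃ` for `h = lift a b x`. -/
  lift_conj : ∀ a b, ∀ x ∈ U a ∩ U b, ∀ v : TangentSpace I x,
    (lift a b x : CliffordAlgebra (cliffordForm ε)) *
        CliffordAlgebra.ι (cliffordForm ε) (fun i => ((ε i : ℤ) : ℝ) * g.val x (frame b i x) v)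
      = CliffordAlgebra.ι (cliffordForm ε) (fun i => ((ε i : ℤ) : ℝ) * g.val x (frame a i x) v) *
        (lift a b x : CliffordAlgebra (cliffordForm ε))
  cocycle : ∀ a b c, ∀ x ∈ U a ∩ U b ∩ U c, lift a b x * lift b c x = lift a c x

namespace SpinStructure

variable {g : PseudoRiemannianMetric I M} {ε : ι → ℤˣ} {A : Type*}

/-- The connection form, in the frame `a`, of the spinor connection induced by the Levi-Civita
connection: the element `¼ ∑ᵢⱼ εᵢ εⱼ g(∇_v eᵢ, eⱼ) eᵢ eⱼ` of the Clifford algebra. -/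
def connectionForm [FiniteDimensional ℝ E] (σ : SpinStructure g ε A) (a : A) {x : M}
    (v : TangentSpace I x) : CliffordAlgebra (cliffordForm ε) :=
  (1 / 4 : ℝ) • ∑ i, ∑ j,
    (((ε i : ℤ) : ℝ) * ((ε j : ℤ) : ℝ) *
        g.val x (g.nabla v (σ.frame a i)) (σ.frame a j x)) •
      (CliffordAlgebra.ι (cliffordForm ε) (Pi.single i 1) *
        CliffordAlgebra.ι (cliffordForm ε) (Pi.single j 1))

variable [FiniteDimensional ℝ E] (S : Type*) [NormedAddCommGroup S] [NormedSpace ℝ S]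
  [Module (CliffordAlgebra (cliffordForm ε)) S]
  [IsScalarTower ℝ (CliffordAlgebra (cliffordForm ε)) S]

/-- The space of parallel spinors, i.e. of Killing spinors with Killing number `0`, where `S` is
the spinor module.  A section of the spinor bundle (the bundle with fibre `S` associated to the
spin structure) is a family of functions `s a : U a → S` with `s a = lift a b • s b` on
`U a ∩ U b`; it is smooth if every `s a` is, and in the trivialization `a` its covariant derivative
is `d(s a) + connectionForm a • s a`.  The functions `s a` are extended by zero to all of `M`. -/
def parallelSpinors (σ : SpinStructure g ε A) : Submodule ℝ (A → M → S) where
  carrier := {s |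
    (∀ a, ∀ x ∉ σ.U a, s a x = 0) ∧
    (∀ a, ContMDiffOn I 𝓘(ℝ, S) ∞ (s a) (σ.U a)) ∧
    (∀ a b, ∀ x ∈ σ.U a ∩ σ.U b,
      s a x = (σ.lift a b x : CliffordAlgebra (cliffordForm ε)) • s b x) ∧
    (∀ a, ∀ x ∈ σ.U a, ∀ v : TangentSpace I x,
      mvfderiv I (s a) x v + σ.connectionForm a v • s a x = 0)}
  zero_mem' := by
    refine ⟨fun a x _ => rfl, fun a => contMDiffOn_const, fun a b x _ => ?_, fun a x _ v => ?_⟩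
    · simp
    · simp
  add_mem' := by
    rintro s t ⟨hs₁, hs₂, hs₃, hs₄⟩ ⟨ht₁, ht₂, ht₃, ht₄⟩
    refine ⟨fun a x hx => ?_, fun a => (hs₂ a).add (ht₂ a), fun a b x hx => ?_,
      fun a x hx v => ?_⟩
    · simp [hs₁ a x hx, ht₁ a x hx]
    · simp [hs₃ a b x hx, ht₃ a b x hx]
    · have hU : σ.U a ∈ nhds x := (σ.isOpen_U a).mem_nhds hx
      have h : mvfderiv I ((s + t) a) x = mvfderiv I (s a) x + mvfderiv I (t a) x :=
        mvfderiv_add (((hs₂ a).contMDiffAt hU).mdifferentiableAt (by simp))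
          (((ht₂ a).contMDiffAt hU).mdifferentiableAt (by simp))
      have e₁ := hs₄ a x hx v
      have e₂ := ht₄ a x hx v
      rw [h]
      simp only [Pi.add_apply, add_apply, smul_add]
      rw [add_add_add_comm, e₁, e₂, add_zero]
  smul_mem' := by
    rintro c s ⟨hs₁, hs₂, hs₃, hs₄⟩
    refine ⟨fun a x hx => ?_, fun a =>
      (contMDiffOn_const (I := I) (I' := 𝓘(ℝ, ℝ)) (c := c)).smul (hs₂ a), fun a b x hx => ?_,
      fun a x hx v => ?_⟩
    · simp [hs₁ a x hx]
    · simp only [Pi.smul_apply, hs₃ a b x hx]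
      rw [smul_algebra_smul_comm]
    · have hU : σ.U a ∈ nhds x := (σ.isOpen_U a).mem_nhds hx
      have h : mvfderiv I ((c • s) a) x = c • mvfderiv I (s a) x := by
        ext w
        exact congrArg (fun L => NormedSpace.fromTangentSpace _ (L w))
          (const_smul_mfderiv (((hs₂ a).contMDiffAt hU).mdifferentiableAt (by simp)) c)
      have e₁ := hs₄ a x hx v
      rw [h]
      simp only [Pi.smul_apply, smul_apply]
      rw [smul_algebra_smul_comm, ← smul_add, e₁, smul_zero]

/-- The invariant `κ`: the dimension of the space of parallel spinors divided by the rank of the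
spinor bundle. -/
def kappa (σ : SpinStructure g ε A) : ℝ :=
  (Module.finrank ℝ (σ.parallelSpinors S) : ℝ) / (Module.finrank ℝ S : ℝ)

end SpinStructure

end Spin

section ProductSpin

variable {E₁ : Type*} [NormedAddCommGroup E₁] [NormedSpace ℝ E₁]
  {H₁ : Type*} [TopologicalSpace H₁] {I₁ : ModelWithCorners ℝ E₁ H₁}
  {M₁ : Type*} [TopologicalSpace M₁] [ChartedSpace H₁ M₁] [IsManifold I₁ ∞ M₁]
  {ι₁ : Type*} [Fintype ι₁] [DecidableEq ι₁]
  {E₂ : Type*} [NormedAddCommGroup E₂] [NormedSpace ℝ E₂]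
  {H₂ : Type*} [TopologicalSpace H₂] {I₂ : ModelWithCorners ℝ E₂ H₂}
  {M₂ : Type*} [TopologicalSpace M₂] [ChartedSpace H₂ M₂] [IsManifold I₂ ∞ M₂]
  {ι₂ : Type*} [Fintype ι₂] [DecidableEq ι₂]

/-- The frame `(e₁, …, eₘ, f₁, …, fₙ)` of `T(M₁ × M₂) = TM₁ ⊕ TM₂` built from frames `e` of `TM₁`
and `f` of `TM₂`. -/
def prodFrame (e : ι₁ → ∀ x : M₁, TangentSpace I₁ x) (f : ι₂ → ∀ x : M₂, TangentSpace I₂ x) :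
    ι₁ ⊕ ι₂ → ∀ x : M₁ × M₂, TangentSpace (I₁.prod I₂) x
  | .inl i, x => (tangentProd I₁ I₂ x).symm (e i x.1, 0)
  | .inr i, x => (tangentProd I₁ I₂ x).symm (0, f i x.2)

/-- The product spin structure on `M₁ × M₂`: the frames are the products of the frames of the
factors, and the transition functions are the images of the pairs of transition functions of the
factors under `Spin(V₁) × Spin(V₂) → Spin(V₁ ⊕ V₂)`. -/
def SpinStructure.prod {g₁ : PseudoRiemannianMetric I₁ M₁} {ε₁ : ι₁ → ℤˣ} {A₁ : Type*}
    {g₂ : PseudoRiemannianMetric I₂ M₂} {ε₂ : ι₂ → ℤˣ} {A₂ : Type*}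
    (σ₁ : SpinStructure g₁ ε₁ A₁) (σ₂ : SpinStructure g₂ ε₂ A₂) :
    SpinStructure (g₁.prod g₂) (Sum.elim ε₁ ε₂) (A₁ × A₂) where
  U a := σ₁.U a.1 ×ˢ σ₂.U a.2
  isOpen_U a := (σ₁.isOpen_U a.1).prod (σ₂.isOpen_U a.2)
  cover x := by
    obtain ⟨a, ha⟩ := σ₁.cover x.1
    obtain ⟨b, hb⟩ := σ₂.cover x.2
    exact ⟨(a, b), ha, hb⟩
  frame a := prodFrame (σ₁.frame a.1) (σ₂.frame a.2)
  smooth_frame := by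
    rintro a (i | i)
    · have h₁ : ContMDiffOn (I₁.prod I₂) I₁.tangent ∞
          (fun x : M₁ × M₂ => (⟨x.1, σ₁.frame a.1 i x.1⟩ : TangentBundle I₁ M₁))
          (σ₁.U a.1 ×ˢ σ₂.U a.2) :=
        (σ₁.smooth_frame a.1 i).comp contMDiffOn_fst fun x hx => hx.1
      have h₂ : ContMDiffOn (I₁.prod I₂) I₂.tangent ∞
          (fun x : M₁ × M₂ => (⟨x.2, 0⟩ : TangentBundle I₂ M₂)) (σ₁.U a.1 ×ˢ σ₂.U a.2) :=
        (Bundle.contMDiff_zeroSection ℝ (TangentSpace I₂ : M₂ → Type _)).comp_contMDiffOn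
          contMDiffOn_snd
      exact contMDiff_equivTangentBundleProd_symm.comp_contMDiffOn (h₁.prodMk h₂)
    · have h₁ : ContMDiffOn (I₁.prod I₂) I₁.tangent ∞
          (fun x : M₁ × M₂ => (⟨x.1, 0⟩ : TangentBundle I₁ M₁)) (σ₁.U a.1 ×ˢ σ₂.U a.2) :=
        (Bundle.contMDiff_zeroSection ℝ (TangentSpace I₁ : M₁ → Type _)).comp_contMDiffOn
          contMDiffOn_fst
      have h₂ : ContMDiffOn (I₁.prod I₂) I₂.tangent ∞
          (fun x : M₁ × M₂ => (⟨x.2, σ₂.frame a.2 i x.2⟩ : TangentBundle I₂ M₂))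
          (σ₁.U a.1 ×ˢ σ₂.U a.2) :=
        (σ₂.smooth_frame a.2 i).comp contMDiffOn_snd fun x hx => hx.2
      exact contMDiff_equivTangentBundleProd_symm.comp_contMDiffOn (h₁.prodMk h₂)
  orthonormal := by
    rintro a x ⟨hx₁, hx₂⟩ (i | i) (j | j)
    · simpa [PseudoRiemannianMetric.prod_val, prodFrame] using σ₁.orthonormal a.1 x.1 hx₁ i j
    · simp [PseudoRiemannianMetric.prod_val, prodFrame]
    · simp [PseudoRiemannianMetric.prod_val, prodFrame]
    · simpa [PseudoRiemannianMetric.prod_val, prodFrame] using σ₂.orthonormal a.2 x.2 hx₂ i j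
  span_frame := by
    rintro a x ⟨hx₁, hx₂⟩
    set W := Submodule.span ℝ
      (Set.range fun i => prodFrame (σ₁.frame a.1) (σ₂.frame a.2) i x) with hW
    have h₁ : ∀ v : TangentSpace I₁ x.1, (tangentProd I₁ I₂ x).symm (v, 0) ∈ W := by
      intro v
      have hle : (⊤ : Submodule ℝ (TangentSpace I₁ x.1)) ≤
          W.comap ((tangentProd I₁ I₂ x).symm.toLinearMap ∘ₗ LinearMap.inl ℝ _ _) := by
        rw [← σ₁.span_frame a.1 x.1 hx₁, Submodule.span_le]
        rintro _ ⟨i, rfl⟩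
        exact Submodule.subset_span ⟨Sum.inl i, rfl⟩
      exact hle trivial
    have h₂ : ∀ v : TangentSpace I₂ x.2, (tangentProd I₁ I₂ x).symm (0, v) ∈ W := by
      intro v
      have hle : (⊤ : Submodule ℝ (TangentSpace I₂ x.2)) ≤
          W.comap ((tangentProd I₁ I₂ x).symm.toLinearMap ∘ₗ LinearMap.inr ℝ _ _) := by
        rw [← σ₂.span_frame a.2 x.2 hx₂, Submodule.span_le]
        rintro _ ⟨i, rfl⟩
        exact Submodule.subset_span ⟨Sum.inr i, rfl⟩
      exact hle trivial
    rw [eq_top_iff]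
    intro v _
    obtain ⟨⟨v₁, v₂⟩, rfl⟩ := (tangentProd I₁ I₂ x).symm.surjective v
    have h := W.add_mem (h₁ v₁) (h₂ v₂)
    rwa [← map_add, Prod.mk_add_mk, add_zero, zero_add] at h
  lift a b x := spinProd (σ₁.lift a.1 b.1 x.1) (σ₂.lift a.2 b.2 x.2)
  smooth_lift := by
    intro a b φ
    have := cliffordAlgebra_finite (cliffordForm ε₁)
    have := cliffordAlgebra_finite (cliffordForm ε₂)
    set B₁ := Module.finBasis ℝ (CliffordAlgebra (cliffordForm ε₁))
    set B₂ := Module.finBasis ℝ (CliffordAlgebra (cliffordForm ε₂))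
    have h : ∀ x : M₁ × M₂, φ (spinProd (σ₁.lift a.1 b.1 x.1) (σ₂.lift a.2 b.2 x.2)) =
        ∑ i, ∑ j, B₁.coord i (σ₁.lift a.1 b.1 x.1) * (B₂.coord j (σ₂.lift a.2 b.2 x.2) *
          φ (CliffordAlgebra.map (cliffordInl ε₁ ε₂) (B₁ i) *
            CliffordAlgebra.map (cliffordInr ε₁ ε₂) (B₂ j))) := by
      intro x
      rw [coe_spinProd]
      conv_lhs => rw [← B₁.sum_repr (σ₁.lift a.1 b.1 x.1 : CliffordAlgebra (cliffordForm ε₁)),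
        ← B₂.sum_repr (σ₂.lift a.2 b.2 x.2 : CliffordAlgebra (cliffordForm ε₂))]
      simp only [map_sum, map_smul, Finset.sum_mul, Finset.mul_sum, smul_mul_assoc,
        mul_smul_comm, smul_eq_mul, Module.Basis.coord_apply]
      rw [Finset.sum_comm]
      refine Finset.sum_congr rfl fun i _ => Finset.sum_congr rfl fun j _ => ?_
      ring
    simp only [h]
    refine contMDiffOn_finsetSum fun i _ => contMDiffOn_finsetSum fun j _ => ?_
    refine ContMDiffOn.mul ?_ (ContMDiffOn.mul ?_ contMDiffOn_const)
    · exact (σ₁.smooth_lift a.1 b.1 (B₁.coord i)).comp contMDiffOn_fst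
        fun x hx => ⟨hx.1.1, hx.2.1⟩
    · exact (σ₂.smooth_lift a.2 b.2 (B₂.coord j)).comp contMDiffOn_snd
        fun x hx => ⟨hx.1.2, hx.2.2⟩
  lift_conj := by
    rintro a b x ⟨⟨ha₁, ha₂⟩, ⟨hb₁, hb₂⟩⟩ v
    have h := spinProd_conj _ _
      (σ₁.lift_conj a.1 b.1 x.1 ⟨ha₁, hb₁⟩ (tangentProd I₁ I₂ x v).1)
      (σ₂.lift_conj a.2 b.2 x.2 ⟨ha₂, hb₂⟩ (tangentProd I₁ I₂ x v).2)
    convert h using 3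
    all_goals
      ext (i | i) <;> simp [PseudoRiemannianMetric.prod_val, prodFrame]
  cocycle := by
    rintro a b c x ⟨⟨⟨ha₁, ha₂⟩, ⟨hb₁, hb₂⟩⟩, ⟨hc₁, hc₂⟩⟩
    rw [spinProd_mul, σ₁.cocycle a.1 b.1 c.1 x.1 ⟨⟨ha₁, hb₁⟩, hc₁⟩,
      σ₂.cocycle a.2 b.2 c.2 x.2 ⟨⟨ha₂, hb₂⟩, hc₂⟩]

end ProductSpin

end

/-! Parallel spinors are defined by transition functions and connection forms, and both take values
in the even part of the Clifford algebra. The even part does not distinguish between irreducible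
modules. The Clifford algebra has no proper nonzero two-sided ideal stable under the grading
involution (`eq_zero_of_mem_graded_ideal`), so it embeds into finitely many copies of a simple
module and of its twist by the involution. Hence it is semisimple, the simple modules are these two
up to isomorphism, and over the even part every finite-dimensional module W is a power of one simple
module (`exists_even_linearEquiv`). Consequently the parallel W-valued sections form a space of
dimension dim W · κ (`finrank_parallelSpinors_mul`).

Multiplicativity. The connection form of a product is the sum of those of the factors
(`connectionForm_prod`), since in orthonormal frames the Koszul formula contains only brackets.
Regard the spinor module S of the product as a module over both smaller Clifford algebras. A
parallel spinor is determined by one value, so the S-valued parallel spinors on M₁ correspond to the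
subspace W of S of their values at a point x₀, and dim W = dim S · κ(M₁). Even elements of the first
algebra commute with the whole second algebra, so W is a module over the second. Restriction to {x₀}
× M₂ identifies the parallel spinors of the product with the W-valued ones on M₂, which have
dimension dim W · κ(M₂) (`finrank_parallelSpinors_prod`). No tensor decomposition of S is needed.

Flatness. If κ(M₁) ≠ 0, then κ(M) = κ(M₁) forces κ(M₂) = 1. Parallel spinors then take every value
at every point; the curvature, lifted to the Clifford algebra, annihilates them, hence annihilates
the spinor module. Even elements act faithfully and the lift determines the curvature, so the
curvature vanishes (`isFlat_of_kappa_eq_one`). Conversely, on a flat manifold the parallel equation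
is solved along rays of a chart, and a Gronwall estimate shows that vanishing curvature makes the
radial solutions parallel in all directions (`exists_parallel_of_flat`). Local parallel frames
differ by locally constant maps, so over a simply connected base a covering-space lift glues them to
global parallel spinors (`exists_flat_section`, `evalParallel_surjective`). -/

set_option linter.unusedSectionVars false

/-! ### Structure of real Clifford algebras: elimination of generators. -/

section CliffordStructure

variable {ι : Type*} [Fintype ι] [DecidableEq ι] (ε : ι → ℤˣ)

/-- The standard generators of the Clifford algebra. -/
noncomputable def cliffordGen (i : ι) : CliffordAlgebra (cliffordForm ε) :=
  CliffordAlgebra.ι (cliffordForm ε) (Pi.single i 1)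

theorem intUnit_mul_self (u : ℤˣ) : ((u : ℤ) : ℝ) * ((u : ℤ) : ℝ) = 1 := by
  rcases Int.units_eq_one_or u with h | h <;> simp [h]

theorem cliffordForm_single (i : ι) : cliffordForm ε (Pi.single i 1) = -((ε i : ℤ) : ℝ) := by
  simp [cliffordForm, QuadraticMap.weightedSumSquares_apply, Pi.single_apply]

theorem cliffordGen_mul_self (i : ι) :
    cliffordGen ε i * cliffordGen ε i = (-((ε i : ℤ) : ℝ)) • 1 := by
  rw [cliffordGen, CliffordAlgebra.ι_sq_scalar, cliffordForm_single, Algebra.algebraMap_eq_smul_one]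

theorem cliffordGen_anticomm {i j : ι} (h : i ≠ j) :
    cliffordGen ε i * cliffordGen ε j = -(cliffordGen ε j * cliffordGen ε i) := by
  refine CliffordAlgebra.ι_mul_ι_comm_of_isOrtho ?_
  rw [QuadraticMap.isOrtho_def]
  simp only [cliffordForm, QuadraticMap.weightedSumSquares_apply, ← Finset.sum_add_distrib]
  refine Finset.sum_congr rfl fun k _ => ?_
  by_cases hi : k = i
  · subst hi; simp [h]
  · simp [hi]

theorem cliffordGen_mul_add_swap (i j : ι) :
    cliffordGen ε i * cliffordGen ε j + cliffordGen ε j * cliffordGen ε i =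
      (if i = j then -2 * ((ε i : ℤ) : ℝ) else 0) • 1 := by
  split_ifs with h
  · subst h
    rw [cliffordGen_mul_self, ← add_smul]; congr 1; ring
  · rw [cliffordGen_anticomm ε h, neg_add_cancel, zero_smul]

theorem involute_cliffordGen (i : ι) :
    CliffordAlgebra.involute (cliffordGen ε i) = -cliffordGen ε i :=
  CliffordAlgebra.involute_ι _

theorem star_cliffordGen (i : ι) : star (cliffordGen ε i) = -cliffordGen ε i :=
  CliffordAlgebra.star_ι _

theorem ι_eq_sum (v : ι → ℝ) :
    CliffordAlgebra.ι (cliffordForm ε) v = ∑ i, v i • cliffordGen ε i := by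
  conv_lhs => rw [pi_eq_sum_univ' v]
  rw [map_sum]
  refine Finset.sum_congr rfl fun i _ => ?_
  rw [map_smul, cliffordGen]

/-- The linear isomorphism with the exterior algebra carries vectors to vectors, and there the
inclusion of vectors has a left inverse. -/
theorem ι_injective : Function.Injective (CliffordAlgebra.ι (cliffordForm ε)) := by
  intro v w h
  have h' := congrArg (CliffordAlgebra.equivExterior (cliffordForm ε)) h
  simp only [CliffordAlgebra.equivExterior, CliffordAlgebra.changeFormEquiv_apply,
    CliffordAlgebra.changeForm_ι] at h'
  exact ExteriorAlgebra.ι_leftInverse.injective h'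

/-- The subalgebra generated by a set of standard generators. -/
noncomputable def cliffordSub (s : Finset ι) : Subalgebra ℝ (CliffordAlgebra (cliffordForm ε)) :=
  Algebra.adjoin ℝ (cliffordGen ε '' s)

theorem cliffordGen_mem {s : Finset ι} {i : ι} (h : i ∈ s) : cliffordGen ε i ∈ cliffordSub ε s :=
  Algebra.subset_adjoin ⟨i, h, rfl⟩

theorem cliffordSub_univ : cliffordSub ε Finset.univ = ⊤ := by
  rw [eq_top_iff, ← CliffordAlgebra.adjoin_range_ι]
  refine Algebra.adjoin_le ?_
  rintro _ ⟨v, rfl⟩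
  rw [ι_eq_sum]
  exact Subalgebra.sum_mem _ fun i _ =>
    Subalgebra.smul_mem _ (cliffordGen_mem ε (Finset.mem_univ i)) _

/-- Each generator other than eᵢ that eᵢ passes contributes a sign, and the grading involution
counts exactly these signs. Both sides are compatible with sums and products, so generators suffice.
-/
theorem mul_cliffordGen_of_notMem {s : Finset ι} {i : ι} (hi : i ∉ s)
    {a : CliffordAlgebra (cliffordForm ε)} (ha : a ∈ cliffordSub ε s) :
    a * cliffordGen ε i = cliffordGen ε i * CliffordAlgebra.involute a := by
  induction ha using Algebra.adjoin_induction with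
  | mem x hx =>
    obtain ⟨j, hj, rfl⟩ := hx
    have hij : j ≠ i := fun h => hi (h ▸ hj)
    rw [involute_cliffordGen, cliffordGen_anticomm ε hij, mul_neg]
  | algebraMap r => rw [AlgHom.commutes, Algebra.commutes]
  | add x y _ _ hx hy => rw [add_mul, hx, hy, map_add, mul_add]
  | mul x y _ _ hx hy => rw [mul_assoc, hy, ← mul_assoc, hx, map_mul, mul_assoc]

theorem exists_eq_add_cliffordGen_mul {s : Finset ι} {i : ι} (hi : i ∉ s)
    {a : CliffordAlgebra (cliffordForm ε)} (ha : a ∈ cliffordSub ε (insert i s)) :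
    ∃ b ∈ cliffordSub ε s, ∃ c ∈ cliffordSub ε s, a = b + cliffordGen ε i * c := by
  -- The form b + eᵢ c is not visibly multiplicative, so the induction proves instead that left
  -- multiplication by a preserves the set of such elements; the claim is its action on 1.
  suffices H : ∀ x ∈ cliffordSub ε s, ∀ y ∈ cliffordSub ε s,
      ∃ b ∈ cliffordSub ε s, ∃ c ∈ cliffordSub ε s,
        a * (x + cliffordGen ε i * y) = b + cliffordGen ε i * c by
    obtain ⟨b, hb, c, hc, h⟩ := H 1 (one_mem _) 0 (zero_mem _)
    exact ⟨b, hb, c, hc, by rw [← h, mul_zero, add_zero, mul_one]⟩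
  induction ha using Algebra.adjoin_induction with
  | mem z hz =>
    obtain ⟨j, hj, rfl⟩ := hz
    intro x hx y hy
    rcases Finset.mem_insert.1 (Finset.mem_coe.1 hj) with rfl | hj
    · refine ⟨(-((ε j : ℤ) : ℝ)) • y, Subalgebra.smul_mem _ hy _, x, hx, ?_⟩
      rw [mul_add, ← mul_assoc, cliffordGen_mul_self, smul_mul_assoc, one_mul, add_comm]
    · have hij : j ≠ i := fun h => hi (h ▸ hj)
      refine ⟨cliffordGen ε j * x, mul_mem (cliffordGen_mem ε hj) hx,
        -(cliffordGen ε j * y), neg_mem (mul_mem (cliffordGen_mem ε hj) hy), ?_⟩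
      rw [mul_add, ← mul_assoc, cliffordGen_anticomm ε hij, neg_mul, mul_neg, mul_assoc]
  | algebraMap r =>
    intro x hx y hy
    refine ⟨r • x, Subalgebra.smul_mem _ hx _, r • y, Subalgebra.smul_mem _ hy _, ?_⟩
    rw [← Algebra.smul_def, smul_add, mul_smul_comm]
  | add z w _ _ hz hw =>
    intro x hx y hy
    obtain ⟨b, hb, c, hc, h⟩ := hz x hx y hy
    obtain ⟨b', hb', c', hc', h'⟩ := hw x hx y hy
    exact ⟨b + b', add_mem hb hb', c + c', add_mem hc hc', by
      rw [add_mul, h, h', mul_add]; abel⟩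
  | mul z w _ _ hz hw =>
    intro x hx y hy
    obtain ⟨b, hb, c, hc, h⟩ := hw x hx y hy
    obtain ⟨b', hb', c', hc', h'⟩ := hz b hb c hc
    exact ⟨b', hb', c', hc', by rw [mul_assoc, h, h']⟩

theorem sign_smul_cliffordGen_mul_cliffordGen (i : ι) :
    (-((ε i : ℤ) : ℝ)) • (cliffordGen ε i * cliffordGen ε i) = 1 := by
  rw [cliffordGen_mul_self, smul_smul, neg_mul_neg, intUnit_mul_self, one_smul]

/-- Twisted conjugation by eᵢ fixes the part free of eᵢ and negates the part containing it.
Comparing an element with its twisted conjugate therefore separates the two parts, which allows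
generators to be removed one at a time. -/
theorem twisted_conj_cliffordGen {s : Finset ι} {i : ι} (hi : i ∉ s)
    {b c : CliffordAlgebra (cliffordForm ε)} (hb : b ∈ cliffordSub ε s)
    (hc : c ∈ cliffordSub ε s) :
    (-((ε i : ℤ) : ℝ)) • (cliffordGen ε i *
        CliffordAlgebra.involute (b + cliffordGen ε i * c) * cliffordGen ε i) =
      b - cliffordGen ε i * c := by
  have h₁ := mul_cliffordGen_of_notMem ε hi hb
  have h₂ := mul_cliffordGen_of_notMem ε hi hc
  have hu := sign_smul_cliffordGen_mul_cliffordGen ε i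
  calc _ = (-((ε i : ℤ) : ℝ)) • ((b - cliffordGen ε i * c) *
        (cliffordGen ε i * cliffordGen ε i)) := by
        congr 1
        rw [map_add, map_mul, involute_cliffordGen, ← mul_assoc _ (cliffordGen ε i)]
        congr 1
        rw [mul_add, ← h₁, sub_mul, mul_assoc (cliffordGen ε i) c, h₂, neg_mul, mul_neg,
          sub_eq_add_neg]
    _ = _ := by rw [← mul_smul_comm, hu, mul_one]

/-- The real Clifford algebra has no proper ideals stable under the grading involution. -/
theorem eq_zero_of_mem_graded_ideal
    (J : Submodule ℝ (CliffordAlgebra (cliffordForm ε)))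
    (hl : ∀ a, ∀ x ∈ J, a * x ∈ J) (hr : ∀ a, ∀ x ∈ J, x * a ∈ J)
    (hα : ∀ x ∈ J, CliffordAlgebra.involute x ∈ J) (h1 : 1 ∉ J) : ∀ x ∈ J, x = 0 := by
  -- Induction on the generators involved. J is stable under twisted conjugation, so averaging x = b
  -- + eᵢ c with its conjugate puts b in J, and b = 0 by induction; then eᵢ c lies in J, hence so
  -- does c because eᵢ is invertible. At the end only scalars remain, and a nonzero one would put 1
  -- in J.
  have H : ∀ s : Finset ι, ∀ x ∈ J, x ∈ cliffordSub ε s → x = 0 := by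
    intro s
    induction s using Finset.induction_on with
    | empty =>
      intro x hx hs
      rw [cliffordSub, Finset.coe_empty, Set.image_empty, Algebra.adjoin_empty] at hs
      obtain ⟨r, rfl⟩ := Algebra.mem_bot.1 hs
      by_cases hr0 : r = 0
      · rw [hr0, map_zero]
      · refine absurd (J.smul_mem r⁻¹ hx) ?_
        rwa [Algebra.algebraMap_eq_smul_one, smul_smul, inv_mul_cancel₀ hr0, one_smul]
    | insert i s hi ih =>
      intro x hx hs
      obtain ⟨b, hb, c, hc, rfl⟩ := exists_eq_add_cliffordGen_mul ε hi hs
      have hT : b - cliffordGen ε i * c ∈ J := by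
        rw [← twisted_conj_cliffordGen ε hi hb hc]
        exact J.smul_mem _ (hr _ _ (hl _ _ (hα _ hx)))
      have hbJ : b ∈ J := by
        have := J.smul_mem (1 / 2 : ℝ) (J.add_mem hx hT)
        rwa [add_add_sub_cancel, ← two_smul ℝ b, smul_smul, one_div_mul_cancel two_ne_zero,
          one_smul] at this
      have hb0 := ih b hbJ hb
      rw [hb0, zero_add] at hx ⊢
      have hcJ : c ∈ J := by
        have := J.smul_mem (-((ε i : ℤ) : ℝ)) (hl (cliffordGen ε i) _ hx)
        rwa [← mul_assoc, ← smul_mul_assoc, sign_smul_cliffordGen_mul_cliffordGen, one_mul] at this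
      rw [ih c hcJ hc, mul_zero]
  intro x hx
  refine H Finset.univ x hx ?_
  rw [cliffordSub_univ]; trivial

/-- An even element of the Clifford algebra that commutes with all vectors and is skew for the
star involution vanishes. -/
theorem eq_zero_of_even_of_commute_of_star_eq_neg {z : CliffordAlgebra (cliffordForm ε)}
    (he : CliffordAlgebra.involute z = z)
    (hc : ∀ i, z * cliffordGen ε i = cliffordGen ε i * z) (hs : star z = -z) : z = 0 := by
  -- Since z is even and commutes with eᵢ, it equals its twisted conjugate, so its eᵢ part vanishes.
  -- Removing every generator leaves a scalar, which the star fixes; skewness then makes it zero.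
  have H : ∀ s : Finset ι, z ∈ cliffordSub ε s → z ∈ cliffordSub ε ∅ := by
    intro s
    induction s using Finset.induction_on with
    | empty => exact id
    | insert i s hi ih =>
      intro h
      obtain ⟨b, hb, c, hc', hz⟩ := exists_eq_add_cliffordGen_mul ε hi h
      have hT := twisted_conj_cliffordGen ε hi hb hc'
      rw [← hz, he, ← hc i, mul_assoc, ← mul_smul_comm, sign_smul_cliffordGen_mul_cliffordGen,
        mul_one, hz] at hT
      have h0 : cliffordGen ε i * c = 0 := by
        have h2 : (2 : ℝ) • (cliffordGen ε i * c) = 0 := by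
          rw [two_smul]
          calc _ = (b + cliffordGen ε i * c) - (b - cliffordGen ε i * c) := by abel
            _ = 0 := by rw [← hT]; simp
        exact (smul_eq_zero.1 h2).resolve_left two_ne_zero
      rw [h0, add_zero] at hz
      exact ih (hz ▸ hb)
  have h := H Finset.univ (by rw [cliffordSub_univ]; trivial)
  rw [cliffordSub, Finset.coe_empty, Set.image_empty, Algebra.adjoin_empty] at h
  obtain ⟨r, rfl⟩ := Algebra.mem_bot.1 h
  rw [CliffordAlgebra.star_algebraMap, eq_neg_iff_add_eq_zero, ← map_add, ← two_mul,
    map_mul] at hs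
  have h2 : (2 : ℝ) • algebraMap ℝ (CliffordAlgebra (cliffordForm ε)) r = 0 := by
    rw [Algebra.smul_def]; exact hs
  exact (smul_eq_zero.1 h2).resolve_left two_ne_zero

/-! ### The spin representation of the Lie algebra of skew matrices -/

/-- The element `¼ ∑ εᵢ εⱼ Bᵢⱼ eᵢ eⱼ` of the Clifford algebra. -/
noncomputable def spinLift : (ι → ι → ℝ) →ₗ[ℝ] CliffordAlgebra (cliffordForm ε) where
  toFun B := (1 / 4 : ℝ) • ∑ i, ∑ j,
    (((ε i : ℤ) : ℝ) * ((ε j : ℤ) : ℝ) * B i j) • (cliffordGen ε i * cliffordGen ε j)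
  map_add' B D := by
    simp only [Pi.add_apply, mul_add, add_smul, Finset.sum_add_distrib, smul_add]
  map_smul' c B := by
    simp only [Pi.smul_apply, smul_eq_mul, RingHom.id_apply, Finset.smul_sum, smul_smul]
    refine Finset.sum_congr rfl fun i _ => Finset.sum_congr rfl fun j _ => ?_
    congr 1; ring

theorem spinLift_apply (B : ι → ι → ℝ) : spinLift ε B = (1 / 4 : ℝ) • ∑ i, ∑ j,
    (((ε i : ℤ) : ℝ) * ((ε j : ℤ) : ℝ) * B i j) • (cliffordGen ε i * cliffordGen ε j) := rfl

theorem spinLift_mem_even (B : ι → ι → ℝ) : spinLift ε B ∈ CliffordAlgebra.even _ := by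
  rw [spinLift_apply]
  refine Subalgebra.smul_mem _ (Subalgebra.sum_mem _ fun i _ => Subalgebra.sum_mem _ fun j _ =>
    Subalgebra.smul_mem _ ?_ _) _
  exact CliffordAlgebra.ι_mul_ι_mem_evenOdd_zero _ _ _

theorem involute_spinLift (B : ι → ι → ℝ) :
    CliffordAlgebra.involute (spinLift ε B) = spinLift ε B :=
  CliffordAlgebra.involute_eq_of_mem_even (spinLift_mem_even ε B)

theorem star_clifford_sum {κ : Type*} (s : Finset κ)
    (f : κ → CliffordAlgebra (cliffordForm ε)) : star (∑ i ∈ s, f i) = ∑ i ∈ s, star (f i) :=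
  map_sum (starAddEquiv : CliffordAlgebra (cliffordForm ε) ≃+ _) f s

/-- The star turns eᵢeⱼ into eⱼeᵢ, the two signs cancelling; exchanging the summation indices then
meets the skewness of B. -/
theorem star_spinLift {B : ι → ι → ℝ} (hB : ∀ i j, B i j = -B j i) :
    star (spinLift ε B) = -spinLift ε B := by
  rw [spinLift_apply, CliffordAlgebra.star_smul, ← smul_neg, star_clifford_sum]
  simp only [star_clifford_sum, CliffordAlgebra.star_smul, star_mul, star_cliffordGen, neg_mul_neg]
  rw [Finset.sum_comm, ← Finset.sum_neg_distrib]
  congr 1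
  refine Finset.sum_congr rfl fun i _ => ?_
  rw [← Finset.sum_neg_distrib]
  refine Finset.sum_congr rfl fun j _ => ?_
  rw [hB j i, ← neg_smul]
  congr 1; ring

/-- Commutators reduce to anticommutators: [eᵢeⱼ, eₖ] = eᵢ{eⱼ, eₖ} − {eᵢ, eₖ}eⱼ. The two terms
contribute equally for skew B, each with a factor 2, which is what the normalization ¼ compensates.
So the bracket with the lift acts on vectors as the infinitesimal rotation given by B. -/
theorem spinLift_commutator_gen {B : ι → ι → ℝ} (hB : ∀ i j, B i j = -B j i) (k : ι) :
    spinLift ε B * cliffordGen ε k - cliffordGen ε k * spinLift ε B =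
      ∑ j, (((ε j : ℤ) : ℝ) * B k j) • cliffordGen ε j := by
  have key : ∀ i j, cliffordGen ε i * cliffordGen ε j * cliffordGen ε k -
      cliffordGen ε k * (cliffordGen ε i * cliffordGen ε j) =
      (if j = k then -2 * ((ε j : ℤ) : ℝ) else 0) • cliffordGen ε i
        - (if i = k then -2 * ((ε i : ℤ) : ℝ) else 0) • cliffordGen ε j := by
    intro i j
    have h₁ := cliffordGen_mul_add_swap ε j k
    have h₂ := cliffordGen_mul_add_swap ε i k
    have h₃ := congrArg (fun t => cliffordGen ε i * t) h₁
    have h₄ := congrArg (fun t => t * cliffordGen ε j) h₂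
    simp only [mul_smul_comm, smul_mul_assoc, mul_one, one_mul, mul_add, add_mul] at h₃ h₄
    rw [← h₃, ← h₄]
    noncomm_ring
  rw [spinLift_apply, smul_mul_assoc, mul_smul_comm, ← smul_sub, Finset.sum_mul, Finset.mul_sum,
    ← Finset.sum_sub_distrib]
  have : ∀ i, (∑ j, (((ε i : ℤ) : ℝ) * ((ε j : ℤ) : ℝ) * B i j) •
        (cliffordGen ε i * cliffordGen ε j)) * cliffordGen ε k -
      cliffordGen ε k * ∑ j, (((ε i : ℤ) : ℝ) * ((ε j : ℤ) : ℝ) * B i j) •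
        (cliffordGen ε i * cliffordGen ε j) =
      (-2 * ((ε i : ℤ) : ℝ) * B i k) • cliffordGen ε i + (if i = k then
        ∑ j, (2 * ((ε j : ℤ) : ℝ) * B k j) • cliffordGen ε j else 0) := by
    intro i
    rw [Finset.sum_mul, Finset.mul_sum, ← Finset.sum_sub_distrib]
    simp only [smul_mul_assoc, mul_smul_comm, ← smul_sub, key]
    simp only [smul_sub, smul_smul, Finset.sum_sub_distrib]
    rw [sub_eq_add_neg]
    congr 1
    · rw [Finset.sum_eq_single k]
      · rw [if_pos rfl]
        congr 1
        linear_combination (-2 * ((ε i : ℤ) : ℝ) * B i k) * intUnit_mul_self (ε k)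
      · intro j _ hj; simp [hj]
      · simp
    · split_ifs with h
      · subst h
        rw [← Finset.sum_neg_distrib]
        refine Finset.sum_congr rfl fun j _ => ?_
        rw [← neg_smul]
        congr 1
        linear_combination (2 * ((ε j : ℤ) : ℝ) * B i j) * intUnit_mul_self (ε i)
      · simp
  simp only [this, Finset.sum_add_distrib, Finset.sum_ite_eq', Finset.mem_univ, if_true]
  rw [← Finset.sum_add_distrib, Finset.smul_sum]
  refine Finset.sum_congr rfl fun i _ => ?_
  rw [← add_smul, smul_smul, hB i k]
  congr 1; ring

theorem spinLift_commutator_ι {B : ι → ι → ℝ} (hB : ∀ i j, B i j = -B j i) (v : ι → ℝ) :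
    spinLift ε B * CliffordAlgebra.ι (cliffordForm ε) v -
        CliffordAlgebra.ι (cliffordForm ε) v * spinLift ε B =
      CliffordAlgebra.ι (cliffordForm ε) fun j => ((ε j : ℤ) : ℝ) * ∑ k, v k * B k j := by
  rw [ι_eq_sum, ι_eq_sum, Finset.mul_sum, Finset.sum_mul, ← Finset.sum_sub_distrib]
  simp only [mul_smul_comm, smul_mul_assoc, ← smul_sub, spinLift_commutator_gen ε hB,
    Finset.smul_sum, smul_smul]
  rw [Finset.sum_comm]
  refine Finset.sum_congr rfl fun j _ => ?_
  rw [← Finset.sum_smul, Finset.mul_sum]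
  congr 1
  exact Finset.sum_congr rfl fun k _ => by ring

/-- The matrix of the commutator of the endomorphisms defined by two skew matrices. -/
def skewBracket (B D : ι → ι → ℝ) (k l : ι) : ℝ :=
  ∑ j, ((ε j : ℤ) : ℝ) * (D k j * B j l - B k j * D j l)

theorem skewBracket_skew {B D : ι → ι → ℝ} (hB : ∀ i j, B i j = -B j i)
    (hD : ∀ i j, D i j = -D j i) (k l : ι) : skewBracket ε B D k l = -skewBracket ε B D l k := by
  rw [skewBracket, skewBracket, ← Finset.sum_neg_distrib]
  refine Finset.sum_congr rfl fun j _ => ?_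
  rw [hB l j, hD l j, hB j k, hD j k]; ring

/-- No fourfold products need be expanded: the difference of the two sides is even and skew for the
star, and by the Jacobi identity it commutes with all vectors, so it vanishes. -/
theorem spinLift_skewBracket {B D : ι → ι → ℝ} (hB : ∀ i j, B i j = -B j i)
    (hD : ∀ i j, D i j = -D j i) :
    spinLift ε (skewBracket ε B D) = spinLift ε B * spinLift ε D - spinLift ε D * spinLift ε B := by
  rw [← sub_eq_zero]
  refine eq_zero_of_even_of_commute_of_star_eq_neg ε ?_ (fun k => ?_) ?_
  · simp only [map_sub, map_mul, involute_spinLift]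
  · have h₁ := spinLift_commutator_gen ε (skewBracket_skew ε hB hD) k
    have h₂ := spinLift_commutator_gen ε hB k
    have h₃ := spinLift_commutator_gen ε hD k
    rw [← sub_eq_zero]
    -- The Jacobi identity, which reduces everything to commutators with a single generator.
    have e : ∀ x y z w : CliffordAlgebra (cliffordForm ε),
        (x - (y * z - z * y)) * w - w * (x - (y * z - z * y)) =
        (x * w - w * x) - ((y * (z * w - w * z) - (z * w - w * z) * y) -
          (z * (y * w - w * y) - (y * w - w * y) * z)) := by
      intro x y z w; noncomm_ring
    rw [e, h₁, h₂, h₃]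
    have e₂ : ∀ B' D' : ι → ι → ℝ, (∀ i j, B' i j = -B' j i) →
        spinLift ε B' * (∑ j, (((ε j : ℤ) : ℝ) * D' k j) • cliffordGen ε j) -
        (∑ j, (((ε j : ℤ) : ℝ) * D' k j) • cliffordGen ε j) * spinLift ε B' =
        ∑ l, (((ε l : ℤ) : ℝ) * ∑ j, ((ε j : ℤ) : ℝ) * (D' k j * B' j l)) • cliffordGen ε l := by
      intro B' D' hB'
      rw [← ι_eq_sum ε fun j => ((ε j : ℤ) : ℝ) * D' k j, spinLift_commutator_ι ε hB', ι_eq_sum]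
      simp only [mul_assoc]
    rw [e₂ B D hB, e₂ D B hD, ← Finset.sum_sub_distrib, ← Finset.sum_sub_distrib]
    refine Finset.sum_eq_zero fun l _ => ?_
    rw [← sub_smul, ← sub_smul, skewBracket]
    simp only [mul_sub, Finset.sum_sub_distrib]
    rw [sub_self, zero_smul]
  · rw [star_sub, star_sub, star_mul, star_mul, star_spinLift ε hB, star_spinLift ε hD,
      star_spinLift ε (skewBracket_skew ε hB hD)]
    noncomm_ring

end CliffordStructure

/-! ### Simple Clifford modules and their restriction to the even part. -/

section CliffordModules

variable {ι : Type*} [Fintype ι] [DecidableEq ι] {ε : ι → ℤˣ}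

/-- The grading involution, or the identity. -/
noncomputable def twistHom (ε : ι → ℤˣ) : Bool →
    (CliffordAlgebra (cliffordForm ε) →ₐ[ℝ] CliffordAlgebra (cliffordForm ε))
  | true => CliffordAlgebra.involute
  | false => AlgHom.id ℝ _

theorem twistHom_twistHom (b : Bool) (a : CliffordAlgebra (cliffordForm ε)) :
    twistHom ε b (twistHom ε b a) = a := by
  cases b
  · rfl
  · exact CliffordAlgebra.involute_involute a

theorem twistHom_eq_self (b : Bool) {a : CliffordAlgebra (cliffordForm ε)}
    (ha : CliffordAlgebra.involute a = a) : twistHom ε b a = a := by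
  cases b
  · rfl
  · exact ha

/-- A module over a Clifford algebra, possibly twisted by the grading involution. -/
def GradingTwist (_ : Bool) (S : Type*) : Type _ := S

instance (b : Bool) (S : Type*) [AddCommGroup S] : AddCommGroup (GradingTwist b S) :=
  inferInstanceAs (AddCommGroup S)

noncomputable instance (b : Bool) (S : Type*) [AddCommGroup S]
    [h : Module (CliffordAlgebra (cliffordForm ε)) S] :
    Module (CliffordAlgebra (cliffordForm ε)) (GradingTwist b S) :=
  Module.compHom S (twistHom ε b).toRingHom

theorem gradingTwist_smul (b : Bool) (S : Type*) [AddCommGroup S]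
    [Module (CliffordAlgebra (cliffordForm ε)) S] (a : CliffordAlgebra (cliffordForm ε))
    (s : GradingTwist b S) :
    a • s = (twistHom ε b a • (id s : S) : S) := rfl

instance (b : Bool) (S : Type*) [AddCommGroup S] [Module (CliffordAlgebra (cliffordForm ε)) S]
    [hS : IsSimpleModule (CliffordAlgebra (cliffordForm ε)) S] :
    IsSimpleModule (CliffordAlgebra (cliffordForm ε)) (GradingTwist b S) := by
  rw [isSimpleModule_iff_toSpanSingleton_surjective]
  have h := isSimpleModule_iff_toSpanSingleton_surjective.1 hS
  refine ⟨h.1, fun x hx y => ?_⟩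
  obtain ⟨a, ha⟩ := h.2 (id x : S) hx (id y : S)
  refine ⟨twistHom ε b a, ?_⟩
  rw [LinearMap.toSpanSingleton_apply, gradingTwist_smul, twistHom_twistHom]
  exact ha

variable (S : Type*) [AddCommGroup S] [Module ℝ S] [Module (CliffordAlgebra (cliffordForm ε)) S]
  [IsScalarTower ℝ (CliffordAlgebra (cliffordForm ε)) S]

/-- The elements that annihilate S together with their involutes form a two-sided ideal stable under
the involution and not containing 1. For even a the two hypotheses coincide, so the even part acts
faithfully even where the full algebra does not. -/
theorem eq_zero_of_smul_eq_zero [Nontrivial S] {a : CliffordAlgebra (cliffordForm ε)}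
    (h : ∀ s : S, a • s = 0) (h' : ∀ s : S, CliffordAlgebra.involute a • s = 0) : a = 0 := by
  let J : Submodule ℝ (CliffordAlgebra (cliffordForm ε)) :=
    { carrier := {a | (∀ s : S, a • s = 0) ∧ ∀ s : S, CliffordAlgebra.involute a • s = 0}
      zero_mem' := by simp
      add_mem' := by
        rintro a b ⟨h₁, h₂⟩ ⟨h₃, h₄⟩
        refine ⟨fun s => ?_, fun s => ?_⟩
        · rw [add_smul, h₁, h₃, add_zero]
        · rw [map_add, add_smul, h₂, h₄, add_zero]
      smul_mem' := by
        rintro c a ⟨h₁, h₂⟩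
        refine ⟨fun s => ?_, fun s => ?_⟩
        · rw [smul_assoc, h₁, smul_zero]
        · rw [map_smul, smul_assoc, h₂, smul_zero] }
  refine eq_zero_of_mem_graded_ideal ε J ?_ ?_ ?_ ?_ a ⟨h, h'⟩
  · rintro b x ⟨h₁, h₂⟩
    refine ⟨fun s => ?_, fun s => ?_⟩
    · rw [mul_smul, h₁, smul_zero]
    · rw [map_mul, mul_smul, h₂, smul_zero]
  · rintro b x ⟨h₁, h₂⟩
    refine ⟨fun s => ?_, fun s => ?_⟩
    · rw [mul_smul, h₁]
    · rw [map_mul, mul_smul, h₂]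
  · rintro x ⟨h₁, h₂⟩
    exact ⟨h₂, fun s => by rw [CliffordAlgebra.involute_involute, h₁]⟩
  · rintro ⟨h₁, -⟩
    obtain ⟨s, hs⟩ := exists_ne (0 : S)
    exact hs (by simpa using h₁ s)

theorem finiteDimensional_of_isSimpleModule (ε : ι → ℤˣ) (S : Type*) [AddCommGroup S] [Module ℝ S]
    [Module (CliffordAlgebra (cliffordForm ε)) S]
    [IsScalarTower ℝ (CliffordAlgebra (cliffordForm ε)) S]
    [IsSimpleModule (CliffordAlgebra (cliffordForm ε)) S] : FiniteDimensional ℝ S :=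
  haveI := cliffordAlgebra_finite (cliffordForm ε)
  Module.Finite.trans (CliffordAlgebra (cliffordForm ε)) S

variable [IsSimpleModule (CliffordAlgebra (cliffordForm ε)) S]

/-- The Clifford algebra embeds into a finite product of copies of a simple module and its twist. -/
theorem exists_injective_clifford :
    ∃ (n : ℕ) (f : CliffordAlgebra (cliffordForm ε) →ₗ[CliffordAlgebra (cliffordForm ε)]
      (∀ k : Bool × Fin n, GradingTwist k.1 S)), Function.Injective f := by
  have := finiteDimensional_of_isSimpleModule ε S
  have := IsSimpleModule.nontrivial (CliffordAlgebra (cliffordForm ε)) S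
  let b := Module.finBasis ℝ S
  -- The coordinates of a are its values on a basis of S, once in S and once in the twist; an
  -- element with all coordinates zero annihilates S along with its involute.
  refine ⟨_, LinearMap.pi fun k : Bool × Fin (Module.finrank ℝ S) =>
    LinearMap.toSpanSingleton (CliffordAlgebra (cliffordForm ε)) (GradingTwist k.1 S)
      (id (b k.2) : S), ?_⟩
  rw [← LinearMap.ker_eq_bot, LinearMap.ker_eq_bot']
  intro a ha
  have h : ∀ (k : Bool) (i), twistHom ε k a • b i = 0 := fun k i => congrFun ha (k, i)
  have key : ∀ c : CliffordAlgebra (cliffordForm ε), (∀ i, c • b i = 0) → ∀ s : S, c • s = 0 := by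
    intro c hc s
    rw [← b.sum_repr s, Finset.smul_sum]
    exact Finset.sum_eq_zero fun i _ => by rw [smul_algebra_smul_comm, hc, smul_zero]
  exact eq_zero_of_smul_eq_zero S (key _ (h false)) (key _ (h true))

/-- As a left module over itself the algebra embeds into a finite product of simple modules. -/
theorem isSemisimpleRing_clifford (ε : ι → ℤˣ) (S : Type*) [AddCommGroup S] [Module ℝ S]
    [Module (CliffordAlgebra (cliffordForm ε)) S]
    [IsScalarTower ℝ (CliffordAlgebra (cliffordForm ε)) S]
    [IsSimpleModule (CliffordAlgebra (cliffordForm ε)) S] :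
    IsSemisimpleRing (CliffordAlgebra (cliffordForm ε)) := by
  obtain ⟨n, f, hf⟩ := exists_injective_clifford (ε := ε) S
  exact IsSemisimpleModule.of_injective f hf

/-- Every simple module over a Clifford algebra is isomorphic to any other one, or to its twist. -/
theorem exists_linearEquiv_gradingTwist (T : Type*) [AddCommGroup T]
    [Module (CliffordAlgebra (cliffordForm ε)) T]
    [IsSimpleModule (CliffordAlgebra (cliffordForm ε)) T] :
    ∃ b, Nonempty (T ≃ₗ[CliffordAlgebra (cliffordForm ε)] GradingTwist b S) := by
  have := isSemisimpleRing_clifford ε S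
  obtain ⟨n, f, hf⟩ := exists_injective_clifford (ε := ε) S
  -- Semisimplicity realizes T as a left ideal, hence inside copies of S and its twist. Some
  -- coordinate is nonzero on T, and by Schur's lemma it is an isomorphism.
  obtain ⟨I, ⟨e⟩⟩ := IsSemisimpleRing.exists_linearEquiv_ideal_of_isSimpleModule
    (CliffordAlgebra (cliffordForm ε)) T
  let g := f ∘ₗ I.subtype ∘ₗ e.toLinearMap
  have hg : Function.Injective g :=
    hf.comp ((Submodule.subtype_injective I).comp e.injective)
  have := IsSimpleModule.nontrivial (CliffordAlgebra (cliffordForm ε)) T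
  obtain ⟨t, ht⟩ := exists_ne (0 : T)
  have hgt : g t ≠ 0 := fun h => ht (hg (h.trans (map_zero g).symm))
  obtain ⟨k, hk⟩ := Function.ne_iff.1 hgt
  have hne : (LinearMap.proj k ∘ₗ g : T →ₗ[_] GradingTwist k.1 S) ≠ 0 := fun h =>
    hk (LinearMap.congr_fun h t)
  exact ⟨k.1, ⟨LinearEquiv.ofBijective _ (LinearMap.bijective_of_ne_zero hne)⟩⟩

/-- As modules over the even part of a Clifford algebra, all finite-dimensional modules over the
Clifford algebra are powers of one simple module. -/
theorem exists_even_linearEquiv (W : Type*) [AddCommGroup W] [Module ℝ W]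
    [Module (CliffordAlgebra (cliffordForm ε)) W]
    [IsScalarTower ℝ (CliffordAlgebra (cliffordForm ε)) W] [FiniteDimensional ℝ W] :
    ∃ (n : ℕ) (φ : W ≃ₗ[ℝ] (Fin n → S)), ∀ a : CliffordAlgebra (cliffordForm ε),
      CliffordAlgebra.involute a = a → ∀ w, φ (a • w) = a • φ w := by
  have := isSemisimpleRing_clifford ε S
  have : Module.Finite (CliffordAlgebra (cliffordForm ε)) W :=
    Module.Finite.of_restrictScalars_finite ℝ _ _
  obtain ⟨n, T, e, hT⟩ := IsSemisimpleModule.exists_linearEquiv_fin_dfinsupp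
    (CliffordAlgebra (cliffordForm ε)) W
  choose b hb using fun i => exists_linearEquiv_gradingTwist (ε := ε) S (T i)
  let e' := e.trans (DFinsupp.linearEquivFunOnFintype)
  -- On each simple summand the possible twist is forgotten. The result is only twisted-linear for
  -- the full algebra, but elements fixed by the involution do not feel the twist.
  let F : W → (Fin n → S) := fun w i => (id ((hb i).some (e' w i)) : S)
  have hF : ∀ a w i, F (a • w) i = twistHom ε (b i) a • F w i := by
    intro a w i
    simp only [F]
    rw [map_smul, Pi.smul_apply, map_smul, gradingTwist_smul]
    rfl
  refine ⟨n, LinearEquiv.ofBijective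
    { toFun := F
      map_add' := fun x y => by
        ext i; simp only [F]; rw [map_add, Pi.add_apply, map_add]; rfl
      map_smul' := fun c x => by
        ext i
        rw [← algebraMap_smul (CliffordAlgebra (cliffordForm ε)) c x, hF, AlgHom.commutes,
          algebraMap_smul]
        rfl } ⟨?_, ?_⟩, ?_⟩
  · intro x y h
    refine e'.injective (funext fun i => (hb i).some.injective ?_)
    exact congrFun h i
  · intro s
    refine ⟨e'.symm fun i => (hb i).some.symm (s i), ?_⟩
    ext i
    change (hb i).some (e' (e'.symm fun i => (hb i).some.symm (s i)) i) = s i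
    rw [LinearEquiv.apply_symm_apply]
    exact LinearEquiv.apply_symm_apply (hb i).some (s i)
  · intro a ha w
    ext i
    change F (a • w) i = a • F w i
    rw [hF, twistHom_eq_self _ ha]

end CliffordModules

/-! ### Vector fields, directional derivatives and Lie brackets in charts. -/

section VectorFields

open Filter Topology

variable {E : Type*} [NormedAddCommGroup E] [NormedSpace ℝ E] [FiniteDimensional ℝ E]
  {H : Type*} [TopologicalSpace H] {I : ModelWithCorners ℝ E H} [I.Boundaryless]
  {M : Type*} [TopologicalSpace M] [ChartedSpace H M] [IsManifold I ∞ M]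
  {F : Type*} [NormedAddCommGroup F] [NormedSpace ℝ F]
  {E' : Type*} [NormedAddCommGroup E'] [NormedSpace ℝ E'] [FiniteDimensional ℝ E']
  {H' : Type*} [TopologicalSpace H'] {I' : ModelWithCorners ℝ E' H'} [I'.Boundaryless]
  {M' : Type*} [TopologicalSpace M'] [ChartedSpace H' M'] [IsManifold I' ∞ M']

/-- A vector field as a map to the tangent bundle. -/
abbrev sectionMap (I : ModelWithCorners ℝ E H) (X : ∀ x : M, TangentSpace I x) :
    M → TangentBundle I M :=
  fun x => ⟨x, X x⟩

theorem mvfderiv_comp_vector {f : M → M'} {h : M' → F} {x : M}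
    (hh : MDifferentiableAt I' 𝓘(ℝ, F) h (f x)) (hf : MDifferentiableAt I I' f x)
    (v : TangentSpace I x) :
    mvfderiv I (fun y => h (f y)) x v = mvfderiv I' h (f x) (mfderiv I I' f x v) :=
  mfderiv_comp_apply x hh hf v

theorem mvfderiv_eq_fderiv (f : E → F) (x : E) (v : E) :
    mvfderiv 𝓘(ℝ, E) f x v = fderiv ℝ f x v := by
  simp only [mvfderiv, mfderiv_eq_fderiv]; rfl

theorem mvfderiv_congr {f h : M → F} {x : M} (hfh : f =ᶠ[𝓝 x] h) :
    mvfderiv I f x = mvfderiv I h x := by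
  ext v
  simp only [mvfderiv]
  have := hfh.mfderiv_eq (I := I) (I' := 𝓘(ℝ, F))
  exact congrArg (fun L : E →L[ℝ] F => L v) this

theorem mvfderiv_clm_comp {G : Type*} [NormedAddCommGroup G] [NormedSpace ℝ G] (L : F →L[ℝ] G)
    {f : M → F} {x : M} (hf : MDifferentiableAt I 𝓘(ℝ, F) f x) (v : TangentSpace I x) :
    mvfderiv I (fun y => L (f y)) x v = L (mvfderiv I f x v) := by
  have h := mfderiv_comp_apply x (g := L) L.differentiableAt.mdifferentiableAt hf v
  have h' : mfderiv 𝓘(ℝ, F) 𝓘(ℝ, G) L (f x) = fderiv ℝ L (f x) := mfderiv_eq_fderiv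
  rw [L.fderiv] at h'
  rw [h'] at h
  exact h

theorem mdifferentiableAt_symm_of_mem {x₀ : M} {y : E} (hy : y ∈ (extChartAt I x₀).target) :
    MDifferentiableAt 𝓘(ℝ, E) I (extChartAt I x₀).symm y :=
  ((contMDiffOn_extChartAt_symm (n := ∞) x₀).contMDiffAt
    ((isOpen_extChartAt_target x₀).mem_nhds hy)).mdifferentiableAt (by simp)

theorem contMDiffAt_symm_of_mem {x₀ : M} {y : E} (hy : y ∈ (extChartAt I x₀).target) :
    ContMDiffAt 𝓘(ℝ, E) I ∞ (extChartAt I x₀).symm y :=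
  (contMDiffOn_extChartAt_symm (n := ∞) x₀).contMDiffAt
    ((isOpen_extChartAt_target x₀).mem_nhds hy)

theorem isInvertible_mfderiv_symm {x₀ : M} {y : E} (hy : y ∈ (extChartAt I x₀).target) :
    (mfderiv 𝓘(ℝ, E) I (extChartAt I x₀).symm y).IsInvertible := by
  have : IsManifold I 1 M := IsManifold.of_le (n := ∞) (by simp)
  have h := isInvertible_mfderivWithin_extChartAt_symm (I := I) hy
  rwa [I.range_eq_univ, mfderivWithin_univ] at h

/-- The expression of a vector field in a chart. -/
noncomputable def chartRep (x₀ : M) (X : ∀ x : M, TangentSpace I x) (y : E) : E :=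
  VectorField.mpullback 𝓘(ℝ, E) I (extChartAt I x₀).symm X y

theorem mfderiv_symm_chartRep {x₀ : M} {y : E} (hy : y ∈ (extChartAt I x₀).target)
    (X : ∀ x : M, TangentSpace I x) :
    mfderiv 𝓘(ℝ, E) I (extChartAt I x₀).symm y (chartRep (E := E) x₀ X y) =
      X ((extChartAt I x₀).symm y) := by
  exact (isInvertible_mfderiv_symm hy).self_apply_inverse _

/-- The derivative of a function along a vector field, in a chart. -/
theorem fderiv_comp_symm_chartRep {x₀ : M} {y : E} (hy : y ∈ (extChartAt I x₀).target)
    {f : M → F} (hf : MDifferentiableAt I 𝓘(ℝ, F) f ((extChartAt I x₀).symm y))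
    (X : ∀ x : M, TangentSpace I x) :
    fderiv ℝ (fun z => f ((extChartAt I x₀).symm z)) y (chartRep x₀ X y) =
      mvfderiv I f ((extChartAt I x₀).symm y) (X ((extChartAt I x₀).symm y)) := by
  rw [← mvfderiv_eq_fderiv]
  refine (mvfderiv_comp_vector (h := f) hf (mdifferentiableAt_symm_of_mem hy) _).trans ?_
  congr 1
  exact mfderiv_symm_chartRep hy X

theorem contDiffAt_chartRep {x₀ : M} {y : E} (hy : y ∈ (extChartAt I x₀).target)
    {X : ∀ x : M, TangentSpace I x}
    (hX : ContMDiffAt I I.tangent ∞ (sectionMap I X) ((extChartAt I x₀).symm y)) :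
    ContDiffAt ℝ ∞ (chartRep x₀ X) y := by
  have : IsManifold I (∞ + 1) M := by simpa using ‹IsManifold I ∞ M›
  exact contMDiffAt_vectorSpace_iff_contDiffAt.1
    (ContMDiffAt.mpullback_vectorField_preimage (n := ∞) hX (contMDiffAt_symm_of_mem hy)
      (isInvertible_mfderiv_symm hy) (by simp))

theorem contDiffAt_comp_symm {x₀ : M} {y : E} (hy : y ∈ (extChartAt I x₀).target)
    {f : M → F} (hf : ContMDiffAt I 𝓘(ℝ, F) ∞ f ((extChartAt I x₀).symm y)) :
    ContDiffAt ℝ ∞ (fun z => f ((extChartAt I x₀).symm z)) y :=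
  contMDiffAt_iff_contDiffAt.1 (hf.comp y (contMDiffAt_symm_of_mem hy))

theorem two_le_infty : (2 : WithTop ℕ∞) ≤ ∞ :=
  WithTop.coe_le_coe.2 (le_top : (2 : ℕ∞) ≤ ⊤)

theorem three_le_infty : (3 : WithTop ℕ∞) ≤ ∞ :=
  WithTop.coe_le_coe.2 (le_top : (3 : ℕ∞) ≤ ⊤)

theorem chartRep_mlieBracket {x₀ : M} {y : E} (hy : y ∈ (extChartAt I x₀).target)
    {X Y : ∀ x : M, TangentSpace I x}
    (hX : ContMDiffAt I I.tangent ∞ (sectionMap I X) ((extChartAt I x₀).symm y))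
    (hY : ContMDiffAt I I.tangent ∞ (sectionMap I Y) ((extChartAt I x₀).symm y)) :
    chartRep x₀ (VectorField.mlieBracket I X Y) y =
      VectorField.lieBracket ℝ (chartRep x₀ X) (chartRep x₀ Y) y := by
  have : IsManifold I (minSmoothness ℝ 3) M :=
    IsManifold.of_le (n := ∞) (by simpa using three_le_infty)
  have h := VectorField.mpullback_mlieBracket (n := ∞) (hX.mdifferentiableAt (by simp))
    (hY.mdifferentiableAt (by simp)) (contMDiffAt_symm_of_mem hy) (by simpa using two_le_infty)
  refine h.trans ?_
  rw [← VectorField.mlieBracketWithin_univ, VectorField.mlieBracketWithin_eq_lieBracketWithin]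
  exact congrFun (VectorField.lieBracketWithin_univ (V := chartRep x₀ X) (W := chartRep x₀ Y)) y

theorem eventually_mdifferentiableAt {N : Type*} [TopologicalSpace N] {H'' : Type*}
    [TopologicalSpace H''] {E'' : Type*} [NormedAddCommGroup E''] [NormedSpace ℝ E'']
    {I'' : ModelWithCorners ℝ E'' H''} [ChartedSpace H'' N] [IsManifold I'' ∞ N]
    {f : M → N} {x : M} (hf : ContMDiffAt I I'' ∞ f x) :
    ∀ᶠ y in 𝓝 x, MDifferentiableAt I I'' f y := by
  have : IsManifold I 1 M := IsManifold.of_le (n := ∞) (by simp)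
  have : IsManifold I'' 1 N := IsManifold.of_le (n := ∞) (by simp)
  filter_upwards [(contMDiffAt_iff_contMDiffAt_nhds (n := 1) (by simp)).1
    (hf.of_le (m := 1) (by simp))] with y hy
  exact hy.mdifferentiableAt (by simp)

/-- The identity is needed on a neighbourhood, not only at one point, so that it can be
differentiated again when second derivatives are formed. -/
theorem mvfderiv_comp_symm_eventuallyEq {x₀ : M} {y : E} (hy : y ∈ (extChartAt I x₀).target)
    (X : ∀ x : M, TangentSpace I x) {f : M → F}
    (hf : ContMDiffAt I 𝓘(ℝ, F) ∞ f ((extChartAt I x₀).symm y)) :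
    (fun z => mvfderiv I f ((extChartAt I x₀).symm z) (X ((extChartAt I x₀).symm z))) =ᶠ[𝓝 y]
      fun z => fderiv ℝ (fun z => f ((extChartAt I x₀).symm z)) z (chartRep x₀ X z) := by
  filter_upwards [(isOpen_extChartAt_target x₀).mem_nhds hy,
    (contMDiffAt_symm_of_mem hy).continuousAt (eventually_mdifferentiableAt hf)] with z hz hfz
  exact (fderiv_comp_symm_chartRep hz hfz X).symm

theorem contDiffAt_fderiv_apply {G : Type*} [NormedAddCommGroup G] [NormedSpace ℝ G] {f : G → F}
    {V : G → G} {y : G} (hf : ContDiffAt ℝ ∞ f y) (hV : ContDiffAt ℝ ∞ V y) :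
    ContDiffAt ℝ ∞ (fun z => fderiv ℝ f z (V z)) y :=
  (hf.fderiv_right (m := ∞) (by simp)).clm_apply hV

theorem contMDiffAt_of_comp_symm {x₀ : M} {y : E} (hy : y ∈ (extChartAt I x₀).target) {f : M → F}
    (hf : ContDiffAt ℝ ∞ (fun z => f ((extChartAt I x₀).symm z)) y) :
    ContMDiffAt I 𝓘(ℝ, F) ∞ f ((extChartAt I x₀).symm y) := by
  have hs : (extChartAt I x₀).symm y ∈ (extChartAt I x₀).source := (extChartAt I x₀).map_target hy
  have h : ContMDiffAt I 𝓘(ℝ, F) ∞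
      (fun x => f ((extChartAt I x₀).symm (extChartAt I x₀ x))) ((extChartAt I x₀).symm y) := by
    refine ContMDiffAt.comp (I' := 𝓘(ℝ, E)) (g := fun z => f ((extChartAt I x₀).symm z)) _ ?_
      (contMDiffAt_extChartAt' (by simpa [extChartAt_source] using hs))
    rw [(extChartAt I x₀).right_inv hy]
    exact hf.contMDiffAt
  refine h.congr_of_eventuallyEq ?_
  filter_upwards [(isOpen_extChartAt_source x₀).mem_nhds hs] with z hz
  rw [(extChartAt I x₀).left_inv hz]

theorem contMDiffAt_mvfderiv_apply {X : ∀ x : M, TangentSpace I x} {f : M → F} {x : M}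
    (hX : ContMDiffAt I I.tangent ∞ (sectionMap I X) x) (hf : ContMDiffAt I 𝓘(ℝ, F) ∞ f x) :
    ContMDiffAt I 𝓘(ℝ, F) ∞ (fun y => mvfderiv I f y (X y)) x := by
  have hy := mem_extChartAt_target (I := I) x
  have hx := extChartAt_to_inv (I := I) x
  rw [← hx] at hX hf
  have h := (contDiffAt_fderiv_apply (contDiffAt_comp_symm hy hf)
    (contDiffAt_chartRep hy hX)).congr_of_eventuallyEq (mvfderiv_comp_symm_eventuallyEq hy X hf)
  have h' := contMDiffAt_of_comp_symm (f := fun y => mvfderiv I f y (X y)) hy h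
  rwa [hx] at h'

/-- In a chart the product rule produces second-derivative terms, which cancel by their symmetry;
the remaining first-derivative terms are the bracket. -/
theorem mvfderiv_mlieBracket {X Y : ∀ x : M, TangentSpace I x} {f : M → F} {x : M}
    (hX : ContMDiffAt I I.tangent ∞ (sectionMap I X) x)
    (hY : ContMDiffAt I I.tangent ∞ (sectionMap I Y) x)
    (hf : ContMDiffAt I 𝓘(ℝ, F) ∞ f x) :
    mvfderiv I f x (VectorField.mlieBracket I X Y x) =
      mvfderiv I (fun y => mvfderiv I f y (Y y)) x (X x) -
        mvfderiv I (fun y => mvfderiv I f y (X y)) x (Y x) := by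
  obtain ⟨x₀, z, hz, rfl⟩ : ∃ (x₀ : M), ∃ z ∈ (extChartAt I x₀).target,
    (extChartAt I x₀).symm z = x := ⟨x, _, mem_extChartAt_target x, extChartAt_to_inv x⟩
  have hfd := hf.mdifferentiableAt (by simp)
  have hf' := contDiffAt_comp_symm hz hf
  have hX' := contDiffAt_chartRep hz hX
  have hY' := contDiffAt_chartRep hz hY
  rw [← fderiv_comp_symm_chartRep hz hfd, chartRep_mlieBracket hz hX hY,
    ← fderiv_comp_symm_chartRep hz ((contMDiffAt_mvfderiv_apply hX hf).mdifferentiableAt (by simp)),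
    ← fderiv_comp_symm_chartRep hz ((contMDiffAt_mvfderiv_apply hY hf).mdifferentiableAt (by simp)),
    (mvfderiv_comp_symm_eventuallyEq hz X hf).fderiv_eq,
    (mvfderiv_comp_symm_eventuallyEq hz Y hf).fderiv_eq]
  set fh := fun z => f ((extChartAt I x₀).symm z)
  have hd := (hf'.fderiv_right (m := ∞) (by simp)).differentiableAt (by simp)
  rw [fderiv_clm_apply hd (hX'.differentiableAt (by simp)),
    fderiv_clm_apply hd (hY'.differentiableAt (by simp))]
  have hsym := hf'.isSymmSndFDerivAt (by simpa using two_le_infty)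
  have := hsym (chartRep x₀ X z) (chartRep x₀ Y z)
  simp only [VectorField.lieBracket, map_sub, add_apply,
    ContinuousLinearMap.comp_apply, ContinuousLinearMap.flip_apply, this]
  abel

/-- A smooth map intertwining two pairs of vector fields intertwines their Lie brackets. -/
theorem mfderiv_mlieBracket {φ : M → M'} {x : M} (hφ : ContMDiffAt I I' ∞ φ x)
    {X Y : ∀ x : M, TangentSpace I x} {X' Y' : ∀ x : M', TangentSpace I' x}
    (hX : ContMDiffAt I I.tangent ∞ (sectionMap I X) x)
    (hY : ContMDiffAt I I.tangent ∞ (sectionMap I Y) x)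
    (hX' : ContMDiffAt I' I'.tangent ∞ (sectionMap I' X') (φ x))
    (hY' : ContMDiffAt I' I'.tangent ∞ (sectionMap I' Y') (φ x))
    (hXX' : ∀ᶠ y in 𝓝 x, mfderiv I I' φ y (X y) = X' (φ y))
    (hYY' : ∀ᶠ y in 𝓝 x, mfderiv I I' φ y (Y y) = Y' (φ y)) :
    mfderiv I I' φ x (VectorField.mlieBracket I X Y x) =
      VectorField.mlieBracket I' X' Y' (φ x) := by
  -- Tangent vectors at φ x are distinguished by the differential of a chart. Applied to this
  -- vector-valued function, both sides become the same commutator of iterated derivatives.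
  let f : M' → E' := extChartAt I' (φ x)
  have hf : ContMDiffAt I' 𝓘(ℝ, E') ∞ f (φ x) := contMDiffAt_extChartAt
  have hinj : Function.Injective (mvfderiv I' f (φ x)) := by
    have : IsManifold I' 1 M' := IsManifold.of_le (n := ∞) (by simp)
    exact (isInvertible_mfderiv_extChartAt (I := I') (mem_extChartAt_source (φ x))).injective
  refine hinj ?_
  have hev : ∀ (Z : ∀ x : M, TangentSpace I x) (Z' : ∀ x : M', TangentSpace I' x),
      (∀ᶠ y in 𝓝 x, mfderiv I I' φ y (Z y) = Z' (φ y)) →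
      (fun y => mvfderiv I (fun y => f (φ y)) y (Z y)) =ᶠ[𝓝 x]
        fun y => mvfderiv I' f (φ y) (Z' (φ y)) := by
    intro Z Z' hZ
    filter_upwards [hZ, eventually_mdifferentiableAt hφ,
      hφ.continuousAt (eventually_mdifferentiableAt hf)] with y h₁ h₂ h₃
    rw [mvfderiv_comp_vector h₃ h₂, h₁]
  have hd := hφ.mdifferentiableAt (by simp)
  rw [← mvfderiv_comp_vector (hf.mdifferentiableAt (by simp)) hd,
    mvfderiv_mlieBracket hX hY
      (show ContMDiffAt I 𝓘(ℝ, E') ∞ (fun y => f (φ y)) x from hf.comp x hφ),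
    mvfderiv_mlieBracket hX' hY' hf,
    mvfderiv_congr (hev X X' hXX'), mvfderiv_congr (hev Y Y' hYY'),
    mvfderiv_comp_vector (h := fun y => mvfderiv I' f y (X' y))
      ((contMDiffAt_mvfderiv_apply hX' hf).mdifferentiableAt (by simp)) hd,
    mvfderiv_comp_vector (h := fun y => mvfderiv I' f y (Y' y))
      ((contMDiffAt_mvfderiv_apply hY' hf).mdifferentiableAt (by simp)) hd,
    hXX'.self_of_nhds, hYY'.self_of_nhds]

/-! ### Coordinate vector fields -/

/-- The vector field with constant coefficients `v` in the chart at `x₀`. -/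
noncomputable def chartField (I : ModelWithCorners ℝ E H) (x₀ : M) (v : E) (x : M) :
    TangentSpace I x :=
  VectorField.mpullback I 𝓘(ℝ, E) (extChartAt I x₀) (fun _ => v) x

theorem contMDiffAt_chartField {x₀ x : M} (hx : x ∈ (extChartAt I x₀).source) (v : E) :
    ContMDiffAt I I.tangent ∞ (sectionMap I (chartField I x₀ v)) x := by
  have : IsManifold I 1 M := IsManifold.of_le (n := ∞) (by simp)
  have : IsManifold I (∞ + 1) M := by simpa using ‹IsManifold I ∞ M›
  refine ContMDiffAt.mpullback_vectorField_preimage (n := ∞) ?_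
    (contMDiffAt_extChartAt' (by simpa [extChartAt_source] using hx))
    (isInvertible_mfderiv_extChartAt hx) (by simp)
  exact contMDiffAt_vectorSpace_iff_contDiffAt.2 contDiffAt_const

theorem chartRep_chartField {x₀ : M} {y : E} (hy : y ∈ (extChartAt I x₀).target) (v : E) :
    chartRep x₀ (chartField I x₀ v) y = v := by
  have : IsManifold I 1 M := IsManifold.of_le (n := ∞) (by simp)
  have hx : (extChartAt I x₀).symm y ∈ (extChartAt I x₀).source := (extChartAt I x₀).map_target hy
  have h := mfderiv_extChartAt_comp_mfderivWithin_extChartAt_symm (I := I) hy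
  rw [I.range_eq_univ, mfderivWithin_univ] at h
  have h₁ := mfderiv_symm_chartRep hy (chartField I x₀ v)
  have h₂ : mfderiv I 𝓘(ℝ, E) (extChartAt I x₀) ((extChartAt I x₀).symm y)
      (chartField I x₀ v ((extChartAt I x₀).symm y)) = v :=
    (isInvertible_mfderiv_extChartAt (I := I) hx).self_apply_inverse _
  rw [← h₁] at h₂
  refine Eq.trans ?_ h₂
  exact (DFunLike.congr_fun h (chartRep x₀ (chartField I x₀ v) y)).symm

/-- Partial derivatives in a chart are derivatives along coordinate vector fields. -/
theorem fderiv_comp_symm {x₀ : M} {y : E} (hy : y ∈ (extChartAt I x₀).target)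
    {f : M → F} (hf : MDifferentiableAt I 𝓘(ℝ, F) f ((extChartAt I x₀).symm y)) (v : E) :
    fderiv ℝ (fun z => f ((extChartAt I x₀).symm z)) y v =
      mvfderiv I f ((extChartAt I x₀).symm y) (chartField I x₀ v ((extChartAt I x₀).symm y)) := by
  rw [← fderiv_comp_symm_chartRep hy hf, chartRep_chartField hy]

theorem eq_of_chartRep_eq {x₀ : M} {y : E} (hy : y ∈ (extChartAt I x₀).target)
    {X Y : ∀ x : M, TangentSpace I x} (h : chartRep x₀ X y = chartRep x₀ Y y) :
    X ((extChartAt I x₀).symm y) = Y ((extChartAt I x₀).symm y) := by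
  refine (mfderiv_symm_chartRep hy X).symm.trans (Eq.trans ?_ (mfderiv_symm_chartRep hy Y))
  exact congrArg (mfderiv 𝓘(ℝ, E) I (extChartAt I x₀).symm y) h

theorem chartField_chartRep {x₀ : M} {y : E} (hy : y ∈ (extChartAt I x₀).target)
    (X : ∀ x : M, TangentSpace I x) :
    chartField I x₀ (chartRep x₀ X y) ((extChartAt I x₀).symm y) =
      X ((extChartAt I x₀).symm y) := by
  exact eq_of_chartRep_eq hy (X := chartField I x₀ (chartRep x₀ X y)) (chartRep_chartField hy _)

theorem chartField_mlieBracket {x₀ : M} {y : E} (hy : y ∈ (extChartAt I x₀).target) (v w : E) :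
    VectorField.mlieBracket I (chartField I x₀ v) (chartField I x₀ w)
      ((extChartAt I x₀).symm y) = 0 := by
  have hx : (extChartAt I x₀).symm y ∈ (extChartAt I x₀).source := (extChartAt I x₀).map_target hy
  have h := chartRep_mlieBracket hy (contMDiffAt_chartField hx v) (contMDiffAt_chartField hx w)
  have hc : ∀ u : E, chartRep x₀ (chartField I x₀ u) =ᶠ[𝓝 y] fun _ => u := fun u => by
    filter_upwards [(isOpen_extChartAt_target x₀).mem_nhds hy] with z hz
    exact chartRep_chartField hz u
  rw [VectorField.lieBracket, (hc v).fderiv_eq, (hc w).fderiv_eq] at h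
  refine eq_of_chartRep_eq (I := I) (Y := 0) hy (h.trans (Eq.trans (by simp; rfl)
    (congrFun VectorField.mpullback_zero y).symm))

theorem chartField_linear (I : ModelWithCorners ℝ E H) (x₀ x : M) (c : ℝ) (v w : E) :
    chartField I x₀ (c • v + w) x = c • chartField I x₀ v x + chartField I x₀ w x := by
  simp only [chartField]
  exact (ContinuousLinearMap.map_add _ _ _).trans
    (congrArg (· + _) (ContinuousLinearMap.map_smul _ c v))

end VectorFields

/-! ### The Koszul formula and the Levi-Civita connection. -/

section LeviCivita

open Filter Topology VectorField

variable {E : Type*} [NormedAddCommGroup E] [NormedSpace ℝ E] [FiniteDimensional ℝ E]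
  {H : Type*} [TopologicalSpace H] {I : ModelWithCorners ℝ E H} [I.Boundaryless]
  {M : Type*} [TopologicalSpace M] [ChartedSpace H M] [IsManifold I ∞ M]

theorem isManifold_of_le_infty {n : WithTop ℕ∞} (h : n ≤ ∞) : IsManifold I n M :=
  IsManifold.of_le (n := ∞) h

theorem mdifferentiableAt_add_field {X Y : ∀ x : M, TangentSpace I x} {x : M}
    (hX : MDifferentiableAt I I.tangent (sectionMap I X) x)
    (hY : MDifferentiableAt I I.tangent (sectionMap I Y) x) :
    MDifferentiableAt I I.tangent (sectionMap I (X + Y)) x := by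
  have : IsManifold I 1 M := isManifold_of_le_infty (by simp)
  exact mdifferentiableAt_add_section hX hY

namespace PseudoRiemannianMetric

variable (g : PseudoRiemannianMetric I M)

/-- Smoothness of a metric is assumed only for its quadratic form; polarization transfers it to
scalar products of different fields. -/
theorem val_eq_polar (x : M) (v w : TangentSpace I x) :
    g.val x v w = (1 / 2 : ℝ) * (g.val x (v + w) (v + w) - g.val x v v - g.val x w w) := by
  simp only [map_add, LinearMap.add_apply, g.symm x w v]
  ring

variable {X Y Z X' : ∀ x : M, TangentSpace I x} {x : M}

theorem mdifferentiableAt_val (hX : MDifferentiableAt I I.tangent (sectionMap I X) x)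
    (hY : MDifferentiableAt I I.tangent (sectionMap I Y) x) :
    MDifferentiableAt I 𝓘(ℝ, ℝ) (fun y => g.val y (X y) (Y y)) x := by
  have hq : ∀ {Z : ∀ x : M, TangentSpace I x},
      MDifferentiableAt I I.tangent (sectionMap I Z) x →
      MDifferentiableAt I 𝓘(ℝ, ℝ) (fun y => g.val y (Z y) (Z y)) x := fun {Z} hZ =>
    MDifferentiableAt.comp (g := fun v : TangentBundle I M => g.val v.proj v.snd v.snd) x
      ((g.smooth _).mdifferentiableAt (by simp)) hZ
  have h := (((hq (mdifferentiableAt_add_field hX hY)).sub (hq hX)).sub (hq hY)).const_smul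
    (1 / 2 : ℝ)
  refine h.congr_of_eventuallyEq (Eventually.of_forall fun y => ?_)
  exact g.val_eq_polar y (X y) (Y y)

theorem contMDiffAt_val (hX : ContMDiffAt I I.tangent ∞ (sectionMap I X) x)
    (hY : ContMDiffAt I I.tangent ∞ (sectionMap I Y) x) :
    ContMDiffAt I 𝓘(ℝ, ℝ) ∞ (fun y => g.val y (X y) (Y y)) x := by
  have hq : ∀ {Z : ∀ x : M, TangentSpace I x},
      ContMDiffAt I I.tangent ∞ (sectionMap I Z) x →
      ContMDiffAt I 𝓘(ℝ, ℝ) ∞ (fun y => g.val y (Z y) (Z y)) x := fun {Z} hZ =>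
    ContMDiffAt.comp (g := fun v : TangentBundle I M => g.val v.proj v.snd v.snd) x
      (g.smooth _) hZ
  have h := contMDiffAt_const (c := (1 / 2 : ℝ)) (I := I) (I' := 𝓘(ℝ, ℝ)) (x := x) (n := ∞)
    |>.mul (((hq (hX.add_section hY)).sub (hq hX)).sub (hq hY))
  refine h.congr_of_eventuallyEq (Eventually.of_forall fun y => ?_)
  exact g.val_eq_polar y (X y) (Y y)

theorem mvfderiv_val_smul {f : M → ℝ} (hf : MDifferentiableAt I 𝓘(ℝ, ℝ) f x)
    (hX : MDifferentiableAt I I.tangent (sectionMap I X) x)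
    (hY : MDifferentiableAt I I.tangent (sectionMap I Y) x) (v : TangentSpace I x) :
    mvfderiv I (fun y => g.val y ((f • X) y) (Y y)) x v =
      f x * mvfderiv I (fun y => g.val y (X y) (Y y)) x v +
        g.val x (X x) (Y x) * mvfderiv I f x v := by
  have h : (fun y => g.val y ((f • X) y) (Y y)) = f * fun y => g.val y (X y) (Y y) := by
    ext y; simp
  rw [h, mvfderiv_mul hf (g.mdifferentiableAt_val hX hY)]
  simp

theorem mvfderiv_val_add (hX : MDifferentiableAt I I.tangent (sectionMap I X) x)
    (hX' : MDifferentiableAt I I.tangent (sectionMap I X') x)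
    (hY : MDifferentiableAt I I.tangent (sectionMap I Y) x) (v : TangentSpace I x) :
    mvfderiv I (fun y => g.val y ((X + X') y) (Y y)) x v =
      mvfderiv I (fun y => g.val y (X y) (Y y)) x v +
        mvfderiv I (fun y => g.val y (X' y) (Y y)) x v := by
  have h : (fun y => g.val y ((X + X') y) (Y y)) =
      (fun y => g.val y (X y) (Y y)) + fun y => g.val y (X' y) (Y y) := by
    ext y; simp
  rw [h, mvfderiv_add (g.mdifferentiableAt_val hX hY) (g.mdifferentiableAt_val hX' hY)]
  simp

theorem val_fun_comm (X Y : ∀ x : M, TangentSpace I x) :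
    (fun y => g.val y (X y) (Y y)) = fun y => g.val y (Y y) (X y) :=
  funext fun y => g.symm y _ _

/-- The terms containing the differential of f cancel between derivatives and brackets. This and the
next three lemmas make the expression tensorial in its first and third arguments, so its value does
not depend on how tangent vectors are extended to fields. -/
theorem koszul_smul_left {f : M → ℝ} (hf : MDifferentiableAt I 𝓘(ℝ, ℝ) f x)
    (hX : MDifferentiableAt I I.tangent (sectionMap I X) x)
    (hY : MDifferentiableAt I I.tangent (sectionMap I Y) x)
    (hZ : MDifferentiableAt I I.tangent (sectionMap I Z) x) :
    g.koszul (f • X) Y Z x = f x * g.koszul X Y Z x := by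
  have : IsManifold I 2 M := isManifold_of_le_infty two_le_infty
  simp only [koszul]
  rw [g.val_fun_comm Z (f • X), g.mvfderiv_val_smul hf hX hZ, g.mvfderiv_val_smul hf hX hY,
    mlieBracket_smul_left hf hX, mlieBracket_smul_right hf hX, g.val_fun_comm Z X]
  simp only [Pi.smul_apply', map_add, map_smul, LinearMap.add_apply, LinearMap.smul_apply,
    smul_eq_mul, map_neg, LinearMap.neg_apply, neg_smul]
  ring

theorem koszul_smul_right {f : M → ℝ} (hf : MDifferentiableAt I 𝓘(ℝ, ℝ) f x)
    (hX : MDifferentiableAt I I.tangent (sectionMap I X) x)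
    (hY : MDifferentiableAt I I.tangent (sectionMap I Y) x)
    (hZ : MDifferentiableAt I I.tangent (sectionMap I Z) x) :
    g.koszul X Y (f • Z) x = f x * g.koszul X Y Z x := by
  have : IsManifold I 2 M := isManifold_of_le_infty two_le_infty
  simp only [koszul]
  rw [g.val_fun_comm Y (f • Z), g.mvfderiv_val_smul hf hZ hX, g.mvfderiv_val_smul hf hZ hY,
    mlieBracket_smul_left hf hZ, mlieBracket_smul_right hf hZ, g.val_fun_comm Y Z]
  simp only [Pi.smul_apply', map_add, map_smul, LinearMap.add_apply, LinearMap.smul_apply,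
    smul_eq_mul, map_neg, LinearMap.neg_apply, neg_smul, g.symm x (Z x)]
  ring

theorem koszul_add_left (hX : MDifferentiableAt I I.tangent (sectionMap I X) x)
    (hX' : MDifferentiableAt I I.tangent (sectionMap I X') x)
    (hY : MDifferentiableAt I I.tangent (sectionMap I Y) x)
    (hZ : MDifferentiableAt I I.tangent (sectionMap I Z) x) :
    g.koszul (X + X') Y Z x = g.koszul X Y Z x + g.koszul X' Y Z x := by
  have : IsManifold I 2 M := isManifold_of_le_infty two_le_infty
  simp only [koszul]
  rw [g.val_fun_comm Z (X + X'), g.mvfderiv_val_add hX hX' hZ, g.mvfderiv_val_add hX hX' hY,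
    mlieBracket_add_left hX hX', mlieBracket_add_right hX hX', g.val_fun_comm Z X,
    g.val_fun_comm Z X']
  simp only [Pi.add_apply, map_add, LinearMap.add_apply]
  ring

theorem koszul_add_right (hX : MDifferentiableAt I I.tangent (sectionMap I X) x)
    (hX' : MDifferentiableAt I I.tangent (sectionMap I X') x)
    (hY : MDifferentiableAt I I.tangent (sectionMap I Y) x)
    (hZ : MDifferentiableAt I I.tangent (sectionMap I Z) x) :
    g.koszul Y Z (X + X') x = g.koszul Y Z X x + g.koszul Y Z X' x := by
  have : IsManifold I 2 M := isManifold_of_le_infty two_le_infty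
  simp only [koszul]
  rw [g.val_fun_comm Z (X + X'), g.mvfderiv_val_add hX hX' hZ, g.mvfderiv_val_add hX hX' hY,
    mlieBracket_add_left hX hX', mlieBracket_add_right hX hX', g.val_fun_comm Z X,
    g.val_fun_comm Z X']
  simp only [Pi.add_apply, map_add, LinearMap.add_apply]
  ring

theorem tensorialAt_koszul_left (hY : MDifferentiableAt I I.tangent (sectionMap I Y) x)
    (hZ : MDifferentiableAt I I.tangent (sectionMap I Z) x) :
    TensorialAt I E (fun X : ∀ x : M, TangentSpace I x => g.koszul X Y Z x) x where
  smul hf hX := g.koszul_smul_left hf hX hY hZ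
  add hX hX' := g.koszul_add_left hX hX' hY hZ

theorem tensorialAt_koszul_right (hX : MDifferentiableAt I I.tangent (sectionMap I X) x)
    (hY : MDifferentiableAt I I.tangent (sectionMap I Y) x) :
    TensorialAt I E (fun Z : ∀ x : M, TangentSpace I x => g.koszul X Y Z x) x where
  smul hf hZ := g.koszul_smul_right hf hX hY hZ
  add hZ hZ' := g.koszul_add_right hZ hZ' hX hY

theorem mdifferentiableAt_extend_field (v : TangentSpace I x) :
    MDifferentiableAt I I.tangent
      (sectionMap I (FiberBundle.extend (E := fun x : M => TangentSpace I x) E v)) x := by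
  have : IsManifold I (1 + 1) M := isManifold_of_le_infty two_le_infty
  exact FiberBundle.mdifferentiableAt_extend I E v

theorem extend_field_self (v : TangentSpace I x) :
    FiberBundle.extend (E := fun x : M => TangentSpace I x) E v x = v :=
  FiberBundle.extend_apply_self E v

/-- `nabla` imposes this equation only on a basis. Tensoriality makes the right-hand side linear in
w, although the extension of w is a mere choice, so agreement on the basis is enough. -/
theorem val_nabla_extend (hY : MDifferentiableAt I I.tangent (sectionMap I Y) x)
    (v w : TangentSpace I x) :
    g.val x (g.nabla v Y) w =
      g.koszul (FiberBundle.extend E v) Y (FiberBundle.extend E w) x := by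
  have : IsManifold I (1 + 1) M := isManifold_of_le_infty two_le_infty
  have ht := g.tensorialAt_koszul_right (mdifferentiableAt_extend_field v) hY
  rw [nabla, LinearMap.BilinForm.apply_toDual_symm_apply]
  refine LinearMap.congr_fun (f := _) (g := (ht.mkHom _ _).toLinearMap) ?_ w
  refine (Module.finBasis ℝ (TangentSpace I x)).ext fun i => ?_
  rw [Module.Basis.constr_basis]
  exact (ht.mkHom_apply_eq_extend _).symm

/-- The Koszul formula. -/
theorem val_nabla (hX : MDifferentiableAt I I.tangent (sectionMap I X) x)
    (hY : MDifferentiableAt I I.tangent (sectionMap I Y) x)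
    (hZ : MDifferentiableAt I I.tangent (sectionMap I Z) x) :
    g.val x (g.nabla (X x) Y) (Z x) = g.koszul X Y Z x := by
  have : IsManifold I (1 + 1) M := isManifold_of_le_infty two_le_infty
  rw [g.val_nabla_extend hY]
  have h₁ := (g.tensorialAt_koszul_left hY (mdifferentiableAt_extend_field (Z x))).pointwise
    (mdifferentiableAt_extend_field (X x)) hX (extend_field_self _)
  have h₂ := (g.tensorialAt_koszul_right hX hY).pointwise
    (mdifferentiableAt_extend_field (Z x)) hZ (extend_field_self _)
  exact h₁.trans h₂

theorem ext_val {v v' : TangentSpace I x} (h : ∀ w, g.val x v w = g.val x v' w) : v = v' := by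
  rw [← sub_eq_zero]
  refine (g.nondegenerate x).1 _ fun w => ?_
  rw [map_sub, LinearMap.sub_apply, h, sub_self]

theorem isLinearMap_nabla (hY : MDifferentiableAt I I.tangent (sectionMap I Y) x) :
    IsLinearMap ℝ fun v : TangentSpace I x => g.nabla v Y := by
  have : IsManifold I (1 + 1) M := isManifold_of_le_infty two_le_infty
  have key : ∀ v w : TangentSpace I x, g.val x (g.nabla v Y) w =
      (g.tensorialAt_koszul_left hY (mdifferentiableAt_extend_field w)).mkHom _ _ v :=
    fun v w => g.val_nabla_extend hY v w
  refine ⟨fun v v' => g.ext_val fun w => ?_, fun c v => g.ext_val fun w => ?_⟩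
  · rw [map_add, LinearMap.add_apply, key, key, key, map_add]
  · rw [map_smul, LinearMap.smul_apply, key, key, map_smul]

/-- The Levi-Civita connection is metric. -/
theorem mvfderiv_val (hX : MDifferentiableAt I I.tangent (sectionMap I X) x)
    (hY : MDifferentiableAt I I.tangent (sectionMap I Y) x) (v : TangentSpace I x) :
    mvfderiv I (fun y => g.val y (X y) (Y y)) x v =
      g.val x (g.nabla v X) (Y x) + g.val x (X x) (g.nabla v Y) := by
  -- Extend v to a field V and add the Koszul expressions for (V, X, Y) and (V, Y, X): all terms
  -- cancel in pairs except the derivative of g(X, Y) along V.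
  have hV := mdifferentiableAt_extend_field v
  set V : ∀ x : M, TangentSpace I x := FiberBundle.extend E v with hVdef
  have hVx : V x = v := extend_field_self v
  rw [← hVx, g.symm x (X x), g.val_nabla hV hX hY, g.val_nabla hV hY hX]
  simp only [koszul]
  rw [mlieBracket_swap_apply (V := X) (W := Y), mlieBracket_swap_apply (V := V) (W := Y),
    mlieBracket_swap_apply (V := X) (W := V), g.val_fun_comm Y X, g.val_fun_comm Y V,
    g.val_fun_comm X V]
  simp only [map_neg, LinearMap.neg_apply]
  ring

theorem contMDiffAt_mlieBracket_field (hX : ContMDiffAt I I.tangent ∞ (sectionMap I X) x)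
    (hY : ContMDiffAt I I.tangent ∞ (sectionMap I Y) x) :
    ContMDiffAt I I.tangent ∞ (sectionMap I (mlieBracket I X Y)) x := by
  have : IsManifold I (((⊤ : ℕ∞) : WithTop ℕ∞) + 1) M := by simpa using ‹IsManifold I ∞ M›
  have : IsManifold I (minSmoothness ℝ 2) M :=
    isManifold_of_le_infty (by simpa using two_le_infty)
  have : IsManifold I (minSmoothness ℝ 3) M :=
    isManifold_of_le_infty (by simpa using three_le_infty)
  exact ContMDiffAt.mlieBracket_vectorField (m := ⊤) (n := ⊤) hX hY (by simp)

theorem contMDiffAt_koszul (hX : ContMDiffAt I I.tangent ∞ (sectionMap I X) x)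
    (hY : ContMDiffAt I I.tangent ∞ (sectionMap I Y) x)
    (hZ : ContMDiffAt I I.tangent ∞ (sectionMap I Z) x) :
    ContMDiffAt I 𝓘(ℝ, ℝ) ∞ (g.koszul X Y Z) x := by
  refine contMDiffAt_const.mul ?_
  refine (((((?_ : ContMDiffAt I 𝓘(ℝ, ℝ) ∞ _ x).add ?_).sub ?_).add ?_).sub ?_).add ?_
  · exact contMDiffAt_mvfderiv_apply hX (g.contMDiffAt_val hY hZ)
  · exact contMDiffAt_mvfderiv_apply hY (g.contMDiffAt_val hZ hX)
  · exact contMDiffAt_mvfderiv_apply hZ (g.contMDiffAt_val hX hY)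
  · exact g.contMDiffAt_val (contMDiffAt_mlieBracket_field hX hY) hZ
  · exact g.contMDiffAt_val (contMDiffAt_mlieBracket_field hY hZ) hX
  · exact g.contMDiffAt_val (contMDiffAt_mlieBracket_field hZ hX) hY

/-- `g(∇_X Y, Z)` is smooth. -/
theorem contMDiffAt_val_nabla (hX : ContMDiffAt I I.tangent ∞ (sectionMap I X) x)
    (hY : ContMDiffAt I I.tangent ∞ (sectionMap I Y) x)
    (hZ : ContMDiffAt I I.tangent ∞ (sectionMap I Z) x) :
    ContMDiffAt I 𝓘(ℝ, ℝ) ∞ (fun y => g.val y (g.nabla (X y) Y) (Z y)) x := by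
  refine (g.contMDiffAt_koszul hX hY hZ).congr_of_eventuallyEq ?_
  filter_upwards [eventually_mdifferentiableAt hX, eventually_mdifferentiableAt hY,
    eventually_mdifferentiableAt hZ] with y h₁ h₂ h₃
  exact g.val_nabla h₁ h₂ h₃

end PseudoRiemannianMetric

end LeviCivita

/-! ### Connection and curvature coefficients in orthonormal frames. -/

section Frames

open Filter Topology VectorField

variable {E : Type*} [NormedAddCommGroup E] [NormedSpace ℝ E] [FiniteDimensional ℝ E]
  {H : Type*} [TopologicalSpace H] {I : ModelWithCorners ℝ E H} [I.Boundaryless]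
  {M : Type*} [TopologicalSpace M] [ChartedSpace H M] [IsManifold I ∞ M]
  {ι : Type*} [Fintype ι] [DecidableEq ι]
  {g : PseudoRiemannianMetric I M} {ε : ι → ℤˣ} {A : Type*}

namespace SpinStructure

variable (σ : SpinStructure g ε A) {a b : A} {x : M} {X Y Z : ∀ x : M, TangentSpace I x}

theorem U_mem_nhds (hx : x ∈ σ.U a) : σ.U a ∈ 𝓝 x := (σ.isOpen_U a).mem_nhds hx

theorem contMDiffAt_frame (hx : x ∈ σ.U a) (i : ι) :
    ContMDiffAt I I.tangent ∞ (sectionMap I (σ.frame a i)) x :=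
  (σ.smooth_frame a i).contMDiffAt (σ.U_mem_nhds hx)

theorem mdifferentiableAt_frame (hx : x ∈ σ.U a) (i : ι) :
    MDifferentiableAt I I.tangent (sectionMap I (σ.frame a i)) x :=
  (σ.contMDiffAt_frame hx i).mdifferentiableAt (by simp)

theorem frame_expansion (hx : x ∈ σ.U a) (v : TangentSpace I x) :
    v = ∑ i, (((ε i : ℤ) : ℝ) * g.val x (σ.frame a i x) v) • σ.frame a i x := by
  have hv : v ∈ Submodule.span ℝ (Set.range fun i => σ.frame a i x) := by
    rw [σ.span_frame a x hx]; trivial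
  induction hv using Submodule.span_induction with
  | mem v hv =>
    obtain ⟨j, rfl⟩ := hv
    simp [σ.orthonormal a x hx, intUnit_mul_self]
  | zero => simp
  | add v w _ _ hv hw =>
    conv_lhs => rw [hv, hw]
    simp only [map_add, mul_add, add_smul, Finset.sum_add_distrib]
  | smul c v _ hv =>
    conv_lhs => rw [hv]
    simp only [map_smul, smul_eq_mul, Finset.smul_sum, smul_smul]
    refine Finset.sum_congr rfl fun i _ => ?_
    congr 1; ring

theorem val_eq_sum_frame (hx : x ∈ σ.U a) (v w : TangentSpace I x) :
    g.val x v w = ∑ i, ((ε i : ℤ) : ℝ) * (g.val x v (σ.frame a i x) * g.val x w (σ.frame a i x)) := by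
  conv_lhs => rw [σ.frame_expansion hx v]
  rw [map_sum, LinearMap.sum_apply]
  refine Finset.sum_congr rfl fun i _ => ?_
  rw [map_smul, LinearMap.smul_apply, smul_eq_mul, g.symm x (σ.frame a i x) v,
    g.symm x (σ.frame a i x) w, mul_assoc]

theorem eq_zero_of_val_frame (hx : x ∈ σ.U a) {v : TangentSpace I x}
    (h : ∀ i, g.val x v (σ.frame a i x) = 0) : v = 0 := by
  rw [σ.frame_expansion hx v]
  refine Finset.sum_eq_zero fun i _ => ?_
  rw [g.symm, h, mul_zero, zero_smul]

/-- Expanding X in the frame reduces smoothness of a field to that of finitely many functions. For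
∇_X Y these functions are given by the Koszul formula. -/
theorem contMDiffAt_of_val_frame (hx : x ∈ σ.U a)
    (h : ∀ i, ContMDiffAt I 𝓘(ℝ, ℝ) ∞ (fun y => g.val y (X y) (σ.frame a i y)) x) :
    ContMDiffAt I I.tangent ∞ (sectionMap I X) x := by
  have : IsManifold I (∞ + 1) M := by simpa using ‹IsManifold I ∞ M›
  have hs : ContMDiffAt I I.tangent ∞ (sectionMap I fun y => ∑ i,
      (((ε i : ℤ) : ℝ) * g.val y (X y) (σ.frame a i y)) • σ.frame a i y) x :=
    ContMDiffAt.sum_section fun i _ =>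
      ((contMDiffAt_const.mul (h i)).smul_section (σ.contMDiffAt_frame hx i))
  refine hs.congr_of_eventuallyEq ?_
  filter_upwards [σ.U_mem_nhds hx] with y hy
  simp only [sectionMap]
  congr 1
  conv_lhs => rw [σ.frame_expansion hy (X y)]
  simp only [g.symm y (X y)]

/-- The covariant derivative of a smooth field along a smooth field is smooth. -/
theorem contMDiffAt_nabla (σ : SpinStructure g ε A)
    (hX : ContMDiffAt I I.tangent ∞ (sectionMap I X) x)
    (hY : ContMDiffAt I I.tangent ∞ (sectionMap I Y) x) :
    ContMDiffAt I I.tangent ∞ (sectionMap I fun y => g.nabla (X y) Y) x := by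
  obtain ⟨a, hx⟩ := σ.cover x
  exact σ.contMDiffAt_of_val_frame hx fun i =>
    g.contMDiffAt_val_nabla hX hY (σ.contMDiffAt_frame hx i)

/-- The connection coefficients `g(∇_v eᵢ, eⱼ)` of a frame. -/
noncomputable def frameCoeff (a : A) {x : M} (v : TangentSpace I x) (i j : ι) : ℝ :=
  g.val x (g.nabla v (σ.frame a i)) (σ.frame a j x)

theorem connectionForm_eq (a : A) {x : M} (v : TangentSpace I x) :
    σ.connectionForm a v = spinLift ε (σ.frameCoeff a v) := rfl

theorem involute_connectionForm (a : A) {x : M} (v : TangentSpace I x) :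
    CliffordAlgebra.involute (σ.connectionForm a v) = σ.connectionForm a v := by
  rw [connectionForm_eq, involute_spinLift]

/-- Differentiate the locally constant function g(eᵢ, eⱼ) with the metric connection. -/
theorem frameCoeff_skew (hx : x ∈ σ.U a) (v : TangentSpace I x) (i j : ι) :
    σ.frameCoeff a v i j = -σ.frameCoeff a v j i := by
  have h := g.mvfderiv_val (σ.mdifferentiableAt_frame hx i) (σ.mdifferentiableAt_frame hx j) v
  have hc : (fun y => g.val y (σ.frame a i y) (σ.frame a j y)) =ᶠ[𝓝 x]
      fun _ => if i = j then ((ε i : ℤ) : ℝ) else 0 := by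
    filter_upwards [σ.U_mem_nhds hx] with y hy
    exact σ.orthonormal a y hy i j
  rw [mvfderiv_congr hc, mvfderiv_const, zero_apply, g.symm x (σ.frame a i x)] at h
  rw [frameCoeff, frameCoeff]
  linarith

theorem frameCoeff_add (hx : x ∈ σ.U a) (v w : TangentSpace I x) :
    σ.frameCoeff a (v + w) = σ.frameCoeff a v + σ.frameCoeff a w := by
  ext i j
  simp only [frameCoeff, (g.isLinearMap_nabla (σ.mdifferentiableAt_frame hx i)).map_add,
    map_add, LinearMap.add_apply, Pi.add_apply]

theorem frameCoeff_smul (hx : x ∈ σ.U a) (c : ℝ) (v : TangentSpace I x) :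
    σ.frameCoeff a (c • v) = c • σ.frameCoeff a v := by
  ext i j
  simp only [frameCoeff, (g.isLinearMap_nabla (σ.mdifferentiableAt_frame hx i)).map_smul,
    map_smul, LinearMap.smul_apply, Pi.smul_apply]

theorem connectionForm_add (hx : x ∈ σ.U a) (v w : TangentSpace I x) :
    σ.connectionForm a (v + w) = σ.connectionForm a v + σ.connectionForm a w := by
  simp only [connectionForm_eq, σ.frameCoeff_add hx, map_add]

theorem connectionForm_smul (hx : x ∈ σ.U a) (c : ℝ) (v : TangentSpace I x) :
    σ.connectionForm a (c • v) = c • σ.connectionForm a v := by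
  simp only [connectionForm_eq, σ.frameCoeff_smul hx, map_smul]

theorem contMDiffAt_frameCoeff (hx : x ∈ σ.U a)
    (hX : ContMDiffAt I I.tangent ∞ (sectionMap I X) x) (i j : ι) :
    ContMDiffAt I 𝓘(ℝ, ℝ) ∞ (fun y => σ.frameCoeff a (X y) i j) x :=
  g.contMDiffAt_val_nabla hX (σ.contMDiffAt_frame hx i) (σ.contMDiffAt_frame hx j)

end SpinStructure

/-! ### Curvature -/

namespace PseudoRiemannianMetric

/-- The curvature is skew with respect to the metric. -/
theorem val_curvature_skew (σ : SpinStructure g ε A) {x : M} {X Y Z W : ∀ x : M, TangentSpace I x}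
    (hX : ContMDiffAt I I.tangent ∞ (sectionMap I X) x)
    (hY : ContMDiffAt I I.tangent ∞ (sectionMap I Y) x)
    (hZ : ContMDiffAt I I.tangent ∞ (sectionMap I Z) x)
    (hW : ContMDiffAt I I.tangent ∞ (sectionMap I W) x) :
    g.val x (g.curvature X Y Z x) (W x) = -g.val x (g.curvature X Y W x) (Z x) := by
  have hd : ∀ {V : ∀ x : M, TangentSpace I x}, ContMDiffAt I I.tangent ∞ (sectionMap I V) x →
      MDifferentiableAt I I.tangent (sectionMap I V) x := fun h => h.mdifferentiableAt (by simp)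
  -- Second derivative of g(Z, W) along two fields. On antisymmetrizing, the mixed terms g(∇Z, ∇W)
  -- cancel; subtracting the derivative along the bracket leaves exactly the two curvature terms,
  -- whose sum is zero.
  have key : ∀ {V V' : ∀ x : M, TangentSpace I x},
      ContMDiffAt I I.tangent ∞ (sectionMap I V) x → ContMDiffAt I I.tangent ∞ (sectionMap I V') x →
      mvfderiv I (fun y => mvfderiv I (fun y => g.val y (Z y) (W y)) y (V' y)) x (V x) =
        g.val x (g.nabla (V x) fun y => g.nabla (V' y) Z) (W x)
          + g.val x (g.nabla (V' x) Z) (g.nabla (V x) W)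
          + (g.val x (g.nabla (V x) Z) (g.nabla (V' x) W)
          + g.val x (Z x) (g.nabla (V x) fun y => g.nabla (V' y) W)) := by
    intro V V' hV hV'
    have hev : (fun y => mvfderiv I (fun y => g.val y (Z y) (W y)) y (V' y)) =ᶠ[𝓝 x]
        (fun y => g.val y (g.nabla (V' y) Z) (W y)) + fun y => g.val y (Z y) (g.nabla (V' y) W) := by
      filter_upwards [eventually_mdifferentiableAt hZ, eventually_mdifferentiableAt hW] with y h₁ h₂
      exact g.mvfderiv_val h₁ h₂ _
    have h₁ := hd (σ.contMDiffAt_nabla hV' hZ)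
    have h₂ := hd (σ.contMDiffAt_nabla hV' hW)
    rw [mvfderiv_congr hev, mvfderiv_add (g.mdifferentiableAt_val h₁ (hd hW))
      (g.mdifferentiableAt_val (hd hZ) h₂), add_apply, g.mvfderiv_val h₁ (hd hW),
      g.mvfderiv_val (hd hZ) h₂]
  have h := mvfderiv_mlieBracket hX hY (g.contMDiffAt_val hZ hW)
  rw [key hX hY, key hY hX, g.mvfderiv_val (hd hZ) (hd hW)] at h
  simp only [curvature, map_sub, LinearMap.sub_apply, g.symm x _ (Z x)] at h ⊢
  linarith

end PseudoRiemannianMetric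

namespace SpinStructure

variable (σ : SpinStructure g ε A) {a b : A} {x : M} {X Y Z : ∀ x : M, TangentSpace I x}

/-- The components `g(R(X, Y) eᵢ, eⱼ)` of the curvature in a frame. -/
noncomputable def curvatureCoeff (a : A) (X Y : ∀ x : M, TangentSpace I x) (x : M) (i j : ι) : ℝ :=
  g.val x (g.curvature X Y (σ.frame a i) x) (σ.frame a j x)

theorem curvatureCoeff_skew (hx : x ∈ σ.U a)
    (hX : ContMDiffAt I I.tangent ∞ (sectionMap I X) x)
    (hY : ContMDiffAt I I.tangent ∞ (sectionMap I Y) x) (i j : ι) :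
    σ.curvatureCoeff a X Y x i j = -σ.curvatureCoeff a X Y x j i :=
  g.val_curvature_skew σ hX hY (σ.contMDiffAt_frame hx i) (σ.contMDiffAt_frame hx j)

/-- Cartan's equation R = dω + ω ∧ ω in components. The quadratic part arises by metricity from
g(∇_V' eᵢ, ∇_V eⱼ), expanded in the frame. -/
theorem curvatureCoeff_eq (hx : x ∈ σ.U a)
    (hX : ContMDiffAt I I.tangent ∞ (sectionMap I X) x)
    (hY : ContMDiffAt I I.tangent ∞ (sectionMap I Y) x) :
    σ.curvatureCoeff a X Y x =
      (fun i j => mvfderiv I (fun y => σ.frameCoeff a (Y y) i j) x (X x))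
        - (fun i j => mvfderiv I (fun y => σ.frameCoeff a (X y) i j) x (Y x))
        - σ.frameCoeff a (mlieBracket I X Y x)
        + skewBracket ε (σ.frameCoeff a (X x)) (σ.frameCoeff a (Y x)) := by
  have hd : ∀ {V : ∀ x : M, TangentSpace I x}, ContMDiffAt I I.tangent ∞ (sectionMap I V) x →
      MDifferentiableAt I I.tangent (sectionMap I V) x := fun h => h.mdifferentiableAt (by simp)
  have key : ∀ {V V' : ∀ x : M, TangentSpace I x},
      ContMDiffAt I I.tangent ∞ (sectionMap I V) x → ContMDiffAt I I.tangent ∞ (sectionMap I V') x →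
      ∀ i j, g.val x (g.nabla (V x) fun y => g.nabla (V' y) (σ.frame a i)) (σ.frame a j x) =
        mvfderiv I (fun y => σ.frameCoeff a (V' y) i j) x (V x) -
          ∑ k, ((ε k : ℤ) : ℝ) * (σ.frameCoeff a (V' x) i k * σ.frameCoeff a (V x) j k) := by
    intro V V' hV hV' i j
    have h := g.mvfderiv_val (hd (σ.contMDiffAt_nabla hV' (σ.contMDiffAt_frame hx i)))
      (σ.mdifferentiableAt_frame hx j) (V x)
    rw [σ.val_eq_sum_frame hx (g.nabla (V' x) (σ.frame a i))] at h
    exact eq_sub_of_add_eq h.symm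
  ext i j
  simp only [curvatureCoeff, PseudoRiemannianMetric.curvature, map_sub, LinearMap.sub_apply,
    key hX hY, key hY hX, Pi.add_apply, Pi.sub_apply]
  have h : skewBracket ε (σ.frameCoeff a (X x)) (σ.frameCoeff a (Y x)) i j =
      -(∑ k, ((ε k : ℤ) : ℝ) * (σ.frameCoeff a (Y x) i k * σ.frameCoeff a (X x) j k)) +
        ∑ k, ((ε k : ℤ) : ℝ) * (σ.frameCoeff a (X x) i k * σ.frameCoeff a (Y x) j k) := by
    rw [skewBracket, ← Finset.sum_neg_distrib, ← Finset.sum_add_distrib]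
    refine Finset.sum_congr rfl fun k _ => ?_
    rw [σ.frameCoeff_skew hx (X x) j k, σ.frameCoeff_skew hx (Y x) j k]
    ring
  rw [h]
  simp only [frameCoeff]
  ring

/-- The Clifford form of Cartan's structure equation. -/
theorem spinLift_curvatureCoeff (hx : x ∈ σ.U a)
    (hX : ContMDiffAt I I.tangent ∞ (sectionMap I X) x)
    (hY : ContMDiffAt I I.tangent ∞ (sectionMap I Y) x) :
    spinLift ε (σ.curvatureCoeff a X Y x) =
      spinLift ε (fun i j => mvfderiv I (fun y => σ.frameCoeff a (Y y) i j) x (X x))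
        - spinLift ε (fun i j => mvfderiv I (fun y => σ.frameCoeff a (X y) i j) x (Y x))
        - σ.connectionForm a (mlieBracket I X Y x)
        + (σ.connectionForm a (X x) * σ.connectionForm a (Y x)
          - σ.connectionForm a (Y x) * σ.connectionForm a (X x)) := by
  rw [σ.curvatureCoeff_eq hx hX hY, map_add, map_sub, map_sub,
    spinLift_skewBracket ε (σ.frameCoeff_skew hx _) (σ.frameCoeff_skew hx _)]
  rfl

theorem spinLift_curvatureCoeff_eq_zero (hg : g.IsFlat) (hx : x ∈ σ.U a)
    {U : Set M} (hU : IsOpen U) (hxU : x ∈ U)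
    (hX : ContMDiffOn I I.tangent ∞ (sectionMap I X) U)
    (hY : ContMDiffOn I I.tangent ∞ (sectionMap I Y) U) :
    spinLift ε (σ.curvatureCoeff a X Y x) = 0 := by
  have h : σ.curvatureCoeff a X Y x = 0 := by
    ext i j
    -- The frame is smooth only over its own domain, so flatness must be applied to locally defined
    -- fields.
    rw [curvatureCoeff, hg (U ∩ σ.U a) X Y (σ.frame a i) (hU.inter (σ.isOpen_U a))
      (hX.mono Set.inter_subset_left) (hY.mono Set.inter_subset_left)
      ((σ.smooth_frame a i).mono Set.inter_subset_right) x ⟨hxU, hx⟩]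
    simp
  rw [h, map_zero]

/-- The commutator with vectors recovers a skew matrix from its lift, so a vanishing lift gives R(X,
Y)eⱼ = 0 for the frame fields. Skew symmetry moves an arbitrary Z out of the curvature and a frame
field in, which replaces a proof of tensoriality in Z. -/
theorem curvature_eq_zero (hx : x ∈ σ.U a)
    (hX : ContMDiffAt I I.tangent ∞ (sectionMap I X) x)
    (hY : ContMDiffAt I I.tangent ∞ (sectionMap I Y) x)
    (hZ : ContMDiffAt I I.tangent ∞ (sectionMap I Z) x)
    (h : spinLift ε (σ.curvatureCoeff a X Y x) = 0) : g.curvature X Y Z x = 0 := by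
  have hR : ∀ i j, σ.curvatureCoeff a X Y x i j = 0 := by
    intro i j
    have h' := spinLift_commutator_ι ε (σ.curvatureCoeff_skew hx hX hY) (Pi.single i 1)
    rw [h, zero_mul, mul_zero, sub_zero, eq_comm] at h'
    have h'' := congrFun (ι_injective ε (h'.trans (map_zero _).symm)) j
    simp only [Pi.single_apply, ite_mul, one_mul, zero_mul, Finset.sum_ite_eq', Finset.mem_univ,
      if_true, Pi.zero_apply, mul_eq_zero, Int.cast_eq_zero] at h''
    exact h''.resolve_left (ε j).ne_zero
  refine σ.eq_zero_of_val_frame hx fun j => ?_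
  rw [g.val_curvature_skew σ hX hY hZ (σ.contMDiffAt_frame hx j)]
  have h0 : g.curvature X Y (σ.frame a j) x = 0 := σ.eq_zero_of_val_frame hx fun i => hR j i
  rw [h0, map_zero, LinearMap.zero_apply, neg_zero]

end SpinStructure

end Frames

/-! ### The connection form of a product. -/

section ProductConnection

open Filter Topology VectorField

variable {E₁ : Type*} [NormedAddCommGroup E₁] [NormedSpace ℝ E₁] [FiniteDimensional ℝ E₁]
  {H₁ : Type*} [TopologicalSpace H₁] {I₁ : ModelWithCorners ℝ E₁ H₁} [I₁.Boundaryless]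
  {M₁ : Type*} [TopologicalSpace M₁] [ChartedSpace H₁ M₁] [IsManifold I₁ ∞ M₁]
  {ι₁ : Type*} [Fintype ι₁] [DecidableEq ι₁]
  {E₂ : Type*} [NormedAddCommGroup E₂] [NormedSpace ℝ E₂] [FiniteDimensional ℝ E₂]
  {H₂ : Type*} [TopologicalSpace H₂] {I₂ : ModelWithCorners ℝ E₂ H₂} [I₂.Boundaryless]
  {M₂ : Type*} [TopologicalSpace M₂] [ChartedSpace H₂ M₂] [IsManifold I₂ ∞ M₂]
  {ι₂ : Type*} [Fintype ι₂] [DecidableEq ι₂]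
  {g₁ : PseudoRiemannianMetric I₁ M₁} {ε₁ : ι₁ → ℤˣ} {A₁ : Type*}
  {g₂ : PseudoRiemannianMetric I₂ M₂} {ε₂ : ι₂ → ℤˣ} {A₂ : Type*}

/-- The right-hand side of the Koszul formula for fields with constant scalar products. -/
noncomputable def PseudoRiemannianMetric.bracketKoszul (g : PseudoRiemannianMetric I₁ M₁)
    (X Y Z : ∀ x : M₁, TangentSpace I₁ x) (x : M₁) : ℝ :=
  (1 / 2 : ℝ) * (g.val x (mlieBracket I₁ X Y x) (Z x) - g.val x (mlieBracket I₁ Y Z x) (X x)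
    + g.val x (mlieBracket I₁ Z X x) (Y x))

namespace SpinStructure

/-- Scalar products within the frame are locally constant, so the derivative terms of the Koszul
formula vanish. Only brackets remain, and these are computed factor by factor on a product. -/
theorem frameCoeff_frame (σ : SpinStructure g₁ ε₁ A₁) {a : A₁} {x : M₁} (hx : x ∈ σ.U a)
    (k i j : ι₁) : σ.frameCoeff a (σ.frame a k x) i j =
      g₁.bracketKoszul (σ.frame a k) (σ.frame a i) (σ.frame a j) x := by
  have hc : ∀ i j (v : TangentSpace I₁ x),
      mvfderiv I₁ (fun y => g₁.val y (σ.frame a i y) (σ.frame a j y)) x v = 0 := by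
    intro i j v
    have h : (fun y => g₁.val y (σ.frame a i y) (σ.frame a j y)) =ᶠ[𝓝 x]
        fun _ => if i = j then ((ε₁ i : ℤ) : ℝ) else 0 := by
      filter_upwards [σ.U_mem_nhds hx] with y hy
      exact σ.orthonormal a y hy i j
    rw [mvfderiv_congr h, mvfderiv_const, zero_apply]
  rw [frameCoeff, g₁.val_nabla (σ.mdifferentiableAt_frame hx k) (σ.mdifferentiableAt_frame hx i)
    (σ.mdifferentiableAt_frame hx j), PseudoRiemannianMetric.koszul, hc, hc, hc,
    PseudoRiemannianMetric.bracketKoszul]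
  ring

variable (σ₁ : SpinStructure g₁ ε₁ A₁) (σ₂ : SpinStructure g₂ ε₂ A₂)

/-- Each projection relates a product frame field to a frame field of the factor or to the zero
field, and related fields have related brackets. -/
theorem tangentProd_mlieBracket_prodFrame {p : A₁ × A₂} {x : M₁ × M₂}
    (hx : x ∈ (σ₁.prod σ₂).U p) (k i : ι₁ ⊕ ι₂) :
    tangentProd I₁ I₂ x (mlieBracket (I₁.prod I₂) ((σ₁.prod σ₂).frame p k)
        ((σ₁.prod σ₂).frame p i) x) =
      (mlieBracket I₁ (Sum.elim (σ₁.frame p.1) 0 k) (Sum.elim (σ₁.frame p.1) 0 i) x.1,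
        mlieBracket I₂ (Sum.elim 0 (σ₂.frame p.2) k) (Sum.elim 0 (σ₂.frame p.2) i) x.2) := by
  have h₁ : ∀ k : ι₁ ⊕ ι₂, ContMDiffAt I₁ I₁.tangent ∞
      (sectionMap I₁ (Sum.elim (σ₁.frame p.1) 0 k)) x.1 := by
    rintro (k | k)
    · exact σ₁.contMDiffAt_frame hx.1 k
    · exact Bundle.contMDiff_zeroSection ℝ (TangentSpace I₁ : M₁ → Type _) x.1
  have h₂ : ∀ k : ι₁ ⊕ ι₂, ContMDiffAt I₂ I₂.tangent ∞
      (sectionMap I₂ (Sum.elim 0 (σ₂.frame p.2) k)) x.2 := by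
    rintro (k | k)
    · exact Bundle.contMDiff_zeroSection ℝ (TangentSpace I₂ : M₂ → Type _) x.2
    · exact σ₂.contMDiffAt_frame hx.2 k
  have r₁ : ∀ k : ι₁ ⊕ ι₂, ∀ y : M₁ × M₂, mfderiv (I₁.prod I₂) I₁ Prod.fst y
      ((σ₁.prod σ₂).frame p k y) = (Sum.elim (σ₁.frame p.1) 0 k : ∀ x, TangentSpace I₁ x) y.1 := by
    rintro (k | k) y <;> rw [mfderiv_fst] <;> rfl
  have r₂ : ∀ k : ι₁ ⊕ ι₂, ∀ y : M₁ × M₂, mfderiv (I₁.prod I₂) I₂ Prod.snd y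
      ((σ₁.prod σ₂).frame p k y) = (Sum.elim 0 (σ₂.frame p.2) k : ∀ x, TangentSpace I₂ x) y.2 := by
    rintro (k | k) y <;> rw [mfderiv_snd] <;> rfl
  have b₁ := mfderiv_mlieBracket (contMDiffAt_fst (n := ∞))
    ((σ₁.prod σ₂).contMDiffAt_frame hx k) ((σ₁.prod σ₂).contMDiffAt_frame hx i) (h₁ k) (h₁ i)
    (Eventually.of_forall (r₁ k)) (Eventually.of_forall (r₁ i))
  have b₂ := mfderiv_mlieBracket (contMDiffAt_snd (n := ∞))
    ((σ₁.prod σ₂).contMDiffAt_frame hx k) ((σ₁.prod σ₂).contMDiffAt_frame hx i) (h₂ k) (h₂ i)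
    (Eventually.of_forall (r₂ k)) (Eventually.of_forall (r₂ i))
  rw [mfderiv_fst] at b₁
  rw [mfderiv_snd] at b₂
  exact Prod.ext b₁ b₂

theorem bracketKoszul_prodFrame {p : A₁ × A₂} {x : M₁ × M₂}
    (hx : x ∈ (σ₁.prod σ₂).U p) (k i j : ι₁ ⊕ ι₂) :
    (g₁.prod g₂).bracketKoszul ((σ₁.prod σ₂).frame p k) ((σ₁.prod σ₂).frame p i)
        ((σ₁.prod σ₂).frame p j) x =
      g₁.bracketKoszul (Sum.elim (σ₁.frame p.1) 0 k) (Sum.elim (σ₁.frame p.1) 0 i)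
          (Sum.elim (σ₁.frame p.1) 0 j) x.1 +
        g₂.bracketKoszul (Sum.elim 0 (σ₂.frame p.2) k) (Sum.elim 0 (σ₂.frame p.2) i)
          (Sum.elim 0 (σ₂.frame p.2) j) x.2 := by
  have hv : ∀ k : ι₁ ⊕ ι₂, tangentProd I₁ I₂ x ((σ₁.prod σ₂).frame p k x) =
      ((Sum.elim (σ₁.frame p.1) 0 k : ∀ x, TangentSpace I₁ x) x.1,
        (Sum.elim 0 (σ₂.frame p.2) k : ∀ x, TangentSpace I₂ x) x.2) := by
    rintro (k | k) <;> rfl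
  simp only [PseudoRiemannianMetric.bracketKoszul, PseudoRiemannianMetric.prod_val,
    tangentProd_mlieBracket_prodFrame σ₁ σ₂ hx, hv]
  ring

theorem bracketKoszul_zero_left (Y Z : ∀ x : M₁, TangentSpace I₁ x) (x : M₁) :
    g₁.bracketKoszul 0 Y Z x = 0 := by
  simp [PseudoRiemannianMetric.bracketKoszul]

theorem bracketKoszul_zero_middle (X Z : ∀ x : M₁, TangentSpace I₁ x) (x : M₁) :
    g₁.bracketKoszul X 0 Z x = 0 := by
  simp [PseudoRiemannianMetric.bracketKoszul]

theorem bracketKoszul_zero_right (X Y : ∀ x : M₁, TangentSpace I₁ x) (x : M₁) :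
    g₁.bracketKoszul X Y 0 x = 0 := by
  simp [PseudoRiemannianMetric.bracketKoszul]

/-- The connection coefficients of the product of two frames. -/
theorem frameCoeff_prod {p : A₁ × A₂} {x : M₁ × M₂} (hx : x ∈ (σ₁.prod σ₂).U p)
    (v : TangentSpace (I₁.prod I₂) x) :
    (σ₁.prod σ₂).frameCoeff p v =
      Sum.elim (fun i => Sum.elim (σ₁.frameCoeff p.1 (tangentProd I₁ I₂ x v).1 i) 0)
        fun i => Sum.elim 0 (σ₂.frameCoeff p.2 (tangentProd I₁ I₂ x v).2 i) := by
  have hv : v ∈ Submodule.span ℝ (Set.range fun i => (σ₁.prod σ₂).frame p i x) := by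
    rw [(σ₁.prod σ₂).span_frame p x hx]; trivial
  have z₁ : σ₁.frameCoeff p.1 (0 : TangentSpace I₁ x.1) = 0 := by
    simpa using σ₁.frameCoeff_smul hx.1 0 0
  have z₂ : σ₂.frameCoeff p.2 (0 : TangentSpace I₂ x.2) = 0 := by
    simpa using σ₂.frameCoeff_smul hx.2 0 0
  -- Both sides are linear in v, so frame vectors suffice. For them, a Koszul expression with a zero
  -- field in any slot vanishes, which leaves only the coefficients with all indices in one factor.
  induction hv using Submodule.span_induction with
  | mem v hv =>
    obtain ⟨k, rfl⟩ := hv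
    ext i j
    rw [frameCoeff_frame _ hx, bracketKoszul_prodFrame σ₁ σ₂ hx]
    rcases k with k | k
    · have e₁ : (tangentProd I₁ I₂ x ((σ₁.prod σ₂).frame p (.inl k) x)).1 = σ₁.frame p.1 k x.1 :=
        rfl
      have e₂ : (tangentProd I₁ I₂ x ((σ₁.prod σ₂).frame p (.inl k) x)).2 = 0 := rfl
      dsimp only
      rw [e₁, e₂, z₂]
      rcases i with i | i <;> rcases j with j | j <;>
        simp [bracketKoszul_zero_left, bracketKoszul_zero_middle, bracketKoszul_zero_right,
          frameCoeff_frame _ hx.1]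
    · have e₁ : (tangentProd I₁ I₂ x ((σ₁.prod σ₂).frame p (.inr k) x)).1 = 0 :=
        rfl
      have e₂ : (tangentProd I₁ I₂ x ((σ₁.prod σ₂).frame p (.inr k) x)).2 = σ₂.frame p.2 k x.2 :=
        rfl
      dsimp only
      rw [e₁, e₂, z₁]
      rcases i with i | i <;> rcases j with j | j <;>
        simp [bracketKoszul_zero_left, bracketKoszul_zero_middle, bracketKoszul_zero_right,
          frameCoeff_frame _ hx.2]
  | zero =>
    have h0 := (σ₁.prod σ₂).frameCoeff_smul hx 0 0
    rw [zero_smul, zero_smul] at h0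
    rw [h0, map_zero, Prod.fst_zero, Prod.snd_zero, z₁, z₂]
    ext (i | i) (j | j) <;> rfl
  | add v w _ _ hv hw =>
    rw [frameCoeff_add _ hx, hv, hw, map_add, Prod.fst_add, Prod.snd_add,
      frameCoeff_add _ hx.1, frameCoeff_add _ hx.2]
    ext (i | i) (j | j) <;> simp
  | smul c v _ hv =>
    rw [frameCoeff_smul _ hx, hv, map_smul, Prod.smul_fst, Prod.smul_snd,
      frameCoeff_smul _ hx.1, frameCoeff_smul _ hx.2]
    ext (i | i) (j | j) <;> simp

theorem map_cliffordInl_gen (i : ι₁) :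
    CliffordAlgebra.map (cliffordInl ε₁ ε₂) (cliffordGen ε₁ i) =
      cliffordGen (Sum.elim ε₁ ε₂) (.inl i) := by
  rw [cliffordGen, CliffordAlgebra.map_apply_ι, cliffordGen]
  congr 1
  change (Sum.elim (Pi.single i 1) 0 : ι₁ ⊕ ι₂ → ℝ) = Pi.single (.inl i) 1
  ext (j | j) <;> simp [Pi.single_apply]

theorem map_cliffordInr_gen (i : ι₂) :
    CliffordAlgebra.map (cliffordInr ε₁ ε₂) (cliffordGen ε₂ i) =
      cliffordGen (Sum.elim ε₁ ε₂) (.inr i) := by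
  rw [cliffordGen, CliffordAlgebra.map_apply_ι, cliffordGen]
  congr 1
  change (Sum.elim 0 (Pi.single i 1) : ι₁ ⊕ ι₂ → ℝ) = Pi.single (.inr i) 1
  ext (j | j) <;> simp [Pi.single_apply]

/-- The connection form of the product spin structure is the sum of the connection forms of the
factors. -/
theorem connectionForm_prod {p : A₁ × A₂} {x : M₁ × M₂} (hx : x ∈ (σ₁.prod σ₂).U p)
    (v : TangentSpace (I₁.prod I₂) x) :
    (σ₁.prod σ₂).connectionForm p v =
      CliffordAlgebra.map (cliffordInl ε₁ ε₂)
          (σ₁.connectionForm p.1 (tangentProd I₁ I₂ x v).1) +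
        CliffordAlgebra.map (cliffordInr ε₁ ε₂)
          (σ₂.connectionForm p.2 (tangentProd I₁ I₂ x v).2) := by
  simp only [connectionForm_eq, frameCoeff_prod σ₁ σ₂ hx, spinLift_apply, map_smul, map_sum,
    map_mul, map_cliffordInl_gen, map_cliffordInr_gen, ← smul_add, Fintype.sum_sum_type,
    Sum.elim_inl, Sum.elim_inr, Pi.zero_apply, mul_zero, zero_smul, Finset.sum_const_zero,
    add_zero, zero_add]

end SpinStructure

end ProductConnection

/-! ### Differentiation in finite-dimensional spaces without a chosen norm, by linear functionals.
-/

section AlgebraicCalculus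

open Filter Topology

variable {E : Type*} [NormedAddCommGroup E] [NormedSpace ℝ E] [FiniteDimensional ℝ E]
  {H : Type*} [TopologicalSpace H] {I : ModelWithCorners ℝ E H} [I.Boundaryless]
  {M : Type*} [TopologicalSpace M] [ChartedSpace H M] [IsManifold I ∞ M]
  {V W U : Type*} [AddCommGroup V] [Module ℝ V] [AddCommGroup W] [Module ℝ W]
  [AddCommGroup U] [Module ℝ U]
  {F : Type*} [NormedAddCommGroup F] [NormedSpace ℝ F]

/-- `c' v` is the derivative at `x` in the direction `v` of the map `c` with values in a
vector space, tested against linear functionals. -/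
def HasAlgDerivAt (I : ModelWithCorners ℝ E H) (c : M → V) (x : M) (c' : TangentSpace I x → V) :
    Prop :=
  ∀ φ : V →ₗ[ℝ] ℝ, MDifferentiableAt I 𝓘(ℝ, ℝ) (fun y => φ (c y)) x ∧
    ∀ v, mvfderiv I (fun y => φ (c y)) x v = φ (c' v)

/-- Smoothness at a point of a map with values in a vector space, tested against linear
functionals. -/
def AlgSmoothAt (I : ModelWithCorners ℝ E H) (c : M → V) (x : M) : Prop :=
  ∀ φ : V →ₗ[ℝ] ℝ, ContMDiffAt I 𝓘(ℝ, ℝ) ∞ (fun y => φ (c y)) x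

variable {c d : M → V} {x : M} {c' d' : TangentSpace I x → V}

theorem mdifferentiableAt_sum {κ : Type*} {t : Finset κ} {f : κ → M → F}
    (h : ∀ i ∈ t, MDifferentiableAt I 𝓘(ℝ, F) (f i) x) :
    MDifferentiableAt I 𝓘(ℝ, F) (fun y => ∑ i ∈ t, f i y) x ∧
      ∀ v : TangentSpace I x, mvfderiv I (fun y => ∑ i ∈ t, f i y) x v =
        ∑ i ∈ t, mvfderiv I (f i) x v := by
  classical
  induction t using Finset.induction_on with
  | empty => exact ⟨by simpa using mdifferentiableAt_const, fun v => by simp [mvfderiv_const]⟩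
  | insert i t hi ih =>
    have h₁ := h i (Finset.mem_insert_self i t)
    have ⟨h₂, h₃⟩ := ih fun j hj => h j (Finset.mem_insert_of_mem hj)
    simp only [Finset.sum_insert hi]
    refine ⟨h₁.add h₂, fun v => ?_⟩
    rw [← h₃ v, ← add_apply, ← mvfderiv_add h₁ h₂]
    rfl

theorem HasAlgDerivAt.map (h : HasAlgDerivAt I c x c') (L : V →ₗ[ℝ] W) :
    HasAlgDerivAt I (fun y => L (c y)) x fun v => L (c' v) := fun φ => h (φ ∘ₗ L)

theorem HasAlgDerivAt.unique (h : HasAlgDerivAt I c x c') (h' : HasAlgDerivAt I c x d')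
    (v : TangentSpace I x) : c' v = d' v := by
  refine (Module.forall_dual_apply_eq_zero_iff ℝ (c' v - d' v)).1 (fun φ => ?_) |> sub_eq_zero.1
  rw [map_sub, ← (h φ).2, ← (h' φ).2, sub_self]

theorem HasAlgDerivAt.congr (h : HasAlgDerivAt I c x c') (hd : d =ᶠ[𝓝 x] c) :
    HasAlgDerivAt I d x c' := by
  intro φ
  have hφ : (fun y => φ (d y)) =ᶠ[𝓝 x] fun y => φ (c y) := hd.mono fun y hy => by
    simp only [hy]
  exact ⟨(h φ).1.congr_of_eventuallyEq hφ, fun v => by rw [mvfderiv_congr hφ, (h φ).2]⟩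

theorem hasAlgDerivAt_const (c : V) : HasAlgDerivAt I (fun _ : M => c) x fun _ => 0 := fun φ =>
  ⟨mdifferentiableAt_const, fun v => by simp [mvfderiv_const]⟩

/-- A basis expansion of the first factor turns φ(β(c, w)) into a finite sum of products of real
functions, to which the usual product rule applies. This is what permits differentiation of Clifford
products and Clifford actions. -/
theorem HasAlgDerivAt.bilin [FiniteDimensional ℝ V] {w : M → W} {w' : TangentSpace I x → W}
    (β : V →ₗ[ℝ] W →ₗ[ℝ] U)
    (h : HasAlgDerivAt I c x c') (h' : HasAlgDerivAt I w x w') :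
    HasAlgDerivAt I (fun y => β (c y) (w y)) x fun v => β (c' v) (w x) + β (c x) (w' v) := by
  intro φ
  let b := Module.finBasis ℝ V
  have hb : ∀ (e : V) (u : W), φ (β e u) = ∑ i, b.coord i e * (φ ∘ₗ β (b i)) u := by
    intro e u
    conv_lhs => rw [← b.sum_repr e]
    simp only [map_sum, map_smul, LinearMap.sum_apply, LinearMap.smul_apply, smul_eq_mul,
      LinearMap.comp_apply, Module.Basis.coord_apply]
  have hi : ∀ i ∈ Finset.univ, MDifferentiableAt I 𝓘(ℝ, ℝ)
      (fun y => b.coord i (c y) * (φ ∘ₗ β (b i)) (w y)) x := fun i _ =>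
    (h (b.coord i)).1.mul (h' (φ ∘ₗ β (b i))).1
  obtain ⟨h₁, h₂⟩ := mdifferentiableAt_sum hi
  simp only [hb, map_add]
  refine ⟨h₁, fun v => ?_⟩
  rw [h₂, ← Finset.sum_add_distrib]
  refine Finset.sum_congr rfl fun i _ => ?_
  have := mvfderiv_mul (h (b.coord i)).1 (h' (φ ∘ₗ β (b i))).1
  refine (DFunLike.congr_fun this v).trans ?_
  simp only [add_apply, smul_apply, smul_eq_mul, (h (b.coord i)).2, (h' (φ ∘ₗ β (b i))).2]
  ring

theorem AlgSmoothAt.exists_hasAlgDerivAt [FiniteDimensional ℝ V] (h : AlgSmoothAt I c x) :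
    ∃ c', HasAlgDerivAt I c x c' := by
  let b := Module.finBasis ℝ V
  refine ⟨fun v => ∑ i, mvfderiv I (fun y => b.coord i (c y)) x v • b i, fun φ => ?_⟩
  have hd : ∀ φ : V →ₗ[ℝ] ℝ, MDifferentiableAt I 𝓘(ℝ, ℝ) (fun y => φ (c y)) x := fun φ =>
    (h φ).mdifferentiableAt (by simp)
  refine ⟨hd φ, fun v => ?_⟩
  have hφ : (fun y => φ (c y)) = fun y => ∑ i, φ (b i) * b.coord i (c y) := by
    ext y
    conv_lhs => rw [← b.sum_repr (c y)]
    simp only [map_sum, map_smul, smul_eq_mul, Module.Basis.coord_apply, mul_comm]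
  have hi : ∀ i ∈ Finset.univ, MDifferentiableAt I 𝓘(ℝ, ℝ)
      (fun y => φ (b i) * b.coord i (c y)) x := fun i _ =>
    mdifferentiableAt_const.mul (hd (b.coord i))
  rw [hφ, (mdifferentiableAt_sum hi).2 v, map_sum]
  refine Finset.sum_congr rfl fun i _ => ?_
  rw [map_smul, smul_eq_mul, mul_comm]
  have := mvfderiv_mul (f := fun _ : M => φ (b i)) mdifferentiableAt_const (hd (b.coord i))
  refine (DFunLike.congr_fun this v).trans ?_
  simp [mvfderiv_const]

theorem AlgSmoothAt.map (h : AlgSmoothAt I c x) (L : V →ₗ[ℝ] W) :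
    AlgSmoothAt I (fun y => L (c y)) x := fun φ => h (φ ∘ₗ L)

theorem AlgSmoothAt.bilin [FiniteDimensional ℝ V] {w : M → W} (β : V →ₗ[ℝ] W →ₗ[ℝ] U)
    (h : AlgSmoothAt I c x) (h' : AlgSmoothAt I w x) :
    AlgSmoothAt I (fun y => β (c y) (w y)) x := by
  intro φ
  let b := Module.finBasis ℝ V
  have hb : ∀ (e : V) (u : W), φ (β e u) = ∑ i, b.coord i e * (φ ∘ₗ β (b i)) u := by
    intro e u
    conv_lhs => rw [← b.sum_repr e]
    simp only [map_sum, map_smul, LinearMap.sum_apply, LinearMap.smul_apply, smul_eq_mul,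
      LinearMap.comp_apply, Module.Basis.coord_apply]
  simp only [hb]
  exact contMDiffAt_finsetSum fun i _ => (h (b.coord i)).mul (h' (φ ∘ₗ β (b i)))

/-- A linear map to a normed space applied to an algebraically smooth map is smooth. -/
theorem AlgSmoothAt.contMDiffAt [FiniteDimensional ℝ V] (h : AlgSmoothAt I c x) (L : V →ₗ[ℝ] F) :
    ContMDiffAt I 𝓘(ℝ, F) ∞ (fun y => L (c y)) x := by
  let b := Module.finBasis ℝ V
  have hL : (fun y => L (c y)) = fun y => ∑ i, b.coord i (c y) • L (b i) := by
    ext y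
    conv_lhs => rw [← b.sum_repr (c y)]
    simp only [map_sum, map_smul, Module.Basis.coord_apply]
  rw [hL]
  exact contMDiffAt_finsetSum fun i _ => (h (b.coord i)).smul contMDiffAt_const

theorem algSmoothAt_iff [FiniteDimensional ℝ F] {f : M → F} :
    AlgSmoothAt I f x ↔ ContMDiffAt I 𝓘(ℝ, F) ∞ f x :=
  ⟨fun h => h.contMDiffAt LinearMap.id, fun h φ =>
    (LinearMap.toContinuousLinearMap φ).contDiff.contMDiff.contMDiffAt.comp x h⟩

theorem MDifferentiableAt.hasAlgDerivAt [FiniteDimensional ℝ F] {f : M → F}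
    (h : MDifferentiableAt I 𝓘(ℝ, F) f x) : HasAlgDerivAt I f x (mvfderiv I f x) := fun φ =>
  ⟨MDifferentiableAt.comp x
    (LinearMap.toContinuousLinearMap φ).differentiableAt.mdifferentiableAt h,
    fun v => mvfderiv_clm_comp (LinearMap.toContinuousLinearMap φ) h v⟩

theorem HasAlgDerivAt.mdifferentiableAt [FiniteDimensional ℝ F] {f : M → F}
    {f' : TangentSpace I x → F} (h : HasAlgDerivAt I f x f') :
    MDifferentiableAt I 𝓘(ℝ, F) f x := by
  let b := Module.finBasis ℝ F
  have hL : f = fun y => ∑ i, b.coord i (f y) • b i := by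
    ext y
    conv_lhs => rw [← b.sum_repr (f y)]
    simp
  rw [hL]
  exact (mdifferentiableAt_sum fun i _ => (h (b.coord i)).1.smul mdifferentiableAt_const).1

theorem HasAlgDerivAt.mvfderiv_eq [FiniteDimensional ℝ F] {f : M → F}
    {f' : TangentSpace I x → F} (h : HasAlgDerivAt I f x f') (v : TangentSpace I x) :
    mvfderiv I f x v = f' v := h.mdifferentiableAt.hasAlgDerivAt.unique h v

end AlgebraicCalculus

/-! ### Smoothness and derivatives of Clifford-valued data; parallel spinors as a functor of the
module. -/

section SpinorCalculus

open Filter Topology VectorField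

variable {E : Type*} [NormedAddCommGroup E] [NormedSpace ℝ E] [FiniteDimensional ℝ E]
  {H : Type*} [TopologicalSpace H] {I : ModelWithCorners ℝ E H} [I.Boundaryless]
  {M : Type*} [TopologicalSpace M] [ChartedSpace H M] [IsManifold I ∞ M]
  {ι : Type*} [Fintype ι] [DecidableEq ι]
  {g : PseudoRiemannianMetric I M} {ε : ι → ℤˣ} {A : Type*}
  (S : Type*) [NormedAddCommGroup S] [NormedSpace ℝ S]
  [Module (CliffordAlgebra (cliffordForm ε)) S]
  [IsScalarTower ℝ (CliffordAlgebra (cliffordForm ε)) S]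

instance cliffordForm_finite : FiniteDimensional ℝ (CliffordAlgebra (cliffordForm ε)) :=
  cliffordAlgebra_finite _

theorem algSmoothAt_pi {κ : Type*} [Finite κ] {B : M → κ → ℝ} {x : M}
    (h : ∀ i, ContMDiffAt I 𝓘(ℝ, ℝ) ∞ (fun y => B y i) x) : AlgSmoothAt I B x := by
  classical
  have := Fintype.ofFinite κ
  intro φ
  have hφ : (fun y => φ (B y)) = fun y => ∑ i, B y i * φ (Pi.single i 1) := by
    ext y
    conv_lhs => rw [pi_eq_sum_univ' (B y)]
    simp [map_sum]
  rw [hφ]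
  exact contMDiffAt_finsetSum fun i _ => (h i).mul contMDiffAt_const

/-- The Clifford multiplication as a bilinear map. -/
noncomputable def cliffordAct :
    CliffordAlgebra (cliffordForm ε) →ₗ[ℝ] S →ₗ[ℝ] S :=
  (Algebra.lsmul ℝ ℝ S).toLinearMap

variable {S}

theorem HasAlgDerivAt.clifford_smul [FiniteDimensional ℝ S] {x : M}
    {c : M → CliffordAlgebra (cliffordForm ε)}
    {c' : TangentSpace I x → CliffordAlgebra (cliffordForm ε)} {s : M → S}
    (hc : HasAlgDerivAt I c x c') (hs : MDifferentiableAt I 𝓘(ℝ, S) s x) (v : TangentSpace I x) :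
    mvfderiv I (fun y => c y • s y) x v = c' v • s x + c x • mvfderiv I s x v :=
  (hc.bilin (cliffordAct S) hs.hasAlgDerivAt).mvfderiv_eq v

theorem AlgSmoothAt.clifford_smul [FiniteDimensional ℝ S] {x : M}
    {c : M → CliffordAlgebra (cliffordForm ε)} {s : M → S}
    (hc : AlgSmoothAt I c x) (hs : ContMDiffAt I 𝓘(ℝ, S) ∞ s x) :
    ContMDiffAt I 𝓘(ℝ, S) ∞ (fun y => c y • s y) x :=
  algSmoothAt_iff.1 (hc.bilin (cliffordAct S) (algSmoothAt_iff.2 hs))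

namespace SpinStructure

variable (σ : SpinStructure g ε A) {a b : A} {x : M} {X Y : ∀ x : M, TangentSpace I x}

theorem algSmoothAt_frameCoeff (hx : x ∈ σ.U a)
    (hX : ContMDiffAt I I.tangent ∞ (sectionMap I X) x) :
    AlgSmoothAt I (fun y => σ.frameCoeff a (X y)) x := by
  have h : AlgSmoothAt I (fun y => fun p : ι × ι => σ.frameCoeff a (X y) p.1 p.2) x :=
    algSmoothAt_pi fun p => σ.contMDiffAt_frameCoeff hx hX p.1 p.2
  exact h.map (LinearEquiv.curry ℝ ℝ ι ι).toLinearMap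

theorem algSmoothAt_connectionForm (hx : x ∈ σ.U a)
    (hX : ContMDiffAt I I.tangent ∞ (sectionMap I X) x) :
    AlgSmoothAt I (fun y => σ.connectionForm a (X y)) x :=
  (σ.algSmoothAt_frameCoeff hx hX).map (spinLift ε)

theorem hasAlgDerivAt_frameCoeff (hx : x ∈ σ.U a)
    (hX : ContMDiffAt I I.tangent ∞ (sectionMap I X) x) :
    HasAlgDerivAt I (fun y => σ.frameCoeff a (X y)) x
      fun v i j => mvfderiv I (fun y => σ.frameCoeff a (X y) i j) x v := by
  obtain ⟨c', hc'⟩ := (σ.algSmoothAt_frameCoeff hx hX).exists_hasAlgDerivAt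
  have h : c' = fun v i j => mvfderiv I (fun y => σ.frameCoeff a (X y) i j) x v := by
    ext v i j
    exact ((hc' (LinearMap.proj j ∘ₗ LinearMap.proj i)).2 v).symm
  rwa [h] at hc'

theorem hasAlgDerivAt_connectionForm (hx : x ∈ σ.U a)
    (hX : ContMDiffAt I I.tangent ∞ (sectionMap I X) x) :
    HasAlgDerivAt I (fun y => σ.connectionForm a (X y)) x
      fun v => spinLift ε fun i j => mvfderiv I (fun y => σ.frameCoeff a (X y) i j) x v :=
  (σ.hasAlgDerivAt_frameCoeff hx hX).map (spinLift ε)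

theorem algSmoothAt_lift (hx : x ∈ σ.U a ∩ σ.U b) :
    AlgSmoothAt I (fun y => (σ.lift a b y : CliffordAlgebra (cliffordForm ε))) x := fun φ =>
  (σ.smooth_lift a b φ).contMDiffAt (((σ.isOpen_U a).inter (σ.isOpen_U b)).mem_nhds hx)

theorem lift_self (hx : x ∈ σ.U a) : σ.lift a a x = 1 := by
  have h := σ.cocycle a a a x ⟨⟨hx, hx⟩, hx⟩
  simpa using h

theorem involute_lift (a b : A) (x : M) :
    CliffordAlgebra.involute (σ.lift a b x : CliffordAlgebra (cliffordForm ε)) = σ.lift a b x :=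
  CliffordAlgebra.involute_eq_of_mem_even (spinGroup.mem_even (σ.lift a b x).2)

/-! ### Functoriality of parallel spinors in the module -/

variable {S' : Type*} [NormedAddCommGroup S'] [NormedSpace ℝ S']
  [Module (CliffordAlgebra (cliffordForm ε)) S']
  [IsScalarTower ℝ (CliffordAlgebra (cliffordForm ε)) S']

/-- Transition functions and connection forms are even, so linearity of φ over even elements is all
that parallelism requires. -/
theorem map_mem_parallelSpinors [FiniteDimensional ℝ S] (φ : S →ₗ[ℝ] S')
    (hφ : ∀ c : CliffordAlgebra (cliffordForm ε), CliffordAlgebra.involute c = c →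
      ∀ s, φ (c • s) = c • φ s) {s : A → M → S} (hs : s ∈ σ.parallelSpinors S) :
    (fun a x => φ (s a x)) ∈ σ.parallelSpinors S' := by
  obtain ⟨h₁, h₂, h₃, h₄⟩ := hs
  let L := LinearMap.toContinuousLinearMap φ
  refine ⟨fun a x hx => by simp [h₁ a x hx], fun a => ?_, fun a b x hx => ?_, fun a x hx v => ?_⟩
  · exact L.contDiff.contMDiff.comp_contMDiffOn (h₂ a)
  · dsimp only
    rw [h₃ a b x hx, hφ _ (σ.involute_lift a b x)]
  · have hd : MDifferentiableAt I 𝓘(ℝ, S) (s a) x :=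
      ((h₂ a).contMDiffAt (σ.U_mem_nhds hx)).mdifferentiableAt (by simp)
    have h := mvfderiv_clm_comp L hd v
    refine (congrArg (· + _) h).trans ?_
    rw [← hφ _ (σ.involute_connectionForm a v)]
    change φ _ + φ _ = 0
    rw [← map_add, h₄ a x hx v, map_zero]

/-- The map of parallel spinors induced by a linear map commuting with even elements. -/
noncomputable def mapParallel [FiniteDimensional ℝ S] (φ : S →ₗ[ℝ] S')
    (hφ : ∀ c : CliffordAlgebra (cliffordForm ε), CliffordAlgebra.involute c = c →
      ∀ s, φ (c • s) = c • φ s) : σ.parallelSpinors S →ₗ[ℝ] σ.parallelSpinors S' where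
  toFun s := ⟨fun a x => φ (s.1 a x), σ.map_mem_parallelSpinors φ hφ s.2⟩
  map_add' s t := by ext a x; simp
  map_smul' c s := by ext a x; simp

/-- Evaluation of parallel spinors at a point. -/
def evalParallel (S : Type*) [NormedAddCommGroup S] [NormedSpace ℝ S]
    [Module (CliffordAlgebra (cliffordForm ε)) S]
    [IsScalarTower ℝ (CliffordAlgebra (cliffordForm ε)) S] (a : A) (x : M) :
    σ.parallelSpinors S →ₗ[ℝ] S where
  toFun s := s.1 a x
  map_add' _ _ := rfl
  map_smul' _ _ := rfl

/-! ### The connection form in a chart -/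

/-- The connection form in a chart, as an operator-valued form. -/
noncomputable def chartConn [FiniteDimensional ℝ S] (a : A) (x₀ : M) (y : E) :
    E →L[ℝ] S →L[ℝ] S :=
  ∑ k, (LinearMap.toContinuousLinearMap ((Module.finBasis ℝ E).coord k)).smulRight
    (LinearMap.toContinuousLinearMap (cliffordAct S (σ.connectionForm a
      (chartField I x₀ (Module.finBasis ℝ E k) ((extChartAt I x₀).symm y)))))

/-- `chartConn` is built from its values on a basis, which makes it linear at every y. It agrees
with the connection form over the domain of the frame, where that form is known to be linear in the
tangent vector. -/
theorem chartConn_apply [FiniteDimensional ℝ S] {x₀ : M} {y : E}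
    (hy : (extChartAt I x₀).symm y ∈ σ.U a) (v : E) (s : S) :
    σ.chartConn a x₀ y v s =
      σ.connectionForm a (chartField I x₀ v ((extChartAt I x₀).symm y)) • s := by
  set p := (extChartAt I x₀).symm y with hp
  let L : E →ₗ[ℝ] CliffordAlgebra (cliffordForm ε) :=
    { toFun := fun v => σ.connectionForm a (chartField I x₀ v p)
      map_add' := fun v w => by
        have := chartField_linear I x₀ p 1 v w
        simp only [one_smul] at this
        rw [this, σ.connectionForm_add hy]
      map_smul' := fun c v => by
        have h0 : chartField I x₀ (0 : E) p = 0 := by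
          simpa using chartField_linear I x₀ p 1 0 0
        have := chartField_linear I x₀ p c v 0
        simp only [add_zero, h0] at this
        rw [this, σ.connectionForm_smul hy]; rfl }
  change _ = L v • s
  conv_rhs => rw [← (Module.finBasis ℝ E).sum_repr v, map_sum, Finset.sum_smul]
  simp only [chartConn, sum_apply, map_smul, smul_assoc]
  rfl

theorem contDiffAt_chartConn [FiniteDimensional ℝ S] {x₀ : M} {y : E}
    (hy : y ∈ (extChartAt I x₀).target) (hya : (extChartAt I x₀).symm y ∈ σ.U a) :
    ContDiffAt ℝ ∞ (σ.chartConn (S := S) a x₀) y := by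
  refine ContDiffAt.sum fun k _ => ?_
  have h := (σ.algSmoothAt_connectionForm hya (contMDiffAt_chartField
    ((extChartAt I x₀).map_target hy) (Module.finBasis ℝ E k))).contMDiffAt
    (LinearMap.toContinuousLinearMap.toLinearMap ∘ₗ cliffordAct S)
  exact contDiffAt_const.smulRight (contDiffAt_comp_symm hy h)

end SpinStructure

end SpinorCalculus

/-! ### Unique continuation, and the dimension count for arbitrary Clifford modules. -/

section UniqueContinuation

open Filter Topology

/-- Along each ray from the centre the norm of the derivative is at most a constant times the norm
of the value, and the initial value is zero; Gronwall's inequality applies. -/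
theorem eq_zero_on_ball_of_norm_fderiv_le {E F : Type*} [NormedAddCommGroup E] [NormedSpace ℝ E]
    [NormedAddCommGroup F] [NormedSpace ℝ F] {t : E → F} {z₀ : E} {r C : ℝ}
    (hd : ∀ z ∈ Metric.ball z₀ r, DifferentiableAt ℝ t z)
    (hC : ∀ z ∈ Metric.ball z₀ r, ∀ v, ‖fderiv ℝ t z v‖ ≤ C * ‖v‖ * ‖t z‖) (h0 : t z₀ = 0) :
    ∀ z ∈ Metric.ball z₀ r, t z = 0 := by
  intro z hz
  have hmem : ∀ τ ∈ Set.Icc (0 : ℝ) 1, z₀ + τ • (z - z₀) ∈ Metric.ball z₀ r := by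
    intro τ hτ
    rw [mem_ball_iff_norm] at hz ⊢
    rw [add_sub_cancel_left, norm_smul, Real.norm_of_nonneg hτ.1]
    exact (mul_le_of_le_one_left (norm_nonneg _) hτ.2).trans_lt hz
  have hder : ∀ τ ∈ Set.Icc (0 : ℝ) 1, HasDerivAt (fun τ : ℝ => t (z₀ + τ • (z - z₀)))
      (fderiv ℝ t (z₀ + τ • (z - z₀)) (z - z₀)) τ := by
    intro τ hτ
    refine (hd _ (hmem τ hτ)).hasFDerivAt.comp_hasDerivAt τ ?_
    simpa using ((hasDerivAt_id τ).smul_const (z - z₀)).const_add z₀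
  have h := eq_zero_of_abs_deriv_le_mul_abs_self_of_eq_zero_right
    (f := fun τ : ℝ => t (z₀ + τ • (z - z₀))) (K := C * ‖z - z₀‖) (a := 0) (b := 1)
    (fun τ hτ => (hder τ hτ).continuousAt.continuousWithinAt)
    (fun τ hτ => (hder τ (Set.Ico_subset_Icc_self hτ)).hasDerivWithinAt) (by simpa using h0)
    (fun τ hτ => hC _ (hmem τ (Set.Ico_subset_Icc_self hτ)) _)
  simpa using h 1 (Set.right_mem_Icc.2 zero_le_one)

variable {E : Type*} [NormedAddCommGroup E] [NormedSpace ℝ E] [FiniteDimensional ℝ E]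
  {H : Type*} [TopologicalSpace H] {I : ModelWithCorners ℝ E H} [I.Boundaryless]
  {M : Type*} [TopologicalSpace M] [ChartedSpace H M] [IsManifold I ∞ M]
  {ι : Type*} [Fintype ι] [DecidableEq ι]
  {g : PseudoRiemannianMetric I M} {ε : ι → ℤˣ} {A : Type*}
  {S : Type*} [NormedAddCommGroup S] [NormedSpace ℝ S]
  [Module (CliffordAlgebra (cliffordForm ε)) S]
  [IsScalarTower ℝ (CliffordAlgebra (cliffordForm ε)) S]

namespace SpinStructure

variable (σ : SpinStructure g ε A) {a b : A} {x : M}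

theorem mdifferentiableAt_parallel {s : A → M → S} (hs : s ∈ σ.parallelSpinors S)
    (hx : x ∈ σ.U a) : MDifferentiableAt I 𝓘(ℝ, S) (s a) x :=
  ((hs.2.1 a).contMDiffAt (σ.U_mem_nhds hx)).mdifferentiableAt (by simp)

theorem mvfderiv_parallel {s : A → M → S} (hs : s ∈ σ.parallelSpinors S)
    (hx : x ∈ σ.U a) (v : TangentSpace I x) :
    mvfderiv I (s a) x v = -(σ.connectionForm a v • s a x) :=
  eq_neg_of_add_eq_zero_left (hs.2.2.2 a x hx v)

theorem parallel_eq_zero_iff {s : A → M → S} (hs : s ∈ σ.parallelSpinors S)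
    (ha : x ∈ σ.U a) (hb : x ∈ σ.U b) : s a x = 0 ↔ s b x = 0 := by
  have key : ∀ {a b}, x ∈ σ.U a → x ∈ σ.U b → s b x = 0 → s a x = 0 := fun ha hb h => by
    rw [hs.2.2.1 _ _ x ⟨ha, hb⟩, h, smul_zero]
  exact ⟨key hb ha, key ha hb⟩

/-- The map `f` represents in the trivialization `a` a spinor field that is parallel at `y`. -/
def IsParallelAt (a : A) (f : M → S) (y : M) : Prop :=
  ContMDiffAt I 𝓘(ℝ, S) ∞ f y ∧
    ∀ v : TangentSpace I y, mvfderiv I f y v = -(σ.connectionForm a v • f y)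

/-- In a chart the connection is continuous, hence bounded near the point, and the estimate along
rays applies. The same statement later shows that transition maps between parallel frames are
locally constant. -/
theorem IsParallelAt.eventually_eq_zero [FiniteDimensional ℝ S] {f : M → S} (hx : x ∈ σ.U a)
    (hf : ∀ᶠ y in 𝓝 x, σ.IsParallelAt a f y) (h0 : f x = 0) : ∀ᶠ y in 𝓝 x, f y = 0 := by
  set φ := extChartAt I x with hφ
  have hxt : φ x ∈ φ.target := mem_extChartAt_target x
  have hsymm : φ.symm (φ x) = x := extChartAt_to_inv x
  have hcont : ContinuousAt φ.symm (φ x) := (contMDiffAt_symm_of_mem hxt).continuousAt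
  have hxa : φ.symm (φ x) ∈ σ.U a := by rwa [hsymm]
  have hcc : ContinuousAt (fun z => ‖σ.chartConn (S := S) a x z‖) (φ x) :=
    ContinuousAt.norm (E := E →L[ℝ] S →L[ℝ] S) (σ.contDiffAt_chartConn hxt hxa).continuousAt
  have hev : ∀ᶠ z in 𝓝 (φ x), z ∈ φ.target ∧ φ.symm z ∈ σ.U a ∧ σ.IsParallelAt a f (φ.symm z) ∧
      ‖σ.chartConn (S := S) a x z‖ ≤ ‖σ.chartConn (S := S) a x (φ x)‖ + 1 := by
    refine ((isOpen_extChartAt_target x).eventually_mem hxt).and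
      ((hcont.eventually ((σ.isOpen_U a).eventually_mem hxa)).and
        ((hcont.eventually (by rwa [hsymm])).and ?_))
    exact (hcc.eventually (eventually_le_nhds (lt_add_one _)))
  obtain ⟨r, hr, hball⟩ := Metric.eventually_nhds_iff_ball.1 hev
  have hz := eq_zero_on_ball_of_norm_fderiv_le (t := fun z => f (φ.symm z)) (z₀ := φ x) (r := r)
    (C := ‖σ.chartConn (S := S) a x (φ x)‖ + 1) (fun z hz => ?_) (fun z hz v => ?_)
    (by simpa only [hsymm] using h0)
  · have : ∀ᶠ y in 𝓝 x, y ∈ φ.source ∧ φ y ∈ Metric.ball (φ x) r :=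
      ((isOpen_extChartAt_source x).eventually_mem (mem_extChartAt_source x)).and
        ((continuousAt_extChartAt x).eventually (Metric.ball_mem_nhds _ hr))
    filter_upwards [this] with y hy
    have := hz _ hy.2
    rwa [φ.left_inv hy.1] at this
  · obtain ⟨h₁, -, h₃, -⟩ := hball z hz
    exact (contDiffAt_comp_symm h₁ h₃.1).differentiableAt (by simp)
  · obtain ⟨h₁, h₂, h₃, h₄⟩ := hball z hz
    rw [fderiv_comp_symm h₁ (h₃.1.mdifferentiableAt (by simp)), h₃.2,
      norm_neg, ← σ.chartConn_apply h₂]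
    exact (ContinuousLinearMap.le_opNorm₂ _ _ _).trans (by gcongr)

theorem isParallelAt_parallel {s : A → M → S} (hs : s ∈ σ.parallelSpinors S) (hx : x ∈ σ.U a) :
    σ.IsParallelAt a (s a) x :=
  ⟨(hs.2.1 a).contMDiffAt (σ.U_mem_nhds hx), σ.mvfderiv_parallel hs hx⟩

theorem eventually_parallel_eq_zero [FiniteDimensional ℝ S] {s : A → M → S}
    (hs : s ∈ σ.parallelSpinors S) (hx : x ∈ σ.U a) (h0 : s a x = 0) :
    ∀ᶠ y in 𝓝 x, s a y = 0 :=
  IsParallelAt.eventually_eq_zero σ hx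
    (((σ.isOpen_U a).eventually_mem hx).mono fun _ hy => σ.isParallelAt_parallel hs hy) h0

/-- A parallel spinor on a connected manifold is determined by its value at a point. -/
theorem evalParallel_injective [ConnectedSpace M] [FiniteDimensional ℝ S] (hx : x ∈ σ.U a) :
    Function.Injective (σ.evalParallel S a x) := by
  rw [injective_iff_map_eq_zero]
  rintro ⟨s, hs⟩ h0
  -- The zero set does not depend on the trivialization. It is open by local uniqueness and closed
  -- by continuity, so connectedness makes it everything.
  let Z : Set M := {y | ∃ b, y ∈ σ.U b ∧ s b y = 0}
  have hopen : IsOpen Z := by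
    rw [isOpen_iff_mem_nhds]
    rintro y ⟨b, hb, h⟩
    filter_upwards [σ.eventually_parallel_eq_zero hs hb h, σ.U_mem_nhds hb] with z h₁ h₂
    exact ⟨b, h₂, h₁⟩
  have hclosed : IsClosed Z := by
    rw [← isOpen_compl_iff, isOpen_iff_mem_nhds]
    intro y hy
    obtain ⟨b, hb⟩ := σ.cover y
    have hne : s b y ≠ 0 := fun h => hy ⟨b, hb, h⟩
    filter_upwards [((hs.2.1 b).contMDiffAt (σ.U_mem_nhds hb)).continuousAt.eventually_ne hne,
      σ.U_mem_nhds hb] with z h₁ h₂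
    rintro ⟨c, hc, h⟩
    exact h₁ ((σ.parallel_eq_zero_iff hs hc h₂).1 h)
  have huniv : Z = Set.univ := IsClopen.eq_univ ⟨hclosed, hopen⟩ ⟨x, a, hx, h0⟩
  ext b y
  by_cases hy : y ∈ σ.U b
  · obtain ⟨c, hc, h⟩ : y ∈ Z := huniv ▸ Set.mem_univ y
    exact (σ.parallel_eq_zero_iff hs hc hy).1 h
  · exact hs.1 b y hy

variable (S) in
theorem finite_parallelSpinors [ConnectedSpace M] [FiniteDimensional ℝ S] :
    FiniteDimensional ℝ (σ.parallelSpinors S) := by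
  obtain ⟨x⟩ : Nonempty M := inferInstance
  obtain ⟨a, ha⟩ := σ.cover x
  exact Module.Finite.of_injective _ (σ.evalParallel_injective (S := S) ha)

/-- The dimension of the space of parallel sections with values in a Clifford module is
proportional to the dimension of the module. -/
theorem finrank_parallelSpinors_mul [ConnectedSpace M]
    (S : Type*) [NormedAddCommGroup S] [NormedSpace ℝ S]
    [Module (CliffordAlgebra (cliffordForm ε)) S]
    [IsScalarTower ℝ (CliffordAlgebra (cliffordForm ε)) S]
    [IsSimpleModule (CliffordAlgebra (cliffordForm ε)) S]
    (W : Type*) [NormedAddCommGroup W] [NormedSpace ℝ W]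
    [Module (CliffordAlgebra (cliffordForm ε)) W]
    [IsScalarTower ℝ (CliffordAlgebra (cliffordForm ε)) W] [FiniteDimensional ℝ W] :
    (Module.finrank ℝ (σ.parallelSpinors W) : ℝ) = Module.finrank ℝ W * σ.kappa S := by
  have := finiteDimensional_of_isSimpleModule ε S
  have := IsSimpleModule.nontrivial (CliffordAlgebra (cliffordForm ε)) S
  have := σ.finite_parallelSpinors S
  -- Over the even part W is a sum of n copies of S. Its coordinate projections and inclusions
  -- commute with even elements, so they induce maps of parallel spinors, and these split the
  -- W-valued ones into n copies of the S-valued ones.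
  obtain ⟨n, φ, hφ⟩ := exists_even_linearEquiv (ε := ε) S W
  have hW : Module.finrank ℝ W = n * Module.finrank ℝ S := by
    rw [φ.finrank_eq, Module.finrank_pi_fintype]; simp
  have hφ' : ∀ c : CliffordAlgebra (cliffordForm ε), CliffordAlgebra.involute c = c →
      ∀ s, φ.symm (c • s) = c • φ.symm s := fun c hc s => by
    rw [LinearEquiv.symm_apply_eq, hφ c hc, LinearEquiv.apply_symm_apply]
  let p (k : Fin n) : σ.parallelSpinors W →ₗ[ℝ] σ.parallelSpinors S :=
    σ.mapParallel (LinearMap.proj k ∘ₗ φ.toLinearMap) fun c hc w => by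
      simp [hφ c hc]
  let q (k : Fin n) : σ.parallelSpinors S →ₗ[ℝ] σ.parallelSpinors W :=
    σ.mapParallel (φ.symm.toLinearMap ∘ₗ LinearMap.single ℝ (fun _ => S) k) fun c hc w => by
      have h : Pi.single (M := fun _ : Fin n => S) k (c • w) = c • Pi.single k w :=
        Pi.single_smul ..
      simp [h, hφ' c hc]
  let e : σ.parallelSpinors W ≃ₗ[ℝ] (Fin n → σ.parallelSpinors S) :=
    LinearEquiv.ofLinearMap (LinearMap.pi p) (∑ k, q k ∘ₗ LinearMap.proj k)
      (by
        refine LinearMap.ext fun t => funext fun j => Subtype.ext (funext₂ fun a x => ?_)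
        change φ ((((∑ k, q k ∘ₗ LinearMap.proj k) t : σ.parallelSpinors W) : A → M → W) a x) j
          = (t j).1 a x
        simp only [LinearMap.sum_apply, Submodule.coe_sum, Finset.sum_apply, map_sum]
        have : ∀ k, φ ((((q k ∘ₗ LinearMap.proj k) t : σ.parallelSpinors W) : A → M → W) a x) j =
            (Pi.single k ((t k).1 a x) : Fin n → S) j := fun k =>
          congrFun (φ.apply_symm_apply _) j
        simp only [this, Pi.single_apply]
        simp)
      (by
        refine LinearMap.ext fun t => Subtype.ext (funext₂ fun a x => φ.injective ?_)
        change φ ((((∑ k, q k ∘ₗ LinearMap.proj k) (LinearMap.pi p t) : σ.parallelSpinors W) :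
          A → M → W) a x) = φ (t.1 a x)
        simp only [LinearMap.sum_apply, Submodule.coe_sum, Finset.sum_apply, map_sum]
        have : ∀ k, φ ((((q k ∘ₗ LinearMap.proj k) (LinearMap.pi p t) : σ.parallelSpinors W) :
            A → M → W) a x) = (Pi.single k (φ (t.1 a x) k) : Fin n → S) := fun k =>
          φ.apply_symm_apply _
        simp only [this]
        exact Finset.univ_sum_single (φ (t.1 a x)))
  have he : Module.finrank ℝ (σ.parallelSpinors W) =
      n * Module.finrank ℝ (σ.parallelSpinors S) := by
    rw [e.finrank_eq, Module.finrank_pi_fintype]; simp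
  have hS : (Module.finrank ℝ S : ℝ) ≠ 0 := by
    exact_mod_cast (Module.finrank_pos (R := ℝ) (M := S)).ne'
  rw [he, hW, kappa]
  push_cast
  field_simp

end SpinStructure

end UniqueContinuation

/-! ### Parallel spinors on products and multiplicativity of κ. -/

section ProductParallel

open Filter Topology

variable {E₁ : Type*} [NormedAddCommGroup E₁] [NormedSpace ℝ E₁] [FiniteDimensional ℝ E₁]
  {H₁ : Type*} [TopologicalSpace H₁] {I₁ : ModelWithCorners ℝ E₁ H₁} [I₁.Boundaryless]
  {M₁ : Type*} [TopologicalSpace M₁] [ChartedSpace H₁ M₁] [IsManifold I₁ ∞ M₁]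
  {ι₁ : Type*} [Fintype ι₁] [DecidableEq ι₁]
  {E₂ : Type*} [NormedAddCommGroup E₂] [NormedSpace ℝ E₂] [FiniteDimensional ℝ E₂]
  {H₂ : Type*} [TopologicalSpace H₂] {I₂ : ModelWithCorners ℝ E₂ H₂} [I₂.Boundaryless]
  {M₂ : Type*} [TopologicalSpace M₂] [ChartedSpace H₂ M₂] [IsManifold I₂ ∞ M₂]
  {ι₂ : Type*} [Fintype ι₂] [DecidableEq ι₂]
  {g₁ : PseudoRiemannianMetric I₁ M₁} {ε₁ : ι₁ → ℤˣ} {A₁ : Type*}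
  {g₂ : PseudoRiemannianMetric I₂ M₂} {ε₂ : ι₂ → ℤˣ} {A₂ : Type*}

/-- A vector of the second factor anticommutes with every vector of the first, so moving it across c
costs the grading involution of c. -/
theorem map_inr_ι_mul_map_inl (w : ι₂ → ℝ) (c : CliffordAlgebra (cliffordForm ε₁)) :
    CliffordAlgebra.map (cliffordInr ε₁ ε₂) (CliffordAlgebra.ι _ w) *
        CliffordAlgebra.map (cliffordInl ε₁ ε₂) c =
      CliffordAlgebra.map (cliffordInl ε₁ ε₂) (CliffordAlgebra.involute c) *
        CliffordAlgebra.map (cliffordInr ε₁ ε₂) (CliffordAlgebra.ι _ w) := by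
  induction c using CliffordAlgebra.induction with
  | algebraMap r => simp only [AlgHom.commutes, Algebra.commutes]
  | ι v =>
    rw [CliffordAlgebra.involute_ι, map_neg, CliffordAlgebra.map_apply_ι,
      CliffordAlgebra.map_apply_ι, neg_mul]
    exact CliffordAlgebra.ι_mul_ι_comm_of_isOrtho (cliffordInl_isOrtho_cliffordInr ε₁ ε₂ v w).symm
  | mul a b ha hb => rw [map_mul, map_mul, map_mul, ← mul_assoc, ha, mul_assoc, hb, mul_assoc]
  | add a b ha hb => rw [map_add, map_add, map_add, mul_add, add_mul, ha, hb]

/-- The even elements of the first factor commute with the second factor. -/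
theorem commute_map_inr_map_inl {c : CliffordAlgebra (cliffordForm ε₁)}
    (hc : CliffordAlgebra.involute c = c) (d : CliffordAlgebra (cliffordForm ε₂)) :
    Commute (CliffordAlgebra.map (cliffordInr ε₁ ε₂) d)
      (CliffordAlgebra.map (cliffordInl ε₁ ε₂) c) := by
  induction d using CliffordAlgebra.induction with
  | algebraMap r => rw [AlgHom.commutes]; exact Algebra.commutes _ _
  | ι w => exact (map_inr_ι_mul_map_inl w c).trans (by rw [hc])
  | mul a b ha hb => rw [map_mul]; exact ha.mul_left hb
  | add a b ha hb => rw [map_add]; exact ha.add_left hb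

theorem mvfderiv_prod_eq_add {F : Type*} [NormedAddCommGroup F] [NormedSpace ℝ F]
    {f : M₁ × M₂ → F} {x : M₁ × M₂} (hf : MDifferentiableAt (I₁.prod I₂) 𝓘(ℝ, F) f x)
    (v : TangentSpace (I₁.prod I₂) x) :
    mvfderiv (I₁.prod I₂) f x v =
      mvfderiv I₁ (fun y => f (y, x.2)) x.1 (tangentProd I₁ I₂ x v).1 +
        mvfderiv I₂ (fun y => f (x.1, y)) x.2 (tangentProd I₁ I₂ x v).2 :=
  mfderiv_prod_eq_add_apply hf

namespace SpinStructure

/-- A real-linear left inverse of j suffices: it need not commute with the Clifford action on all of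
S, but it does on the range of j, where all values of t lie. -/
theorem exists_parallel_lift {ε₁ : ι₁ → ℤˣ} {σ : SpinStructure g₁ ε₁ A₁}
    {S : Type*} [NormedAddCommGroup S] [NormedSpace ℝ S] [FiniteDimensional ℝ S]
    [Module (CliffordAlgebra (cliffordForm ε₁)) S]
    [IsScalarTower ℝ (CliffordAlgebra (cliffordForm ε₁)) S]
    {W : Type*} [NormedAddCommGroup W] [NormedSpace ℝ W]
    [Module (CliffordAlgebra (cliffordForm ε₁)) W]
    [IsScalarTower ℝ (CliffordAlgebra (cliffordForm ε₁)) W]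
    (j : W →ₗ[ℝ] S) (hj : Function.Injective j)
    (hjc : ∀ (c : CliffordAlgebra (cliffordForm ε₁)) w, j (c • w) = c • j w)
    {t : A₁ → M₁ → S} (ht : t ∈ σ.parallelSpinors S) (hr : ∀ a x, t a x ∈ LinearMap.range j) :
    ∃ t' ∈ σ.parallelSpinors W, ∀ a x, j (t' a x) = t a x := by
  obtain ⟨π, hπ⟩ := LinearMap.exists_leftInverse_of_injective j (LinearMap.ker_eq_bot.2 hj)
  have hπ' : ∀ w, π (j w) = w := fun w => LinearMap.congr_fun hπ w
  have hjπ : ∀ a x, j (π (t a x)) = t a x := by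
    intro a x
    obtain ⟨w, hw⟩ := hr a x
    rw [← hw, hπ']
  have hπc : ∀ (c : CliffordAlgebra (cliffordForm ε₁)) a x, π (c • t a x) = c • π (t a x) := by
    intro c a x
    rw [← hjπ a x, ← hjc, hπ', hπ']
  refine ⟨fun a x => π (t a x), ⟨fun a x hx => by simp [ht.1 a x hx], fun a => ?_,
    fun a b x hx => ?_, fun a x hx v => ?_⟩, hjπ⟩
  · exact (LinearMap.toContinuousLinearMap π).contDiff.contMDiff.comp_contMDiffOn (ht.2.1 a)
  · dsimp only
    rw [ht.2.2.1 a b x hx, hπc]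
  · have h := mvfderiv_clm_comp (LinearMap.toContinuousLinearMap π)
      (σ.mdifferentiableAt_parallel ht hx) v
    refine (congrArg (· + _) h).trans ?_
    dsimp only
    rw [← hπc]
    change π _ + π _ = 0
    rw [← map_add, ht.2.2.2 a x hx v, map_zero]

variable (σ₁ : SpinStructure g₁ ε₁ A₁) (σ₂ : SpinStructure g₂ ε₂ A₂)
  {S : Type*} [NormedAddCommGroup S] [NormedSpace ℝ S]
  [Module (CliffordAlgebra (cliffordForm (Sum.elim ε₁ ε₂))) S]
  [IsScalarTower ℝ (CliffordAlgebra (cliffordForm (Sum.elim ε₁ ε₂))) S]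
  [Module (CliffordAlgebra (cliffordForm ε₁)) S]
  [IsScalarTower ℝ (CliffordAlgebra (cliffordForm ε₁)) S]
  [Module (CliffordAlgebra (cliffordForm ε₂)) S]
  [IsScalarTower ℝ (CliffordAlgebra (cliffordForm ε₂)) S]
  (h₁ : ∀ (c : CliffordAlgebra (cliffordForm ε₁)) (s : S),
    c • s = CliffordAlgebra.map (cliffordInl ε₁ ε₂) c • s)
  (h₂ : ∀ (c : CliffordAlgebra (cliffordForm ε₂)) (s : S),
    c • s = CliffordAlgebra.map (cliffordInr ε₁ ε₂) c • s)

theorem smul_comm_of_even (h₁ : ∀ (c : CliffordAlgebra (cliffordForm ε₁)) (s : S),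
      c • s = CliffordAlgebra.map (cliffordInl ε₁ ε₂) c • s)
    (h₂ : ∀ (c : CliffordAlgebra (cliffordForm ε₂)) (s : S),
      c • s = CliffordAlgebra.map (cliffordInr ε₁ ε₂) c • s)
    {c : CliffordAlgebra (cliffordForm ε₁)} (hc : CliffordAlgebra.involute c = c)
    (d : CliffordAlgebra (cliffordForm ε₂)) (s : S) : d • c • s = c • d • s := by
  rw [h₁, h₂, h₂, h₁, smul_smul, smul_smul, (commute_map_inr_map_inl hc d).eq]

theorem lift_prod_smul (h₁ : ∀ (c : CliffordAlgebra (cliffordForm ε₁)) (s : S),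
      c • s = CliffordAlgebra.map (cliffordInl ε₁ ε₂) c • s)
    (h₂ : ∀ (c : CliffordAlgebra (cliffordForm ε₂)) (s : S),
      c • s = CliffordAlgebra.map (cliffordInr ε₁ ε₂) c • s) (p q : A₁ × A₂) (x : M₁ × M₂) (s : S) :
    ((σ₁.prod σ₂).lift p q x : CliffordAlgebra (cliffordForm (Sum.elim ε₁ ε₂))) • s =
      (σ₁.lift p.1 q.1 x.1 : CliffordAlgebra (cliffordForm ε₁)) •
        (σ₂.lift p.2 q.2 x.2 : CliffordAlgebra (cliffordForm ε₂)) • s := by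
  rw [h₁, h₂, smul_smul]
  rfl

theorem connectionForm_prod_smul (h₁ : ∀ (c : CliffordAlgebra (cliffordForm ε₁)) (s : S),
      c • s = CliffordAlgebra.map (cliffordInl ε₁ ε₂) c • s)
    (h₂ : ∀ (c : CliffordAlgebra (cliffordForm ε₂)) (s : S),
      c • s = CliffordAlgebra.map (cliffordInr ε₁ ε₂) c • s) {p : A₁ × A₂} {x : M₁ × M₂}
    (hx : x ∈ (σ₁.prod σ₂).U p) (v : TangentSpace (I₁.prod I₂) x) (s : S) :
    (σ₁.prod σ₂).connectionForm p v • s =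
      σ₁.connectionForm p.1 (tangentProd I₁ I₂ x v).1 • s +
        σ₂.connectionForm p.2 (tangentProd I₁ I₂ x v).2 • s := by
  rw [connectionForm_prod σ₁ σ₂ hx, add_smul, h₁, h₂]

theorem connectionForm_zero (σ : SpinStructure g₁ ε₁ A₁) {a : A₁} {x : M₁} (hx : x ∈ σ.U a) :
    σ.connectionForm a (0 : TangentSpace I₁ x) = 0 := by
  simpa using σ.connectionForm_smul hx 0 0

/-- Freezing the second point and index makes the second transition function trivial; on vectors (v,
0) the second connection form vanishes. When y lies outside the domain of b the slice is zero, since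
sections are extended by zero. -/
theorem slice_left_mem_parallelSpinors
    (h₁ : ∀ (c : CliffordAlgebra (cliffordForm ε₁)) (s : S),
      c • s = CliffordAlgebra.map (cliffordInl ε₁ ε₂) c • s)
    (h₂ : ∀ (c : CliffordAlgebra (cliffordForm ε₂)) (s : S),
      c • s = CliffordAlgebra.map (cliffordInr ε₁ ε₂) c • s)
    {s : A₁ × A₂ → M₁ × M₂ → S} (hs : s ∈ (σ₁.prod σ₂).parallelSpinors S) (b : A₂) (y : M₂) :
    (fun a x => s (a, b) (x, y)) ∈ σ₁.parallelSpinors S := by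
  by_cases hy : y ∈ σ₂.U b
  · refine ⟨fun a x hx => hs.1 _ _ fun h => hx h.1, fun a => ?_, fun a a' x hx => ?_,
      fun a x hx v => ?_⟩
    · exact (hs.2.1 (a, b)).comp (contMDiffOn_id.prodMk contMDiffOn_const) fun x hx => ⟨hx, hy⟩
    · have h := hs.2.2.1 (a, b) (a', b) (x, y) ⟨⟨hx.1, hy⟩, ⟨hx.2, hy⟩⟩
      rw [lift_prod_smul σ₁ σ₂ h₁ h₂, σ₂.lift_self hy] at h
      simpa using h
    · have hxy : (x, y) ∈ (σ₁.prod σ₂).U (a, b) := ⟨hx, hy⟩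
      have h := hs.2.2.2 (a, b) (x, y) hxy ((tangentProd I₁ I₂ (x, y)).symm (v, 0))
      rw [mvfderiv_prod_eq_add ((σ₁.prod σ₂).mdifferentiableAt_parallel hs hxy),
        connectionForm_prod_smul σ₁ σ₂ h₁ h₂ hxy, LinearEquiv.apply_symm_apply] at h
      dsimp only at h
      rw [connectionForm_zero σ₂ hy] at h
      simpa using h
  · have h0 : (fun a x => s (a, b) (x, y)) = 0 :=
      funext₂ fun a x => hs.1 _ _ fun h => hy h.2
    rw [h0]
    exact zero_mem _

theorem slice_right_mem_parallelSpinors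
    (h₁ : ∀ (c : CliffordAlgebra (cliffordForm ε₁)) (s : S),
      c • s = CliffordAlgebra.map (cliffordInl ε₁ ε₂) c • s)
    (h₂ : ∀ (c : CliffordAlgebra (cliffordForm ε₂)) (s : S),
      c • s = CliffordAlgebra.map (cliffordInr ε₁ ε₂) c • s)
    {s : A₁ × A₂ → M₁ × M₂ → S} (hs : s ∈ (σ₁.prod σ₂).parallelSpinors S)
    {a : A₁} {x : M₁} (hx : x ∈ σ₁.U a) :
    (fun b y => s (a, b) (x, y)) ∈ σ₂.parallelSpinors S := by
  refine ⟨fun b y hy => hs.1 _ _ fun h => hy h.2, fun b => ?_, fun b b' y hy => ?_,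
    fun b y hy v => ?_⟩
  · exact (hs.2.1 (a, b)).comp (contMDiffOn_const.prodMk contMDiffOn_id) fun y hy => ⟨hx, hy⟩
  · have h := hs.2.2.1 (a, b) (a, b') (x, y) ⟨⟨hx, hy.1⟩, ⟨hx, hy.2⟩⟩
    rw [lift_prod_smul σ₁ σ₂ h₁ h₂, σ₁.lift_self hx] at h
    simpa using h
  · have hxy : (x, y) ∈ (σ₁.prod σ₂).U (a, b) := ⟨hx, hy⟩
    have h := hs.2.2.2 (a, b) (x, y) hxy ((tangentProd I₁ I₂ (x, y)).symm (0, v))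
    rw [mvfderiv_prod_eq_add ((σ₁.prod σ₂).mdifferentiableAt_parallel hs hxy),
      connectionForm_prod_smul σ₁ σ₂ h₁ h₂ hxy, LinearEquiv.apply_symm_apply] at h
    dsimp only at h
    rw [connectionForm_zero σ₁ hx] at h
    simpa using h

/-- A parallel section over `M₂` with values in parallel spinors over `M₁` gives a parallel spinor
on the product. -/
theorem prod_mem_parallelSpinors [FiniteDimensional ℝ S]
    (h₁ : ∀ (c : CliffordAlgebra (cliffordForm ε₁)) (s : S),
      c • s = CliffordAlgebra.map (cliffordInl ε₁ ε₂) c • s)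
    (h₂ : ∀ (c : CliffordAlgebra (cliffordForm ε₂)) (s : S),
      c • s = CliffordAlgebra.map (cliffordInr ε₁ ε₂) c • s)
    {W : Type*} [NormedAddCommGroup W] [NormedSpace ℝ W] [FiniteDimensional ℝ W]
    [Module (CliffordAlgebra (cliffordForm ε₂)) W]
    [IsScalarTower ℝ (CliffordAlgebra (cliffordForm ε₂)) W]
    (Φ : W →ₗ[ℝ] σ₁.parallelSpinors S)
    (hΦ : ∀ (c : CliffordAlgebra (cliffordForm ε₂)) w a x, (Φ (c • w)).1 a x = c • (Φ w).1 a x)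
    {t : A₂ → M₂ → W} (ht : t ∈ σ₂.parallelSpinors W) :
    (fun p x => (Φ (t p.2 x.2)).1 p.1 x.1) ∈ (σ₁.prod σ₂).parallelSpinors S := by
  let ev (a : A₁) (x : M₁) : W →ₗ[ℝ] S := σ₁.evalParallel S a x ∘ₗ Φ
  have hsm : ∀ p : A₁ × A₂, ContMDiffOn (I₁.prod I₂) 𝓘(ℝ, S) ∞
      (fun x : M₁ × M₂ => (Φ (t p.2 x.2)).1 p.1 x.1) ((σ₁.prod σ₂).U p) := by
    intro p
    -- A basis of W separates the variables: the spinor becomes a finite sum of a function on M₂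
    -- times a spinor on M₁, so joint smoothness follows from smoothness on the factors.
    let b := Module.finBasis ℝ W
    have hb : ∀ x : M₁ × M₂, (Φ (t p.2 x.2)).1 p.1 x.1 =
        ∑ k, (b.coord k) (t p.2 x.2) • (Φ (b k)).1 p.1 x.1 := by
      intro x
      change ev p.1 x.1 (t p.2 x.2) = ∑ k, (b.coord k) (t p.2 x.2) • ev p.1 x.1 (b k)
      conv_lhs => rw [← b.sum_repr (t p.2 x.2)]
      simp only [map_sum, map_smul, Module.Basis.coord_apply]
    simp only [hb]
    refine contMDiffOn_finsetSum fun k _ => ?_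
    have hc : ContMDiffOn (I₁.prod I₂) 𝓘(ℝ, ℝ) ∞ (fun x : M₁ × M₂ => b.coord k (t p.2 x.2))
        ((σ₁.prod σ₂).U p) :=
      (LinearMap.toContinuousLinearMap (b.coord k)).contDiff.contMDiff.comp_contMDiffOn
        ((ht.2.1 p.2).comp contMDiffOn_snd fun x hx => hx.2)
    exact hc.smul (((Φ (b k)).2.2.1 p.1).comp contMDiffOn_fst fun x hx => hx.1)
  refine ⟨fun p x hx => ?_, hsm, fun p q x hx => ?_, fun p x hx v => ?_⟩
  · by_cases h : x.1 ∈ σ₁.U p.1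
    · have h' : x.2 ∉ σ₂.U p.2 := fun h' => hx ⟨h, h'⟩
      simp [ht.1 p.2 x.2 h']
    · exact (Φ (t p.2 x.2)).2.1 p.1 x.1 h
  · dsimp only
    rw [lift_prod_smul σ₁ σ₂ h₁ h₂, ht.2.2.1 p.2 q.2 x.2 ⟨hx.1.2, hx.2.2⟩, hΦ,
      (Φ (t q.2 x.2)).2.2.2.1 p.1 q.1 x.1 ⟨hx.1.1, hx.2.1⟩]
    exact smul_comm_of_even h₁ h₂ (σ₁.involute_lift _ _ _) _ _
  · have hd : MDifferentiableAt (I₁.prod I₂) 𝓘(ℝ, S)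
        (fun x : M₁ × M₂ => (Φ (t p.2 x.2)).1 p.1 x.1) x :=
      ((hsm p).contMDiffAt ((σ₁.prod σ₂).U_mem_nhds hx)).mdifferentiableAt (by simp)
    rw [mvfderiv_prod_eq_add hd, connectionForm_prod_smul σ₁ σ₂ h₁ h₂ hx]
    -- The derivative along M₁ cancels the first connection form because Φ takes parallel values;
    -- the derivative along M₂ cancels the second because t is parallel and Φ is compatible with the
    -- second Clifford algebra.
    have e₁ := (Φ (t p.2 x.2)).2.2.2.2 p.1 x.1 hx.1 (tangentProd I₁ I₂ x v).1
    have e₂ := mvfderiv_clm_comp (LinearMap.toContinuousLinearMap (ev p.1 x.1))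
      (σ₂.mdifferentiableAt_parallel ht hx.2) (tangentProd I₁ I₂ x v).2
    rw [σ₂.mvfderiv_parallel ht hx.2, map_neg] at e₂
    have e₃ : (LinearMap.toContinuousLinearMap (ev p.1 x.1))
        (σ₂.connectionForm p.2 (tangentProd I₁ I₂ x v).2 • t p.2 x.2) =
        σ₂.connectionForm p.2 (tangentProd I₁ I₂ x v).2 • (Φ (t p.2 x.2)).1 p.1 x.1 :=
      hΦ _ _ _ _
    rw [e₃] at e₂
    have e₄ := e₂
    dsimp only at e₁ ⊢
    rw [show (mvfderiv I₂ (fun y => (Φ (t p.2 y)).1 p.1 x.1) x.2) (tangentProd I₁ I₂ x v).2 =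
      -(σ₂.connectionForm p.2 (tangentProd I₁ I₂ x v).2 • (Φ (t p.2 x.2)).1 p.1 x.1) from e₄]
    rw [add_add_add_comm, neg_add_cancel, add_zero]
    exact e₁

/-- Parallel spinors on the product are parallel W-valued sections over M₂, where W consists of the
values at x₀ of S-valued parallel spinors on M₁. The dimension formula is applied twice: to S over
M₁ and to W over M₂. -/
theorem finrank_parallelSpinors_prod [FiniteDimensional ℝ S] [ConnectedSpace M₁]
    [ConnectedSpace M₂]
    (h₁ : ∀ (c : CliffordAlgebra (cliffordForm ε₁)) (s : S),
      c • s = CliffordAlgebra.map (cliffordInl ε₁ ε₂) c • s)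
    (h₂ : ∀ (c : CliffordAlgebra (cliffordForm ε₂)) (s : S),
      c • s = CliffordAlgebra.map (cliffordInr ε₁ ε₂) c • s)
    (S₁ : Type*) [NormedAddCommGroup S₁] [NormedSpace ℝ S₁]
    [Module (CliffordAlgebra (cliffordForm ε₁)) S₁]
    [IsScalarTower ℝ (CliffordAlgebra (cliffordForm ε₁)) S₁]
    [IsSimpleModule (CliffordAlgebra (cliffordForm ε₁)) S₁]
    (S₂ : Type*) [NormedAddCommGroup S₂] [NormedSpace ℝ S₂]
    [Module (CliffordAlgebra (cliffordForm ε₂)) S₂]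
    [IsScalarTower ℝ (CliffordAlgebra (cliffordForm ε₂)) S₂]
    [IsSimpleModule (CliffordAlgebra (cliffordForm ε₂)) S₂] :
    (Module.finrank ℝ ((σ₁.prod σ₂).parallelSpinors S) : ℝ) =
      Module.finrank ℝ S * (σ₁.kappa S₁ * σ₂.kappa S₂) := by
  obtain ⟨x₀⟩ : Nonempty M₁ := inferInstance
  obtain ⟨a₀, hx₀⟩ := σ₁.cover x₀
  have hinj := σ₁.evalParallel_injective (S := S) hx₀
  have hmul : ∀ (c : CliffordAlgebra (cliffordForm ε₂)) (d : CliffordAlgebra (cliffordForm ε₁)),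
      CliffordAlgebra.involute d = d → ∀ s : S, cliffordAct S c (d • s) = d • cliffordAct S c s :=
    fun c d hd s => smul_comm_of_even h₁ h₂ hd c s
  -- Stability under the second Clifford algebra holds because its elements commute with even
  -- elements of the first and thus map parallel spinors on M₁ to parallel spinors.
  let W : Submodule (CliffordAlgebra (cliffordForm ε₂)) S :=
    { carrier := Set.range (σ₁.evalParallel S a₀ x₀)
      zero_mem' := ⟨0, map_zero _⟩
      add_mem' := by
        rintro _ _ ⟨s, rfl⟩ ⟨t, rfl⟩
        exact ⟨s + t, map_add _ _ _⟩
      smul_mem' := by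
        rintro c _ ⟨s, rfl⟩
        exact ⟨σ₁.mapParallel (cliffordAct S c) (hmul c) s, rfl⟩ }
  let j : W →ₗ[ℝ] S := W.subtype.restrictScalars ℝ
  have hj : Function.Injective j := Subtype.val_injective
  have : FiniteDimensional ℝ W := Module.Finite.of_injective j hj
  let e := LinearEquiv.ofInjective (σ₁.evalParallel S a₀ x₀) hinj
  -- The parallel extension of a value at x₀. It respects the second Clifford algebra because
  -- parallel spinors with equal values at x₀ coincide.
  let Φ : W →ₗ[ℝ] σ₁.parallelSpinors S :=
    e.symm.toLinearMap ∘ₗ j.codRestrict (LinearMap.range (σ₁.evalParallel S a₀ x₀)) fun w => w.2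
  have hev : ∀ w, σ₁.evalParallel S a₀ x₀ (Φ w) = j w := fun w =>
    congrArg Subtype.val (e.apply_symm_apply _)
  have hΦ : ∀ (c : CliffordAlgebra (cliffordForm ε₂)) w a x,
      (Φ (c • w)).1 a x = c • (Φ w).1 a x := by
    intro c w a x
    have h : Φ (c • w) = σ₁.mapParallel (cliffordAct S c) (hmul c) (Φ w) := by
      refine hinj ((hev _).trans ?_)
      change c • j w = c • (σ₁.evalParallel S a₀ x₀ (Φ w))
      rw [hev]
    rw [h]; rfl
  have hΦb : Function.Bijective Φ := by
    refine ⟨fun w w' h => hj (by rw [← hev, ← hev, h]), fun s => ⟨⟨_, s, rfl⟩, hinj ?_⟩⟩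
    rw [hev]; rfl
  have hW : (Module.finrank ℝ W : ℝ) = Module.finrank ℝ S * σ₁.kappa S₁ := by
    rw [(LinearEquiv.ofBijective Φ hΦb).finrank_eq, σ₁.finrank_parallelSpinors_mul S₁ S]
  let T : (σ₁.prod σ₂).parallelSpinors S →ₗ[ℝ] σ₂.parallelSpinors S :=
    { toFun := fun s => ⟨fun b y => s.1 (a₀, b) (x₀, y),
        slice_right_mem_parallelSpinors σ₁ σ₂ h₁ h₂ s.2 hx₀⟩
      map_add' := fun _ _ => rfl
      map_smul' := fun _ _ => rfl }
  let J : σ₂.parallelSpinors W →ₗ[ℝ] σ₂.parallelSpinors S :=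
    σ₂.mapParallel j fun c _ w => rfl
  have hT : Function.Injective T := by
    obtain ⟨y₀⟩ : Nonempty M₂ := inferInstance
    obtain ⟨b₀, hy₀⟩ := σ₂.cover y₀
    intro s s' h
    refine (σ₁.prod σ₂).evalParallel_injective (S := S) (a := (a₀, b₀)) (x := (x₀, y₀))
      ⟨hx₀, hy₀⟩ ?_
    exact congrFun (congrFun (congrArg Subtype.val h) b₀) y₀
  have hJ : Function.Injective J := by
    intro t t' h
    refine Subtype.ext (funext₂ fun b y => hj ?_)
    exact congrFun (congrFun (congrArg Subtype.val h) b) y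
  -- Restricting to the slice over x₀ gives values in W, as the slices along M₁ are parallel;
  -- conversely the parallel extension of a W-valued section along M₁ restricts back to that
  -- section.
  have hTJ : LinearMap.range T = LinearMap.range J := by
    refine le_antisymm ?_ ?_
    · rintro _ ⟨s, rfl⟩
      obtain ⟨t, ht, h⟩ := exists_parallel_lift j hj (fun _ _ => rfl) (T s).2 fun b y => by
        refine ⟨⟨_, ⟨⟨_, slice_left_mem_parallelSpinors σ₁ σ₂ h₁ h₂ s.2 b y⟩, rfl⟩⟩, rfl⟩
      exact ⟨⟨t, ht⟩, Subtype.ext (funext₂ h)⟩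
    · rintro _ ⟨t, rfl⟩
      refine ⟨⟨_, prod_mem_parallelSpinors σ₁ σ₂ h₁ h₂ Φ hΦ t.2⟩, Subtype.ext ?_⟩
      exact funext₂ fun b y => hev (t.1 b y)
  rw [← LinearMap.finrank_range_of_inj hT, hTJ, LinearMap.finrank_range_of_inj hJ,
    σ₂.finrank_parallelSpinors_mul S₂ W, hW, mul_assoc]

/-- Multiplicativity of the invariant `κ`. -/
theorem kappa_prod [ConnectedSpace M₁] [ConnectedSpace M₂]
    (S₁ : Type*) [NormedAddCommGroup S₁] [NormedSpace ℝ S₁]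
    [Module (CliffordAlgebra (cliffordForm ε₁)) S₁]
    [IsScalarTower ℝ (CliffordAlgebra (cliffordForm ε₁)) S₁]
    [IsSimpleModule (CliffordAlgebra (cliffordForm ε₁)) S₁]
    (S₂ : Type*) [NormedAddCommGroup S₂] [NormedSpace ℝ S₂]
    [Module (CliffordAlgebra (cliffordForm ε₂)) S₂]
    [IsScalarTower ℝ (CliffordAlgebra (cliffordForm ε₂)) S₂]
    [IsSimpleModule (CliffordAlgebra (cliffordForm ε₂)) S₂]
    (S : Type*) [NormedAddCommGroup S] [NormedSpace ℝ S]
    [Module (CliffordAlgebra (cliffordForm (Sum.elim ε₁ ε₂))) S]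
    [IsScalarTower ℝ (CliffordAlgebra (cliffordForm (Sum.elim ε₁ ε₂))) S]
    [IsSimpleModule (CliffordAlgebra (cliffordForm (Sum.elim ε₁ ε₂))) S] :
    (σ₁.prod σ₂).kappa S = σ₁.kappa S₁ * σ₂.kappa S₂ := by
  have := finiteDimensional_of_isSimpleModule (Sum.elim ε₁ ε₂) S
  have := IsSimpleModule.nontrivial (CliffordAlgebra (cliffordForm (Sum.elim ε₁ ε₂))) S
  let m₁ : Module (CliffordAlgebra (cliffordForm ε₁)) S :=
    Module.compHom S (CliffordAlgebra.map (cliffordInl ε₁ ε₂)).toRingHom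
  let m₂ : Module (CliffordAlgebra (cliffordForm ε₂)) S :=
    Module.compHom S (CliffordAlgebra.map (cliffordInr ε₁ ε₂)).toRingHom
  have h₁ : ∀ (c : CliffordAlgebra (cliffordForm ε₁)) (s : S),
    c • s = CliffordAlgebra.map (cliffordInl ε₁ ε₂) c • s := fun _ _ => rfl
  have h₂ : ∀ (c : CliffordAlgebra (cliffordForm ε₂)) (s : S),
    c • s = CliffordAlgebra.map (cliffordInr ε₁ ε₂) c • s := fun _ _ => rfl
  have t₁ : IsScalarTower ℝ (CliffordAlgebra (cliffordForm ε₁)) S :=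
    ⟨fun r c s => by rw [h₁, h₁, map_smul, smul_assoc]⟩
  have t₂ : IsScalarTower ℝ (CliffordAlgebra (cliffordForm ε₂)) S :=
    ⟨fun r c s => by rw [h₂, h₂, map_smul, smul_assoc]⟩
  have hS : (Module.finrank ℝ S : ℝ) ≠ 0 := by
    exact_mod_cast (Module.finrank_pos (R := ℝ) (M := S)).ne'
  rw [kappa, finrank_parallelSpinors_prod σ₁ σ₂ h₁ h₂ S₁ S₂, mul_div_cancel_left₀ _ hS]

end SpinStructure

end ProductParallel

/-! ### A maximal number of parallel spinors implies flatness. -/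

section FlatFromParallel

open Filter Topology VectorField

variable {E : Type*} [NormedAddCommGroup E] [NormedSpace ℝ E] [FiniteDimensional ℝ E]
  {H : Type*} [TopologicalSpace H] {I : ModelWithCorners ℝ E H} [I.Boundaryless]
  {M : Type*} [TopologicalSpace M] [ChartedSpace H M] [IsManifold I ∞ M]
  {ι : Type*} [Fintype ι] [DecidableEq ι]
  {g : PseudoRiemannianMetric I M} {ε : ι → ℤˣ} {A : Type*}
  {S : Type*} [NormedAddCommGroup S] [NormedSpace ℝ S]
  [Module (CliffordAlgebra (cliffordForm ε)) S]
  [IsScalarTower ℝ (CliffordAlgebra (cliffordForm ε)) S]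

namespace SpinStructure

variable (σ : SpinStructure g ε A) {a b : A} {x : M} {X Y : ∀ x : M, TangentSpace I x}

/-- The curvature annihilates parallel spinors. -/
theorem spinLift_curvatureCoeff_smul [FiniteDimensional ℝ S] {s : A → M → S}
    (hs : s ∈ σ.parallelSpinors S) (hx : x ∈ σ.U a)
    (hX : ContMDiffAt I I.tangent ∞ (sectionMap I X) x)
    (hY : ContMDiffAt I I.tangent ∞ (sectionMap I Y) x) :
    spinLift ε (σ.curvatureCoeff a X Y x) • s a x = 0 := by
  -- The equation ds = −ωs is differentiated once more and the first derivative substituted again.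
  -- Comparing the commutator of second derivatives with the bracket yields the integrability
  -- condition Rs = 0.
  have key : ∀ {X Y : ∀ x : M, TangentSpace I x}, ContMDiffAt I I.tangent ∞ (sectionMap I X) x →
      ContMDiffAt I I.tangent ∞ (sectionMap I Y) x →
      mvfderiv I (fun y => mvfderiv I (s a) y (Y y)) x (X x) =
        -(spinLift ε (fun i j => mvfderiv I (fun y => σ.frameCoeff a (Y y) i j) x (X x)) • s a x) +
          (σ.connectionForm a (Y x) * σ.connectionForm a (X x)) • s a x := by
    intro X Y _ hY
    have hev : (fun y => mvfderiv I (s a) y (Y y)) =ᶠ[𝓝 x]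
        -fun y => σ.connectionForm a (Y y) • s a y := by
      filter_upwards [σ.U_mem_nhds hx] with y hy
      exact σ.mvfderiv_parallel hs hy _
    rw [mvfderiv_congr hev, mvfderiv_neg, neg_apply,
      (σ.hasAlgDerivAt_connectionForm hx hY).clifford_smul (σ.mdifferentiableAt_parallel hs hx),
      σ.mvfderiv_parallel hs hx, smul_neg, neg_add, neg_neg, mul_smul]
  have h := mvfderiv_mlieBracket hX hY ((hs.2.1 a).contMDiffAt (σ.U_mem_nhds hx))
  rw [key hX hY, key hY hX, σ.mvfderiv_parallel hs hx] at h
  rw [σ.spinLift_curvatureCoeff hx hX hY, add_smul, sub_smul, sub_smul, sub_smul]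
  rw [neg_eq_iff_eq_neg] at h
  rw [h]
  abel

/-- If the space of parallel spinors has maximal dimension, then the metric is flat. -/
theorem isFlat_of_kappa_eq_one [ConnectedSpace M]
    [IsSimpleModule (CliffordAlgebra (cliffordForm ε)) S] (h : σ.kappa S = 1) : g.IsFlat := by
  have := finiteDimensional_of_isSimpleModule ε S
  have := IsSimpleModule.nontrivial (CliffordAlgebra (cliffordForm ε)) S
  have := σ.finite_parallelSpinors S
  have hS : (Module.finrank ℝ S : ℝ) ≠ 0 := by
    exact_mod_cast (Module.finrank_pos (R := ℝ) (M := S)).ne'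
  have hdim : Module.finrank ℝ (σ.parallelSpinors S) = Module.finrank ℝ S := by
    rw [kappa, div_eq_one_iff_eq hS] at h
    exact_mod_cast h
  intro U X Y Z hU hX hY hZ x hxU
  obtain ⟨a, hx⟩ := σ.cover x
  have hX' := hX.contMDiffAt (hU.mem_nhds hxU)
  have hY' := hY.contMDiffAt (hU.mem_nhds hxU)
  -- Evaluation is injective between spaces of equal dimension, so parallel spinors take every value
  -- at x. The lifted curvature thus annihilates S, and being even it is zero.
  have hsurj : Function.Surjective (σ.evalParallel S a x) :=
    (LinearMap.injective_iff_surjective_of_finrank_eq_finrank hdim).1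
      (σ.evalParallel_injective hx)
  refine σ.curvature_eq_zero hx hX' hY' (hZ.contMDiffAt (hU.mem_nhds hxU)) ?_
  have hzero : ∀ s : S, spinLift ε (σ.curvatureCoeff a X Y x) • s = 0 := by
    intro s
    obtain ⟨s, rfl⟩ := hsurj s
    exact σ.spinLift_curvatureCoeff_smul s.2 hx hX' hY'
  exact eq_zero_of_smul_eq_zero S hzero (by rwa [involute_spinLift])

end SpinStructure

end FlatFromParallel

/-! ### Integration of a flat linear connection along rays. -/

section FlatConnection

open Filter Topology Set

variable {E F : Type*} [NormedAddCommGroup E] [NormedSpace ℝ E]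
  [NormedAddCommGroup F] [NormedSpace ℝ F]

/-- Solutions of linear equations along a short segment. -/
theorem exists_solution_segment [CompleteSpace F] {T : ℝ → F →L[ℝ] F}
    (hT : ContinuousOn T (Icc 0 1)) (hb : ∀ t ∈ Icc (0 : ℝ) 1, ‖T t‖ ≤ 1 / 4) (w : F) :
    ∃ y : ℝ → F, y 0 = w ∧ ∀ t ∈ Icc (0 : ℝ) 1, HasDerivWithinAt y (T t (y t)) (Icc 0 1) t := by
  -- On the closed ball of radius a about w the vector field has norm at most (‖w‖ + a)/4 ≤ a, so
  -- Picard–Lindelöf applies on the whole unit time interval.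
  let a : NNReal := ‖w‖₊ + 1
  have hpl : IsPicardLindelof (fun t => T t) (tmin := 0) (tmax := 1)
      ⟨0, left_mem_Icc.2 zero_le_one⟩ w a 0 a 1 := by
    refine ⟨fun t ht => ?_, fun v _ => ?_, fun t ht v hv => ?_, ?_⟩
    · refine ((T t).lipschitz.weaken ?_).lipschitzOnWith
      rw [← NNReal.coe_le_coe]
      exact (hb t ht).trans (by norm_num)
    · exact hT.clm_apply continuousOn_const
    · have hv' : ‖v‖ ≤ ‖w‖ + a := by
        rw [mem_closedBall_iff_norm] at hv
        calc ‖v‖ = ‖w + (v - w)‖ := by rw [add_sub_cancel]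
          _ ≤ ‖w‖ + ‖v - w‖ := norm_add_le _ _
          _ ≤ ‖w‖ + a := by gcongr
      have ha : (a : ℝ) = ‖w‖ + 1 := rfl
      calc ‖T t v‖ ≤ ‖T t‖ * ‖v‖ := (T t).le_opNorm v
        _ ≤ 1 / 4 * (‖w‖ + a) := by gcongr; exact hb t ht
        _ ≤ a := by rw [ha]; linarith [norm_nonneg w]
    · simp
  obtain ⟨y, h0, hy⟩ := hpl.exists_eq_forall_mem_Icc_hasDerivWithinAt₀
  exact ⟨y, h0, hy⟩

/-- The error term in the comparison of two neighbouring radial solutions. -/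
theorem norm_radial_error_le {B : E → E →L[ℝ] F →L[ℝ] F} {B' : E →L[ℝ] E →L[ℝ] F →L[ℝ] F}
    {p q x h : E} {t C D K : ℝ} {y : F} (hC : 0 ≤ C) (hD : 0 ≤ D) (hK : 0 ≤ K)
    (ht : t ∈ Icc (0 : ℝ) 1) (hqp : q - p = t • h)
    (hflat : B' x h y - B' h x y + (B p x (B p h y) - B p h (B p x y)) = 0)
    (hp : ‖B p‖ ≤ C) (hB' : ∀ u, ‖B' u‖ ≤ D * ‖u‖) (hrem : ‖B q - B p - B' (q - p)‖ ≤ K * ‖q - p‖ ^ 2)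
    (hxh : ‖x + h‖ ≤ 1) (hh : ‖h‖ ≤ 1) :
    ‖-(B q (x + h) y) + t • B q (x + h) (B p h y) + B p (x + h) y + t • B' x h y
      - t • B p h (B p x y)‖ ≤ (K + D + (K + D + C) * C) * ‖y‖ * ‖h‖ ^ 2 := by
  have ht1 : ‖t‖ ≤ 1 := by rw [Real.norm_of_nonneg ht.1]; exact ht.2
  have hth : ‖q - p‖ ≤ ‖h‖ := by
    rw [hqp, norm_smul]
    exact mul_le_of_le_one_left (norm_nonneg _) ht1
  have hrem' : ‖B q - B p - B' (q - p)‖ ≤ K * ‖h‖ ^ 2 := hrem.trans (by gcongr)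
  have hdiff : ‖B q - B p‖ ≤ (K + D) * ‖h‖ := by
    calc ‖B q - B p‖ = ‖(B q - B p - B' (q - p)) + B' (q - p)‖ := by rw [sub_add_cancel]
      _ ≤ K * ‖h‖ ^ 2 + D * ‖h‖ := by
        refine (norm_add_le (E := E →L[ℝ] F →L[ℝ] F) _ _).trans (add_le_add hrem' ?_)
        exact (hB' _).trans (by gcongr)
      _ ≤ (K + D) * ‖h‖ := by nlinarith [norm_nonneg h, mul_nonneg hK (norm_nonneg h)]
  have hdecomp : -(B q (x + h) y) + t • B q (x + h) (B p h y) + B p (x + h) y + t • B' x h y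
      - t • B p h (B p x y) =
      -((B q - B p - B' (q - p)) (x + h) y) - t • B' h h y
        + t • ((B q - B p) (x + h) (B p h y) + B p h (B p h y)) := by
    -- Flatness exchanges the two directions. The term B'(h, x) then cancels against the first-order
    -- Taylor term of B q − B p, so no contribution linear in h survives.
    have e : B' x h y = B' h x y - (B p x (B p h y) - B p h (B p x y)) := by
      rw [← sub_eq_zero, ← hflat]; abel
    rw [e, hqp]
    simp only [map_smul, map_add, sub_apply, smul_apply, add_apply, smul_add, smul_sub]
    abel
  rw [hdecomp]
  have b₁ : ‖(B q - B p - B' (q - p)) (x + h) y‖ ≤ K * ‖h‖ ^ 2 * 1 * ‖y‖ :=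
    (ContinuousLinearMap.le_opNorm₂ _ _ _).trans (by gcongr)
  have b₂ : ‖t • B' h h y‖ ≤ 1 * (D * ‖h‖ * ‖h‖ * ‖y‖) := by
    rw [norm_smul]
    refine mul_le_mul ht1 ?_ (norm_nonneg _) zero_le_one
    refine ((B' h h).le_opNorm y).trans ?_
    gcongr
    exact ((B' h).le_opNorm h).trans (by gcongr; exact hB' h)
  have b₃ : ‖B p h y‖ ≤ C * ‖h‖ * ‖y‖ := (ContinuousLinearMap.le_opNorm₂ _ _ _).trans (by gcongr)
  have b₄ : ‖(B q - B p) (x + h) (B p h y)‖ ≤ (K + D) * ‖h‖ * 1 * (C * ‖h‖ * ‖y‖) :=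
    (ContinuousLinearMap.le_opNorm₂ _ _ _).trans (by gcongr)
  have b₅ : ‖B p h (B p h y)‖ ≤ C * ‖h‖ * (C * ‖h‖ * ‖y‖) :=
    (ContinuousLinearMap.le_opNorm₂ _ _ _).trans (by gcongr)
  have b₆ : ‖t • ((B q - B p) (x + h) (B p h y) + B p h (B p h y))‖ ≤
      1 * ((K + D) * ‖h‖ * 1 * (C * ‖h‖ * ‖y‖) + C * ‖h‖ * (C * ‖h‖ * ‖y‖)) := by
    rw [norm_smul]
    exact mul_le_mul ht1 ((norm_add_le _ _).trans (add_le_add b₄ b₅)) (norm_nonneg _) zero_le_one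
  rw [← norm_neg] at b₁
  refine (norm_add_le _ _).trans ((add_le_add ((norm_sub_le _ _).trans (add_le_add b₁ b₂)) b₆).trans
    (le_of_eq ?_))
  ring

/-- Parallel sections of a flat connection through a prescribed value, in a ball. -/
theorem exists_parallel_of_flat_at_zero [CompleteSpace F] {B : E → E →L[ℝ] F →L[ℝ] F}
    {B' : E → E →L[ℝ] E →L[ℝ] F →L[ℝ] F} {r C D K : ℝ} (hr : 0 < r) (hr1 : r ≤ 1) (hC : 0 < C)
    (hD : 0 ≤ D) (hK : 0 ≤ K) (hrC : C * r ≤ 1 / 4)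
    (hB : ∀ p ∈ Metric.ball (0 : E) r, HasFDerivAt B (B' p) p)
    (hbC : ∀ p ∈ Metric.ball (0 : E) r, ‖B p‖ ≤ C) 
    (hbD : ∀ p ∈ Metric.ball (0 : E) r, ∀ u, ‖B' p u‖ ≤ D * ‖u‖)
    (hrem : ∀ p ∈ Metric.ball (0 : E) r, ∀ q ∈ Metric.ball (0 : E) r,
      ‖B q - B p - B' p (q - p)‖ ≤ K * ‖q - p‖ ^ 2)
    (hflat : ∀ p ∈ Metric.ball (0 : E) r, ∀ u v s,
      B' p u v s - B' p v u s + (B p u (B p v s) - B p v (B p u s)) = 0) (w : F) :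
    ∃ t : E → F, t 0 = w ∧
      ∀ x ∈ Metric.ball (0 : E) r, HasFDerivAt t (-((B x).flip (t x))) x := by
  have hmem : ∀ x ∈ Metric.ball (0 : E) r, ∀ t ∈ Icc (0 : ℝ) 1, t • x ∈ Metric.ball (0 : E) r := by
    intro x hx t ht
    rw [mem_ball_zero_iff] at hx ⊢
    rw [norm_smul, Real.norm_of_nonneg ht.1]
    exact (mul_le_of_le_one_left (norm_nonneg _) ht.2).trans_lt hx
  have hIcc : ∀ t ∈ Ico (0 : ℝ) 1, Icc (0 : ℝ) 1 ∈ 𝓝[≥] t := fun t ht =>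
    mem_of_superset (Icc_mem_nhdsGE ht.2) (Icc_subset_Icc_left ht.1)
  -- The value at x will be the time-one value of the solution along the ray to x. The condition C r
  -- ≤ 1/4 supplies the bound needed for existence up to time one; outside the ball an arbitrary
  -- function is chosen.
  have hsol : ∀ x, ∃ y : ℝ → F, x ∈ Metric.ball (0 : E) r → y 0 = w ∧
      ∀ t ∈ Icc (0 : ℝ) 1, HasDerivWithinAt y (-(B (t • x) x) (y t)) (Icc 0 1) t := by
    intro x
    by_cases hx : x ∈ Metric.ball (0 : E) r
    · have hc : ContinuousOn (fun t : ℝ => -(B (t • x) x)) (Icc 0 1) := fun t ht => by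
        have h₁ : ContinuousAt (fun t : ℝ => B (t • x)) t :=
          ContinuousAt.comp (f := fun t : ℝ => t • x) (hB _ (hmem x hx t ht)).continuousAt
            (by fun_prop)
        exact (h₁.clm_apply continuousAt_const).neg.continuousWithinAt
      have hn : ∀ t ∈ Icc (0 : ℝ) 1, ‖-(B (t • x) x)‖ ≤ 1 / 4 := fun t ht => by
        rw [norm_neg]
        refine ((B (t • x)).le_opNorm x).trans (le_trans ?_ hrC)
        have := (mem_ball_zero_iff.1 hx).le
        have := hbC _ (hmem x hx t ht)
        gcongr
      obtain ⟨y, h0, hy⟩ := exists_solution_segment hc hn w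
      exact ⟨y, fun _ => ⟨h0, hy⟩⟩
    · exact ⟨0, fun h => absurd h hx⟩
  choose y hy using hsol
  refine ⟨fun x => y x 1, ?_, fun x hx => ?_⟩
  -- At the centre the ray is constant, so the equation reads y' = 0.
  · have h0 : (0 : E) ∈ Metric.ball (0 : E) r := Metric.mem_ball_self hr
    obtain ⟨h1, h2⟩ := hy 0 h0
    have hc : ∀ t ∈ Icc (0 : ℝ) 1, ‖y 0 t - y 0 0‖ ≤ 0 * (t - 0) := by
      refine norm_image_sub_le_of_norm_deriv_right_le_segment (f' := fun _ => 0)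
        (fun t ht => (h2 t ht).continuousWithinAt) (fun t ht => ?_) (by simp)
      simpa using (h2 t (Ico_subset_Icc_self ht)).mono_of_mem_nhdsWithin (hIcc t ht)
    have := hc 1 (right_mem_Icc.2 zero_le_one)
    rw [zero_mul, norm_le_zero_iff, sub_eq_zero] at this
    exact this.trans h1
  obtain ⟨hy0, hyd⟩ := hy x hx
  obtain ⟨Y, hY⟩ := isCompact_Icc.exists_bound_of_continuousOn
    (f := y x) fun t ht => (hyd t ht).continuousWithinAt
  have hY0 : 0 ≤ Y := (norm_nonneg _).trans (hY 0 (left_mem_Icc.2 zero_le_one))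
  set N := (K + D + (K + D + C) * C) * Y with hN
  have key : ∀ᶠ h in 𝓝 (0 : E), ‖y (x + h) 1 - y x 1 - (-((B x).flip (y x 1))) h‖ ≤
      N / C * (Real.exp C - 1) * ‖‖h‖ ^ 2‖ := by
    have hev : ∀ᶠ h in 𝓝 (0 : E), x + h ∈ Metric.ball (0 : E) r ∧ ‖h‖ ≤ 1 := by
      refine ((by fun_prop : ContinuousAt (fun h : E => x + h) 0).eventually
        (Metric.isOpen_ball.eventually_mem (by simpa using hx))).and ?_
      filter_upwards [Metric.ball_mem_nhds (0 : E) one_pos] with h hh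
      exact (mem_ball_zero_iff.1 hh).le
    filter_upwards [hev] with h ⟨hxh, hh1⟩
    obtain ⟨hz0, hzd⟩ := hy (x + h) hxh
    -- The difference of neighbouring radial solutions minus its expected first variation −t
    -- B(tx)(h) y(t). It starts at 0 and satisfies the linear equation along x + h up to an error
    -- quadratic in h, so z(1) is quadratic in h, which is differentiability at x.
    set z : ℝ → F := fun t => y (x + h) t - y x t + t • B (t • x) h (y x t) with hz
    have hxh1 : ‖x + h‖ ≤ 1 := (mem_ball_zero_iff.1 hxh).le.trans hr1
    have hder : ∀ t ∈ Icc (0 : ℝ) 1, HasDerivWithinAt z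
        (-(B (t • (x + h)) (x + h)) (z t) + (-(B (t • (x + h)) (x + h) (y x t))
          + t • B (t • (x + h)) (x + h) (B (t • x) h (y x t)) + B (t • x) (x + h) (y x t)
          + t • B' (t • x) x h (y x t) - t • B (t • x) h (B (t • x) x (y x t)))) (Icc 0 1) t := by
      intro t ht
      have d₁ : HasDerivAt (fun t : ℝ => B (t • x)) (B' (t • x) x) t :=
        HasFDerivAt.comp_hasDerivAt (E := E →L[ℝ] F →L[ℝ] F) (F := E) (f := fun t : ℝ => t • x) t
          (hB _ (hmem x hx t ht)) (by simpa using (hasDerivAt_id t).smul_const x)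
      have d₂ : HasDerivWithinAt (fun t : ℝ => B (t • x) h) (B' (t • x) x h) (Icc 0 1) t := by
        simpa using (d₁.clm_apply (hasDerivAt_const t h)).hasDerivWithinAt
      have d₃ := d₂.clm_apply (hyd t ht)
      have d₄ := (hasDerivWithinAt_id t (Icc (0 : ℝ) 1)).smul d₃
      refine (((hzd t ht).sub (hyd t ht)).add d₄).congr_deriv ?_
      simp only [hz, id_eq, map_add, map_sub, map_smul, map_neg, smul_add, add_apply,
        one_smul, smul_neg]
      abel
    have hbound : ∀ t ∈ Icc (0 : ℝ) 1, ‖-(B (t • (x + h)) (x + h)) (z t) +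
        (-(B (t • (x + h)) (x + h) (y x t))
          + t • B (t • (x + h)) (x + h) (B (t • x) h (y x t)) + B (t • x) (x + h) (y x t)
          + t • B' (t • x) x h (y x t) - t • B (t • x) h (B (t • x) x (y x t)))‖ ≤
        C * ‖z t‖ + N * ‖h‖ ^ 2 := by
      intro t ht
      have hp := hmem x hx t ht
      have hq := hmem (x + h) hxh t ht
      refine (norm_add_le _ _).trans (add_le_add ?_ ?_)
      · rw [norm_neg]
        refine (ContinuousLinearMap.le_opNorm₂ _ _ _).trans ?_
        have := hbC _ hq
        calc ‖B (t • (x + h))‖ * ‖x + h‖ * ‖z t‖ ≤ C * 1 * ‖z t‖ := by gcongr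
          _ = C * ‖z t‖ := by ring
      · refine (norm_radial_error_le hC.le hD hK ht (by rw [← smul_sub, add_sub_cancel_left])
          (hflat _ hp x h _) (hbC _ hp) (hbD _ hp) (hrem _ hp _ hq) hxh1 hh1).trans ?_
        rw [hN]
        have := hY t ht
        gcongr
    have hgr := norm_le_gronwallBound_of_norm_deriv_right_le (f := z) (δ := 0) (K := C)
      (ε := N * ‖h‖ ^ 2) (a := 0) (b := 1) (fun t ht => (hder t ht).continuousWithinAt)
      (fun t ht => (hder t (Ico_subset_Icc_self ht)).mono_of_mem_nhdsWithin (hIcc t ht))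
      (by simp [hz, hz0, hy0]) (fun t ht => hbound t (Ico_subset_Icc_self ht)) 1
      (right_mem_Icc.2 zero_le_one)
    -- With zero initial value and error N‖h‖², the Gronwall bound at time one is (N‖h‖²/C)(e^C −
    -- 1); hence the strict positivity of C.
    rw [gronwallBound_of_K_ne_0 hC.ne'] at hgr
    have hz1 : z 1 = y (x + h) 1 - y x 1 - (-((B x).flip (y x 1))) h := by
      simp [hz]
    rw [← hz1]
    refine hgr.trans (le_of_eq ?_)
    rw [Real.norm_of_nonneg (by positivity)]
    simp only [sub_zero, mul_one]
    ring
  rw [hasFDerivAt_iff_isLittleO_nhds_zero]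
  refine (Asymptotics.IsBigO.of_bound _ key).trans_isLittleO ?_
  exact Asymptotics.isLittleO_norm_pow_id one_lt_two

end FlatConnection

/-! ### Uniform Taylor estimates, translation to a general centre, and smoothness of solutions. -/

section FlatConnection

open Filter Topology Set

variable {E F G : Type*} [NormedAddCommGroup E] [NormedSpace ℝ E]
  [NormedAddCommGroup F] [NormedSpace ℝ F] [NormedAddCommGroup G] [NormedSpace ℝ G]

/-- Taylor's formula with a uniform quadratic remainder. -/
theorem ContDiffAt.exists_taylor_bounds {B : E → G} {z₀ : E} (hB : ContDiffAt ℝ 2 B z₀) :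
    ∃ r C D K : ℝ, 0 < r ∧ r ≤ 1 ∧ 0 < C ∧ 0 ≤ D ∧ 0 ≤ K ∧ C * r ≤ 1 / 4 ∧
      (∀ p ∈ Metric.ball z₀ r, HasFDerivAt B (fderiv ℝ B p) p) ∧
      (∀ p ∈ Metric.ball z₀ r, ‖B p‖ ≤ C) ∧
      (∀ p ∈ Metric.ball z₀ r, ∀ u, ‖fderiv ℝ B p u‖ ≤ D * ‖u‖) ∧
      ∀ p ∈ Metric.ball z₀ r, ∀ q ∈ Metric.ball z₀ r,
        ‖B q - B p - fderiv ℝ B p (q - p)‖ ≤ K * ‖q - p‖ ^ 2 := by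
  have h1 : ContDiffAt ℝ 1 (fderiv ℝ B) z₀ := hB.fderiv_right (by norm_num)
  obtain ⟨K, s, hs, hK⟩ := h1.exists_lipschitzOnWith
  have hd : ∀ᶠ z in 𝓝 z₀, DifferentiableAt ℝ B z :=
    (hB.eventually (by simp)).mono fun z hz => hz.differentiableAt (by simp)
  have hev : ∀ᶠ z in 𝓝 z₀, DifferentiableAt ℝ B z ∧ ‖B z‖ ≤ ‖B z₀‖ + 1 ∧
      ‖fderiv ℝ B z‖ ≤ ‖fderiv ℝ B z₀‖ + 1 ∧ z ∈ s :=
    hd.and ((hB.continuousAt.norm.eventually (eventually_le_nhds (lt_add_one _))).and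
      ((h1.continuousAt.norm.eventually (eventually_le_nhds (lt_add_one _))).and hs))
  obtain ⟨r₀, hr₀, hball⟩ := Metric.eventually_nhds_iff_ball.1 hev
  set C := ‖B z₀‖ + 1 with hC
  have hC0 : 0 < C := by positivity
  -- The last bound gives C r ≤ 1/4, the smallness used to solve along rays.
  set r := min r₀ (min 1 (1 / (4 * C))) with hr
  have hrr : Metric.ball z₀ r ⊆ Metric.ball z₀ r₀ := Metric.ball_subset_ball (min_le_left _ _)
  refine ⟨r, C, ‖fderiv ℝ B z₀‖ + 1, K, ?_, ?_, hC0, by positivity, K.2, ?_,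
    fun p hp => (hball p (hrr hp)).1.hasFDerivAt, fun p hp => (hball p (hrr hp)).2.1,
    fun p hp u => ?_, fun p hp q hq => ?_⟩
  · exact lt_min hr₀ (lt_min one_pos (by positivity))
  · exact (min_le_right _ _).trans (min_le_left _ _)
  · calc C * r ≤ C * (1 / (4 * C)) := by
          gcongr
          exact (min_le_right _ _).trans (min_le_right _ _)
      _ = 1 / 4 := by field_simp
  · have := (hball p (hrr hp)).2.2.1
    exact ((fderiv ℝ B p).le_opNorm u).trans (by gcongr)
  -- The mean value inequality is used on the part of the ball within distance ‖q − p‖ of p, where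
  -- the Lipschitz bound keeps the derivative within K‖q − p‖ of its value at p.
  · have hp' : p ∈ Metric.closedBall p ‖q - p‖ := Metric.mem_closedBall_self (norm_nonneg _)
    have hq' : q ∈ Metric.closedBall p ‖q - p‖ := by rw [mem_closedBall_iff_norm]
    have := Convex.norm_image_sub_le_of_norm_hasFDerivWithin_le' (𝕜 := ℝ) (f := B)
      (f' := fderiv ℝ B) (φ := fderiv ℝ B p) (C := K * ‖q - p‖) (x := p) (y := q)
      (s := Metric.ball z₀ r ∩ Metric.closedBall p ‖q - p‖)
      (fun x hx => (hball x (hrr hx.1)).1.hasFDerivAt.hasFDerivWithinAt)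
      (fun x hx => by
        refine (hK.norm_sub_le (hball x (hrr hx.1)).2.2.2 (hball p (hrr hp)).2.2.2).trans ?_
        have := mem_closedBall_iff_norm.1 hx.2
        gcongr)
      ((convex_ball z₀ r).inter (convex_closedBall _ _)) ⟨hp, hp'⟩ ⟨hq, hq'⟩
    rwa [pow_two, ← mul_assoc]

/-- Parallel sections of a flat connection through a prescribed value, in a ball. -/
theorem exists_parallel_of_flat [CompleteSpace F] {B : E → E →L[ℝ] F →L[ℝ] F} {z₀ : E}
    (hB : ContDiffAt ℝ 2 B z₀)
    (hflat : ∀ᶠ p in 𝓝 z₀, ∀ u v s, fderiv ℝ B p u v s - fderiv ℝ B p v u s +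
      (B p u (B p v s) - B p v (B p u s)) = 0) :
    ∃ r > 0, ∀ w, ∃ t : E → F, t z₀ = w ∧
      ∀ z ∈ Metric.ball z₀ r, HasFDerivAt t (-((B z).flip (t z))) z := by
  obtain ⟨r₁, C, D, K, hr, hr1, hC, hD, hK, hrC, h₁, h₂, h₃, h₄⟩ :=
    ContDiffAt.exists_taylor_bounds (G := E →L[ℝ] F →L[ℝ] F) hB
  obtain ⟨r₂, hr₂, hball⟩ := Metric.eventually_nhds_iff_ball.1 hflat
  have hrpos : 0 < min r₁ r₂ := lt_min hr hr₂
  have hm : ∀ p ∈ Metric.ball (0 : E) (min r₁ r₂), z₀ + p ∈ Metric.ball z₀ r₁ := fun p hp => by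
    rw [mem_ball_iff_norm, add_sub_cancel_left]
    exact (mem_ball_zero_iff.1 hp).trans_le (min_le_left _ _)
  have hm' : ∀ p ∈ Metric.ball (0 : E) (min r₁ r₂), z₀ + p ∈ Metric.ball z₀ r₂ := fun p hp => by
    rw [mem_ball_iff_norm, add_sub_cancel_left]
    exact (mem_ball_zero_iff.1 hp).trans_le (min_le_right _ _)
  refine ⟨min r₁ r₂, hrpos, fun w => ?_⟩
  obtain ⟨t, ht0, ht⟩ := exists_parallel_of_flat_at_zero (B := fun p => B (z₀ + p))
    (B' := fun p => fderiv ℝ B (z₀ + p)) hrpos ((min_le_left _ _).trans hr1) hC hD hK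
    (le_trans (by gcongr; exact min_le_left _ _) hrC)
    (fun p hp => (hasFDerivAt_comp_add_left z₀).2 (h₁ _ (hm p hp))) (fun p hp => h₂ _ (hm p hp))
    (fun p hp => h₃ _ (hm p hp))
    (fun p hp q hq => by simpa using h₄ _ (hm p hp) _ (hm q hq))
    (fun p hp => hball _ (hm' p hp)) w
  refine ⟨fun z => t (z - z₀), by simpa using ht0, fun z hz => ?_⟩
  have h := ht (z - z₀) (by rwa [mem_ball_zero_iff, ← mem_ball_iff_norm])
  rw [add_sub_cancel] at h
  exact (hasFDerivAt_comp_sub z₀).2 h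

/-- Solutions of a linear total differential equation with smooth coefficients are smooth. -/
theorem contDiffOn_of_hasFDerivAt_clm [FiniteDimensional ℝ E] {B : E → E →L[ℝ] F →L[ℝ] F}
    {t : E → F} {s : Set E}
    (hs : IsOpen s) (hB : ContDiffOn ℝ ∞ B s)
    (ht : ∀ z ∈ s, HasFDerivAt t (-((B z).flip (t z))) z) : ContDiffOn ℝ ∞ t s := by
  rw [contDiffOn_infty]
  intro n
  -- Bootstrap: if t is of class Cⁿ, the equation makes its derivative Cⁿ, so t is of class Cⁿ⁺¹.
  induction n with
  | zero => exact contDiffOn_zero.2 fun z hz => (ht z hz).continuousAt.continuousWithinAt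
  | succ n ih =>
    rw [Nat.cast_add, Nat.cast_one, contDiffOn_succ_iff_fderiv_of_isOpen hs]
    refine ⟨fun z hz => (ht z hz).differentiableAt.differentiableWithinAt, by simp, ?_⟩
    refine contDiffOn_clm_apply.2 fun v => ?_
    have hv : ContDiffOn ℝ n (fun z => B z v) s :=
      (hB.of_le (by exact_mod_cast le_top)).clm_apply contDiffOn_const
    exact (hv.clm_apply ih).neg.congr fun z hz => by rw [(ht z hz).fderiv]; rfl

end FlatConnection

/-! ### Local parallel spinors on flat manifolds. -/

section LocalParallel

open Filter Topology

variable {E : Type*} [NormedAddCommGroup E] [NormedSpace ℝ E] [FiniteDimensional ℝ E]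
  {H : Type*} [TopologicalSpace H] {I : ModelWithCorners ℝ E H} [I.Boundaryless]
  {M : Type*} [TopologicalSpace M] [ChartedSpace H M] [IsManifold I ∞ M]
  {ι : Type*} [Fintype ι] [DecidableEq ι]
  {g : PseudoRiemannianMetric I M} {ε : ι → ℤˣ} {A : Type*}
  {S : Type*} [NormedAddCommGroup S] [NormedSpace ℝ S]
  [Module (CliffordAlgebra (cliffordForm ε)) S]
  [IsScalarTower ℝ (CliffordAlgebra (cliffordForm ε)) S]

namespace SpinStructure

variable (σ : SpinStructure g ε A) {a b : A} {x : M}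

/-- Partial derivatives in a chart are derivatives along coordinate fields. This puts the derivative
of the connection operator into the form in which it occurs in Cartan's equation. -/
theorem fderiv_chartConn_apply [FiniteDimensional ℝ S] {x₀ : M} {y : E}
    (hy : y ∈ (extChartAt I x₀).target) (hya : (extChartAt I x₀).symm y ∈ σ.U a) (u v : E) (s : S) :
    fderiv ℝ (σ.chartConn (S := S) a x₀) y u v s =
      spinLift ε (fun i j => mvfderiv I (fun z => σ.frameCoeff a (chartField I x₀ v z) i j)
        ((extChartAt I x₀).symm y) (chartField I x₀ u ((extChartAt I x₀).symm y))) • s := by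
  have hd : HasFDerivAt (σ.chartConn (S := S) a x₀) (fderiv ℝ (σ.chartConn (S := S) a x₀) y) y :=
    ((σ.contDiffAt_chartConn hy hya).differentiableAt (by simp)).hasFDerivAt
  have hd' := (hd.clm_apply (hasFDerivAt_const v y)).clm_apply (hasFDerivAt_const s y)
  have hc := σ.hasAlgDerivAt_connectionForm hya
    (contMDiffAt_chartField ((extChartAt I x₀).map_target hy) v)
  have hev : (fun z => σ.chartConn (S := S) a x₀ z v s) =ᶠ[𝓝 y] fun z =>
      (fun p => σ.connectionForm a (chartField I x₀ v p) • s) ((extChartAt I x₀).symm z) := by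
    filter_upwards [(contMDiffAt_symm_of_mem hy).continuousAt.eventually
      ((σ.isOpen_U a).eventually_mem hya)] with z hz
    exact σ.chartConn_apply hz v s
  have hm : MDifferentiableAt I 𝓘(ℝ, S) (fun p => σ.connectionForm a (chartField I x₀ v p) • s)
      ((extChartAt I x₀).symm y) := (hc.map ((cliffordAct S).flip s)).mdifferentiableAt
  have h₁ := fderiv_comp_symm hy hm u
  rw [← hev.fderiv_eq, hd'.fderiv] at h₁
  refine Eq.trans ?_ (h₁.trans ((hc.map ((cliffordAct S).flip s)).mvfderiv_eq _))
  simp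

/-- Cartan's equation is applied to two coordinate fields, whose bracket vanishes, and then acts on
S. -/
theorem chartConn_flat [FiniteDimensional ℝ S] (hg : g.IsFlat) {x₀ : M} {y : E}
    (hy : y ∈ (extChartAt I x₀).target) (hya : (extChartAt I x₀).symm y ∈ σ.U a) (u v : E) (s : S) :
    fderiv ℝ (σ.chartConn (S := S) a x₀) y u v s - fderiv ℝ (σ.chartConn (S := S) a x₀) y v u s +
      (σ.chartConn a x₀ y u (σ.chartConn a x₀ y v s) -
        σ.chartConn a x₀ y v (σ.chartConn a x₀ y u s)) = 0 := by
  have hs := (extChartAt I x₀).map_target hy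
  have h := σ.spinLift_curvatureCoeff_eq_zero hg hya (isOpen_extChartAt_source x₀) hs
    (fun z hz => (contMDiffAt_chartField hz u).contMDiffWithinAt)
    (fun z hz => (contMDiffAt_chartField hz v).contMDiffWithinAt)
  have h0 : σ.connectionForm a (0 : TangentSpace I ((extChartAt I x₀).symm y)) = 0 := by
    have h := σ.connectionForm_smul hya 0 (0 : TangentSpace I ((extChartAt I x₀).symm y))
    rwa [smul_zero, zero_smul] at h
  rw [σ.spinLift_curvatureCoeff hya (contMDiffAt_chartField hs u) (contMDiffAt_chartField hs v),
    chartField_mlieBracket hy, h0, sub_zero] at h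
  rw [σ.fderiv_chartConn_apply hy hya, σ.fderiv_chartConn_apply hy hya]
  simp only [σ.chartConn_apply hya]
  rw [← mul_smul, ← mul_smul, ← sub_smul, ← sub_smul, ← add_smul, h, zero_smul]

/-- Local parallel spinors on a flat manifold through every value at a point. -/
theorem exists_local_parallel [FiniteDimensional ℝ S] (hg : g.IsFlat) (hx : x ∈ σ.U a) :
    ∃ N : Set M, IsOpen N ∧ x ∈ N ∧ N ⊆ σ.U a ∧ ∀ w, ∃ f : M → S, f x = w ∧
      ∀ y ∈ N, σ.IsParallelAt a f y := by
  have := FiniteDimensional.complete ℝ S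
  set φ := extChartAt I x with hφ
  have hxt : φ x ∈ φ.target := mem_extChartAt_target x
  have hsymm : φ.symm (φ x) = x := extChartAt_to_inv x
  have hcont : ContinuousAt φ.symm (φ x) := (contMDiffAt_symm_of_mem hxt).continuousAt
  have hxa : φ.symm (φ x) ∈ σ.U a := by rwa [hsymm]
  have hev : ∀ᶠ z in 𝓝 (φ x), z ∈ φ.target ∧ φ.symm z ∈ σ.U a :=
    ((isOpen_extChartAt_target x).eventually_mem hxt).and
      (hcont.eventually ((σ.isOpen_U a).eventually_mem hxa))
  obtain ⟨r₁, hr₁, hball⟩ := Metric.eventually_nhds_iff_ball.1 hev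
  obtain ⟨r₂, hr₂, hsol⟩ := exists_parallel_of_flat (F := S)
    ((σ.contDiffAt_chartConn hxt hxa).of_le two_le_infty)
    (hev.mono fun z hz u v s => σ.chartConn_flat hg hz.1 hz.2 u v s)
  set r := min r₁ r₂ with hr
  have hr0 : 0 < r := lt_min hr₁ hr₂
  have hle₁ : Metric.ball (φ x) r ⊆ Metric.ball (φ x) r₁ :=
    Metric.ball_subset_ball (min_le_left _ _)
  have hle₂ : Metric.ball (φ x) r ⊆ Metric.ball (φ x) r₂ :=
    Metric.ball_subset_ball (min_le_right _ _)
  refine ⟨φ.source ∩ φ ⁻¹' Metric.ball (φ x) r,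
    (continuousOn_extChartAt x).isOpen_inter_preimage (isOpen_extChartAt_source x)
      Metric.isOpen_ball, ⟨mem_extChartAt_source x, Metric.mem_ball_self hr0⟩, ?_, fun w => ?_⟩
  · rintro y ⟨hy, hyb⟩
    have := (hball _ (hle₁ hyb)).2
    rwa [φ.left_inv hy] at this
  obtain ⟨t, ht0, ht⟩ := hsol w
  refine ⟨fun y => t (φ y), ht0, ?_⟩
  have key : ∀ z ∈ Metric.ball (φ x) r, ContMDiffAt I 𝓘(ℝ, S) ∞ (fun y => t (φ y)) (φ.symm z) ∧
      ∀ v : TangentSpace I (φ.symm z), mvfderiv I (fun y => t (φ y)) (φ.symm z) v =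
        -(σ.connectionForm a v • t (φ (φ.symm z))) := by
    intro z hz
    have hzt := (hball _ (hle₁ hz)).1
    have hza := (hball _ (hle₁ hz)).2
    have htz : ContDiffAt ℝ ∞ t z :=
      (contDiffOn_of_hasFDerivAt_clm Metric.isOpen_ball (s := Metric.ball (φ x) r)
        (fun p hp => (σ.contDiffAt_chartConn (hball _ (hle₁ hp)).1
          (hball _ (hle₁ hp)).2).contDiffWithinAt)
        (fun p hp => ht p (hle₂ hp))).contDiffAt (Metric.isOpen_ball.mem_nhds hz)
    have heq : (fun z => t (φ (φ.symm z))) =ᶠ[𝓝 z] t := by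
      filter_upwards [(isOpen_extChartAt_target x).mem_nhds hzt] with p hp
      rw [φ.right_inv hp]
    have hsm : ContMDiffAt I 𝓘(ℝ, S) ∞ (fun y => t (φ y)) (φ.symm z) :=
      contMDiffAt_of_comp_symm hzt (htz.congr_of_eventuallyEq heq)
    refine ⟨hsm, fun v => ?_⟩
    -- The chart equation speaks of coordinate directions. An arbitrary tangent vector v is the
    -- value at this point of the coordinate field whose constant coefficients are those of an
    -- extension of v.
    have h₁ := fderiv_comp_symm hzt (hsm.mdifferentiableAt (by simp))
      (chartRep x (FiberBundle.extend E v) z)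
    rw [chartField_chartRep hzt, FiberBundle.extend_apply_self, heq.fderiv_eq,
      (ht z (hle₂ hz)).fderiv] at h₁
    rw [← h₁, φ.right_inv hzt]
    have h₂ := σ.chartConn_apply (S := S) hza (chartRep x (FiberBundle.extend E v) z) (t z)
    rw [chartField_chartRep hzt, FiberBundle.extend_apply_self] at h₂
    rw [← h₂]
    rfl
  rintro y ⟨hy, hyb⟩
  have := key _ hyb
  rwa [φ.left_inv hy] at this

end SpinStructure

end LocalParallel

/-! ### Transformation of the connection form under change of trivialization. -/

section Gauge

open Filter Topology

variable {E : Type*} [NormedAddCommGroup E] [NormedSpace ℝ E] [FiniteDimensional ℝ E]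
  {H : Type*} [TopologicalSpace H] {I : ModelWithCorners ℝ E H} [I.Boundaryless]
  {M : Type*} [TopologicalSpace M] [ChartedSpace H M] [IsManifold I ∞ M]
  {ι : Type*} [Fintype ι] [DecidableEq ι]
  {g : PseudoRiemannianMetric I M} {ε : ι → ℤˣ} {A : Type*}

/-- The conjugation of the Clifford algebra as a linear map. -/
noncomputable def cliffordStar (ε : ι → ℤˣ) :
    CliffordAlgebra (cliffordForm ε) →ₗ[ℝ] CliffordAlgebra (cliffordForm ε) where
  toFun := star
  map_add' := star_add
  map_smul' := CliffordAlgebra.star_smul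

namespace SpinStructure

variable (σ : SpinStructure g ε A) {a b : A} {x : M}

/-- The coefficients in the frame `a` of the `k`-th vector of the frame `b`. -/
noncomputable def frameTransition (a b : A) (k : ι) (x : M) : ι → ℝ := fun i =>
  ((ε i : ℤ) : ℝ) * g.val x (σ.frame a i x) (σ.frame b k x)

theorem lift_mul_gen (hx : x ∈ σ.U a ∩ σ.U b) (k : ι) :
    (σ.lift a b x : CliffordAlgebra (cliffordForm ε)) * cliffordGen ε k =
      CliffordAlgebra.ι (cliffordForm ε) (σ.frameTransition a b k x) *
        (σ.lift a b x : CliffordAlgebra (cliffordForm ε)) := by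
  have h := σ.lift_conj a b x hx (σ.frame b k x)
  have hk : (fun i => ((ε i : ℤ) : ℝ) * g.val x (σ.frame b i x) (σ.frame b k x)) =
      Pi.single k 1 := by
    ext i
    rw [σ.orthonormal b x hx.2]
    by_cases hik : i = k
    · subst hik; simp [intUnit_mul_self]
    · simp [hik]
  rw [hk] at h
  exact h

/-- Metricity is applied to the scalar product of a vector of each frame, with both covariant
derivatives expanded in their own frames. -/
theorem hasAlgDerivAt_frameTransition (hx : x ∈ σ.U a ∩ σ.U b) (k : ι) :
    HasAlgDerivAt I (σ.frameTransition a b k) x fun v i =>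
      -(((ε i : ℤ) : ℝ) * ∑ j, σ.frameTransition a b k x j * σ.frameCoeff a v j i) +
        ∑ j, ((ε j : ℤ) : ℝ) * σ.frameCoeff b v k j * σ.frameTransition a b j x i := by
  have hs : ∀ i, ContMDiffAt I 𝓘(ℝ, ℝ) ∞
      (fun y => ((ε i : ℤ) : ℝ) * g.val y (σ.frame a i y) (σ.frame b k y)) x := fun i =>
    contMDiffAt_const.mul (g.contMDiffAt_val (σ.contMDiffAt_frame hx.1 i)
      (σ.contMDiffAt_frame hx.2 k))
  obtain ⟨c', hc'⟩ := (algSmoothAt_pi (B := σ.frameTransition a b k) hs).exists_hasAlgDerivAt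
  convert hc' using 1
  ext v i
  refine Eq.trans ?_ ((hc' (LinearMap.proj i)).2 v)
  have hd := g.mdifferentiableAt_val (σ.mdifferentiableAt_frame hx.1 i)
    (σ.mdifferentiableAt_frame hx.2 k)
  have hm := mvfderiv_mul (f := fun _ : M => ((ε i : ℤ) : ℝ)) mdifferentiableAt_const hd
  refine Eq.trans ?_ (DFunLike.congr_fun hm v).symm
  simp only [mvfderiv_const, add_apply, smul_apply, smul_eq_mul,
    g.mvfderiv_val (σ.mdifferentiableAt_frame hx.1 i) (σ.mdifferentiableAt_frame hx.2 k)]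
  rw [σ.val_eq_sum_frame hx.1 (g.nabla v (σ.frame a i)),
    σ.val_eq_sum_frame hx.2 (σ.frame a i x) (g.nabla v (σ.frame b k))]
  have h0 : ((0 : TangentSpace I x →L[ℝ] ℝ)) v = 0 := rfl
  rw [h0, mul_zero, add_zero, mul_add, ← mul_neg, ← Finset.sum_neg_distrib, Finset.mul_sum,
    Finset.mul_sum, Finset.mul_sum]
  congr 1
  · refine Finset.sum_congr rfl fun j _ => ?_
    rw [σ.frameCoeff_skew hx.1 v j i, frameTransition, g.symm x (σ.frame a j x), frameCoeff]
    ring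
  · refine Finset.sum_congr rfl fun j _ => ?_
    rw [frameTransition, frameCoeff]
    ring

/-- The transformation law of the connection forms. -/
theorem lift_deriv (hx : x ∈ σ.U a ∩ σ.U b)
    {h' : TangentSpace I x → CliffordAlgebra (cliffordForm ε)}
    (hh : HasAlgDerivAt I (fun y => (σ.lift a b y : CliffordAlgebra (cliffordForm ε))) x h')
    (v : TangentSpace I x) :
    h' v + σ.connectionForm a v * (σ.lift a b x : CliffordAlgebra (cliffordForm ε)) -
      (σ.lift a b x : CliffordAlgebra (cliffordForm ε)) * σ.connectionForm b v = 0 := by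
  set h := (σ.lift a b x : CliffordAlgebra (cliffordForm ε)) with hdef
  set p := σ.connectionForm a v with hp
  set q := σ.connectionForm b v with hq
  have hstar : star h * h = 1 := spinGroup.star_mul_self_of_mem (σ.lift a b x).2
  have hstar' : h * star h = 1 := spinGroup.mul_star_self_of_mem (σ.lift a b x).2
  -- Let T be the frame change. Differentiating h eₖ = ι(T eₖ) h and replacing the connection
  -- coefficients by commutators with p and q shows that the defect of the transformation law
  -- intertwines vectors exactly as h does.
  have hgen : ∀ k, (h' v + p * h - h * q) * cliffordGen ε k =
      CliffordAlgebra.ι (cliffordForm ε) (σ.frameTransition a b k x) * (h' v + p * h - h * q) := by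
    intro k
    have hl := hh.map (LinearMap.mulRight ℝ (cliffordGen ε k))
    have hT := (σ.hasAlgDerivAt_frameTransition hx k).map (CliffordAlgebra.ι (cliffordForm ε))
    have hr := hT.bilin (LinearMap.mul ℝ (CliffordAlgebra (cliffordForm ε))) hh
    have hev : (fun y => LinearMap.mulRight ℝ (cliffordGen ε k)
        (σ.lift a b y : CliffordAlgebra (cliffordForm ε))) =ᶠ[𝓝 x] fun y =>
        LinearMap.mul ℝ (CliffordAlgebra (cliffordForm ε))
          (CliffordAlgebra.ι (cliffordForm ε) (σ.frameTransition a b k y)) (σ.lift a b y) := by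
      filter_upwards [((σ.isOpen_U a).inter (σ.isOpen_U b)).mem_nhds hx] with y hy
      exact σ.lift_mul_gen hy k
    have key := hl.unique (hr.congr hev) v
    have e₁ := spinLift_commutator_ι ε (σ.frameCoeff_skew hx.1 v) (σ.frameTransition a b k x)
    have e₂ := spinLift_commutator_gen ε (σ.frameCoeff_skew hx.2 v) k
    rw [← connectionForm_eq, ← hp] at e₁
    rw [← connectionForm_eq, ← hq] at e₂
    have e₃ : CliffordAlgebra.ι (cliffordForm ε) (fun i =>
        -(((ε i : ℤ) : ℝ) * ∑ j, σ.frameTransition a b k x j * σ.frameCoeff a v j i) +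
          ∑ j, ((ε j : ℤ) : ℝ) * σ.frameCoeff b v k j * σ.frameTransition a b j x i) * h =
        -(p * CliffordAlgebra.ι (cliffordForm ε) (σ.frameTransition a b k x) -
          CliffordAlgebra.ι (cliffordForm ε) (σ.frameTransition a b k x) * p) * h +
        h * (q * cliffordGen ε k - cliffordGen ε k * q) := by
      rw [e₁, e₂, ← map_neg, Finset.mul_sum]
      simp only [mul_smul_comm, hdef, σ.lift_mul_gen hx]
      simp only [← hdef, ← smul_mul_assoc, ← Finset.sum_mul, ← add_mul, ← map_smul, ← map_sum,
        ← map_add]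
      congr 2
      ext i
      simp
    have e₄ := σ.lift_mul_gen hx k
    rw [← hdef] at e₄
    simp only [LinearMap.mulRight_apply, LinearMap.mul_apply', ← hdef] at key
    rw [e₃] at key
    rw [sub_mul, add_mul, key, mul_assoc p, e₄, mul_sub, ← mul_assoc h, ← mul_assoc h, e₄]
    noncomm_ring
  have hskew : star (h' v) * h + star h * h' v = 0 := by
    have h₁ := (hh.map (cliffordStar ε)).bilin (LinearMap.mul ℝ (CliffordAlgebra (cliffordForm ε))) hh
    have hc : (fun y => LinearMap.mul ℝ (CliffordAlgebra (cliffordForm ε))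
        (cliffordStar ε (σ.lift a b y : CliffordAlgebra (cliffordForm ε))) (σ.lift a b y)) =
        fun _ => 1 := by
      ext y
      exact spinGroup.star_mul_self_of_mem (σ.lift a b y).2
    rw [hc] at h₁
    exact h₁.unique (hasAlgDerivAt_const 1) v
  have heven : CliffordAlgebra.involute (h' v) = h' v := by
    have h₁ := hh.map (CliffordAlgebra.involute (Q := cliffordForm ε)).toLinearMap
    simp only [AlgHom.toLinearMap_apply, σ.involute_lift] at h₁
    exact h₁.unique hh v
  have hinv : CliffordAlgebra.involute h = h := σ.involute_lift a b x
  have hinv' : CliffordAlgebra.involute (star h) = star h :=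
    CliffordAlgebra.involute_eq_of_mem_even
      (spinGroup.mem_even (spinGroup.star_mem (σ.lift a b x).2))
  have hp₁ : star p = -p := star_spinLift ε (σ.frameCoeff_skew hx.1 v)
  have hq₁ : star q = -q := star_spinLift ε (σ.frameCoeff_skew hx.2 v)
  -- Multiplied by h⁻¹ = star h, the defect commutes with all vectors. It is even, and it is skew
  -- because h is unitary and p, q are skew; hence it vanishes.
  have hzero : star h * (h' v + p * h - h * q) = 0 := by
    refine eq_zero_of_even_of_commute_of_star_eq_neg ε ?_ (fun k => ?_) ?_
    · rw [map_mul, hinv', map_sub, map_add, map_mul, map_mul, heven, hinv, hp, hq,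
        σ.involute_connectionForm, σ.involute_connectionForm]
    · rw [mul_assoc, hgen]
      have e₄ := σ.lift_mul_gen hx k
      rw [← hdef] at e₄
      have e₅ : star h * CliffordAlgebra.ι (cliffordForm ε) (σ.frameTransition a b k x) =
          cliffordGen ε k * star h := by
        calc _ = star h * (CliffordAlgebra.ι (cliffordForm ε) (σ.frameTransition a b k x) * h) *
              star h := by rw [mul_assoc, mul_assoc, hstar', mul_one]
          _ = _ := by rw [← e₄, ← mul_assoc, hstar, one_mul]
      rw [← mul_assoc, e₅, mul_assoc]
    · rw [mul_sub, mul_add, ← mul_assoc _ h, hstar, one_mul]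
      simp only [star_sub, star_add, star_mul, star_star, hp₁, hq₁, eq_neg_of_add_eq_zero_left hskew]
      noncomm_ring
  calc _ = h * star h * (h' v + p * h - h * q) := by rw [hstar', one_mul]
    _ = 0 := by rw [mul_assoc, hzero, mul_zero]

end SpinStructure

end Gauge

/-! ### Flat sections over simply connected spaces. -/

open Topology Filter in
/-- On a simply connected space, a system of locally constant transition functions has a
flat section through every prescribed value at a point. -/
theorem exists_flat_section {X F : Type*} [TopologicalSpace X] [SimplyConnectedSpace X]
    [LocallyPathConnectedSpace X] (N : X → Set X) (hN : ∀ i, IsOpen (N i)) (hmem : ∀ i, i ∈ N i)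
    (C : X → X → X → F → F) (hself : ∀ i, ∀ y ∈ N i, ∀ w, C i i y w = w)
    (hcomp : ∀ i j k, ∀ y ∈ N i ∩ N j ∩ N k, ∀ w, C j k y (C i j y w) = C i k y w)
    (hloc : ∀ i j, ∀ y ∈ N i ∩ N j, ∀ w, ∀ᶠ z in 𝓝 y, C i j z w = C i j y w) (x₀ : X) (w₀ : F) :
    ∃ s : X → F, s x₀ = w₀ ∧ ∀ y, ∀ᶠ z in 𝓝 y, z ∈ N y ∧ C z y z (s z) = s y := by
  -- With the discrete topology on the fibre, locally constant transition maps are continuous, and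
  -- the fibre bundle they define is a covering.
  let _ : TopologicalSpace F := ⊥
  have : DiscreteTopology F := ⟨rfl⟩
  let Z : FiberBundleCore X X F :=
    { baseSet := N
      isOpen_baseSet := hN
      indexAt := id
      mem_baseSet_at := hmem
      coordChange := C
      coordChange_self := hself
      continuousOn_coordChange := by
        rintro i j ⟨y, w⟩ ⟨hy, -⟩
        refine ContinuousAt.continuousWithinAt ?_
        refine tendsto_nhds_of_eventually_eq ?_
        rw [nhds_prod_eq, nhds_discrete F, prod_pure, eventually_map]
        exact hloc i j y hy w
      coordChange_comp := hcomp }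
  have hcov : IsCoveringMap (Bundle.TotalSpace.proj : Z.TotalSpace → X) :=
    FiberBundle.isCoveringMap (F := F) (E := Z.Fiber)
  -- A global section is a lift of the identity map, which exists because the base is simply
  -- connected and locally path connected.
  obtain ⟨s, ⟨hs₀, hs⟩, -⟩ := hcov.existsUnique_continuousMap_lifts (ContinuousMap.id X) x₀
    ⟨x₀, w₀⟩ rfl
  have hproj : ∀ y, (s y).1 = y := fun y => congrFun hs y
  let f : X → F := fun y => (s y).2
  have htriv : ∀ y z, (Z.localTriv y (s z)).2 = C z y z (f z) := fun y z => by
    change C (s z).1 y (s z).1 (f z) = _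
    rw [hproj]
  refine ⟨f, congrArg (fun e : Z.TotalSpace => (e.2 : F)) hs₀, fun y => ?_⟩
  have hc : ContinuousAt (fun z => (Z.localTriv y (s z)).2) y := by
    refine continuousAt_snd.comp
      (ContinuousAt.comp (g := Z.localTriv y) ?_ s.continuous.continuousAt)
    refine (Z.localTriv y).continuousAt ?_
    change (s y).1 ∈ N y
    rw [hproj]
    exact hmem y
  have hev : ∀ᶠ z in 𝓝 y, C z y z (f z) = C y y y (f y) := by
    simp only [htriv] at hc
    have := hc.eventually (p := fun w => w = C y y y (f y))
    rw [nhds_discrete F] at this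
    exact this rfl
  rw [hself y y (hmem y)] at hev
  exact ((hN y).eventually_mem (hmem y)).and hev

/-! ### Global parallel spinors on simply connected flat manifolds. -/

section Gluing

open Filter Topology

variable {E : Type*} [NormedAddCommGroup E] [NormedSpace ℝ E] [FiniteDimensional ℝ E]
  {H : Type*} [TopologicalSpace H] {I : ModelWithCorners ℝ E H} [I.Boundaryless]
  {M : Type*} [TopologicalSpace M] [ChartedSpace H M] [IsManifold I ∞ M]
  {ι : Type*} [Fintype ι] [DecidableEq ι]
  {g : PseudoRiemannianMetric I M} {ε : ι → ℤˣ} {A : Type*}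
  {S : Type*} [NormedAddCommGroup S] [NormedSpace ℝ S]
  [Module (CliffordAlgebra (cliffordForm ε)) S]
  [IsScalarTower ℝ (CliffordAlgebra (cliffordForm ε)) S]

namespace SpinStructure

variable (σ : SpinStructure g ε A) {a b : A} {x : M} {f f' : M → S}

variable {σ} in
theorem IsParallelAt.congr (h : σ.IsParallelAt a f x) (hf : f' =ᶠ[𝓝 x] f) :
    σ.IsParallelAt a f' x :=
  ⟨h.1.congr_of_eventuallyEq hf, fun v => by rw [mvfderiv_congr hf, h.2, hf.eq_of_nhds]⟩

variable {σ} in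
theorem IsParallelAt.sub (h : σ.IsParallelAt a f x) (h' : σ.IsParallelAt a f' x) :
    σ.IsParallelAt a (fun y => f y - f' y) x := by
  refine ⟨h.1.sub h'.1, fun v => ?_⟩
  have e := DFunLike.congr_fun (mvfderiv_sub (h.1.mdifferentiableAt (by simp))
    (h'.1.mdifferentiableAt (by simp))) v
  refine e.trans ?_
  rw [sub_apply, h.2, h'.2, smul_sub]
  abel

variable {σ} in
theorem IsParallelAt.sum_smul {κ : Type*} [Fintype κ] {f : κ → M → S}
    (h : ∀ k, σ.IsParallelAt a (f k) x) (c : κ → ℝ) :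
    σ.IsParallelAt a (fun y => ∑ k, c k • f k y) x := by
  have hs : ∀ k, ContMDiffAt I 𝓘(ℝ, S) ∞ (fun y => c k • f k y) x := fun k =>
    (contMDiffAt_const (I := I) (I' := 𝓘(ℝ, ℝ)) (c := c k)).smul (h k).1
  refine ⟨contMDiffAt_finsetSum fun k _ => hs k, fun v => ?_⟩
  rw [(mdifferentiableAt_sum fun k _ => (hs k).mdifferentiableAt (by simp)).2 v, Finset.smul_sum,
    ← Finset.sum_neg_distrib]
  refine Finset.sum_congr rfl fun k _ => ?_
  have e := mvfderiv_clm_comp (c k • ContinuousLinearMap.id ℝ S)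
    ((h k).1.mdifferentiableAt (by simp)) v
  refine e.trans ?_
  rw [(h k).2, smul_algebra_smul_comm]
  exact smul_neg _ _

variable {σ} in
/-- The notion of parallelism does not depend on the trivialization. -/
theorem IsParallelAt.lift_smul [FiniteDimensional ℝ S] (h : σ.IsParallelAt b f x)
    (hx : x ∈ σ.U a ∩ σ.U b) :
    σ.IsParallelAt a (fun y => (σ.lift a b y : CliffordAlgebra (cliffordForm ε)) • f y) x := by
  refine ⟨(σ.algSmoothAt_lift hx).clifford_smul h.1, fun v => ?_⟩
  obtain ⟨h', hh⟩ := (σ.algSmoothAt_lift hx).exists_hasAlgDerivAt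
  have e := σ.lift_deriv hx hh v
  rw [hh.clifford_smul (h.1.mdifferentiableAt (by simp)), h.2, smul_neg, ← mul_smul, ← mul_smul,
    ← neg_smul, ← add_smul, ← neg_smul]
  congr 1
  rw [← sub_eq_zero, ← e]
  abel

/-- Local parallel frames of the spinor bundle of a flat manifold. -/
theorem exists_local_parallelFrame [FiniteDimensional ℝ S] (hg : g.IsFlat) (hx : x ∈ σ.U a) :
    ∃ N : Set M, IsOpen N ∧ x ∈ N ∧ N ⊆ σ.U a ∧ ∃ P : M → S →ₗ[ℝ] S, P x = LinearMap.id ∧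
      ∀ y ∈ N, Function.Bijective (P y) ∧ ∀ w, σ.IsParallelAt a (fun z => P z w) y := by
  have := FiniteDimensional.complete ℝ S
  obtain ⟨N, hN, hxN, hNa, hf⟩ := σ.exists_local_parallel (S := S) hg hx
  choose f hf₀ hf using hf
  let b := Module.finBasis ℝ S
  -- The solutions were chosen separately for each initial value. Only those starting at basis
  -- vectors are kept, and linear extension makes P linear in the initial value.
  let P : M → S →L[ℝ] S := fun y =>
    ∑ k, (LinearMap.toContinuousLinearMap (b.coord k)).smulRight (f (b k) y)
  have hP : ∀ y w, P y w = ∑ k, b.coord k w • f (b k) y := fun y w => by simp [P]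
  have hPx : P x = 1 := by
    ext w
    rw [hP]
    simp only [hf₀]
    exact b.sum_repr w
  have hcont : ContinuousOn P N := fun y hy => by
    refine ContinuousAt.continuousWithinAt ?_
    refine tendsto_finsetSum _ fun k _ => ?_
    have h1 : ContinuousAt (f (b k)) y := (hf (b k) y hy).1.continuousAt
    exact ((ContinuousLinearMap.smulRightL ℝ S S
      (LinearMap.toContinuousLinearMap (b.coord k))).continuous.tendsto _).comp h1
  -- Invertibility is an open condition that holds at x, where P is the identity, so shrinking the
  -- neighbourhood makes P a frame.
  refine ⟨N ∩ P ⁻¹' {T | IsUnit T}, hcont.isOpen_inter_preimage hN Units.isOpen,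
    ⟨hxN, by simp [hPx]⟩, Set.inter_subset_left.trans hNa, fun y => (P y : S →ₗ[ℝ] S), ?_, ?_⟩
  · exact congrArg (fun T : S →L[ℝ] S => (T : S →ₗ[ℝ] S)) hPx
  · rintro y ⟨hy, hu⟩
    refine ⟨ContinuousLinearMap.isUnit_iff_bijective.1 hu, fun w => ?_⟩
    have : (fun z => (P z : S →ₗ[ℝ] S) w) = fun z => ∑ k, b.coord k w • f (b k) z := by
      ext z
      exact hP z w
    rw [this]
    exact IsParallelAt.sum_smul (fun k => hf (b k) y hy) _

theorem lift_smul_lift_smul {c : A} (hx : x ∈ σ.U a ∩ σ.U b ∩ σ.U c) (w : S) :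
    (σ.lift a b x : CliffordAlgebra (cliffordForm ε)) •
        (σ.lift b c x : CliffordAlgebra (cliffordForm ε)) • w =
      (σ.lift a c x : CliffordAlgebra (cliffordForm ε)) • w := by
  rw [← mul_smul, ← σ.cocycle a b c x hx]
  rfl

open Classical in
/-- On a simply connected flat manifold there is a parallel spinor through every value. -/
theorem evalParallel_surjective [SimplyConnectedSpace M] [FiniteDimensional ℝ S] (hg : g.IsFlat)
    (hx : x ∈ σ.U a) : Function.Surjective (σ.evalParallel S a x) := by
  -- Without boundary the model space H is homeomorphic to the vector space E.
  have : LocallyPathConnectedSpace H :=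
    I.toHomeomorph.isOpenEmbedding.locallyPathConnectedSpace
  have : LocallyPathConnectedSpace M := ChartedSpace.locallyPathConnectedSpace H M
  choose α hα using σ.cover
  choose N hN hmem hNα P hPid hP using fun y => σ.exists_local_parallelFrame (S := S) hg (hα y)
  -- The change of coordinates from the parallel frame around i to the one around j, passing through
  -- the transition function of the spinor bundle.
  let C : M → M → M → S → S := fun i j y w => Function.invFun (P j y)
    ((σ.lift (α j) (α i) y : CliffordAlgebra (cliffordForm ε)) • P i y w)
  have hC : ∀ i j, ∀ y ∈ N j, ∀ w, P j y (C i j y w) =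
      (σ.lift (α j) (α i) y : CliffordAlgebra (cliffordForm ε)) • P i y w := fun i j y hy w =>
    Function.rightInverse_invFun (hP j y hy).1.2 _
  intro w
  obtain ⟨s, hs₀, hs⟩ := exists_flat_section N hN hmem C
    (fun i y hy w => (hP i y hy).1.1 (by
      rw [hC i i y hy, σ.lift_self (hNα i hy)]
      exact one_smul _ _))
    (fun i j k y hy w => (hP k y hy.2).1.1 (by
      rw [hC j k y hy.2, hC i j y hy.1.2, hC i k y hy.2,
        σ.lift_smul_lift_smul ⟨⟨hNα k hy.2, hNα j hy.1.2⟩, hNα i hy.1.1⟩]))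
    (fun i j y hy w => by
      -- With the coordinates frozen at y, both frames give parallel spinors agreeing at y, hence
      -- near y; so C is locally constant.
      have h0 := IsParallelAt.eventually_eq_zero σ (x := y) (a := α j) (S := S)
        (f := fun z => (σ.lift (α j) (α i) z : CliffordAlgebra (cliffordForm ε)) • P i z w -
          P j z (C i j y w)) (hNα j hy.2) ?_ (by simp only [hC i j y hy.2, sub_self])
      · filter_upwards [h0, (hN j).mem_nhds hy.2] with z hz hzj
        refine (hP j z hzj).1.1 ?_
        rw [hC i j z hzj]
        exact sub_eq_zero.1 hz
      · filter_upwards [(hN i).mem_nhds hy.1, (hN j).mem_nhds hy.2] with z hzi hzj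
        exact (((hP i z hzi).2 w).lift_smul ⟨hNα j hzj, hNα i hzi⟩).sub ((hP j z hzj).2 _))
    -- The value w refers to the trivialization a and is transported to the one chosen at x, where
    -- the parallel frame is the identity.
    x ((σ.lift (α x) a x : CliffordAlgebra (cliffordForm ε)) • w)
  -- At each y the frame centred at y itself is used. Flatness of s makes this agree near y with a
  -- constant combination of one parallel frame, so t is smooth and parallel.
  let t : A → M → S := fun c y => if y ∈ σ.U c then
    (σ.lift c (α y) y : CliffordAlgebra (cliffordForm ε)) • P y y (s y) else 0
  have hloc : ∀ c, ∀ y ∈ σ.U c, σ.IsParallelAt c (t c) y := by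
    intro c y hy
    refine (((hP y y (hmem y)).2 (s y)).lift_smul ⟨hy, hα y⟩).congr ?_
    filter_upwards [hs y, (σ.isOpen_U c).mem_nhds hy] with z hz hzc
    rw [← hz.2, hC z y z hz.1, σ.lift_smul_lift_smul ⟨⟨hzc, hNα y hz.1⟩, hα z⟩]
    exact if_pos hzc
  refine ⟨⟨t, fun c y hy => if_neg hy, fun c y hy => (hloc c y hy).1.contMDiffWithinAt,
    fun c d y hy => ?_, fun c y hy v => ?_⟩, ?_⟩
  · simp only [t, if_pos hy.1, if_pos hy.2]
    rw [σ.lift_smul_lift_smul ⟨hy, hα y⟩]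
  · rw [(hloc c y hy).2, neg_add_cancel]
  · change t a x = w
    simp only [t, if_pos hx, hPid, hs₀]
    rw [LinearMap.id_apply, σ.lift_smul_lift_smul ⟨⟨hx, hα x⟩, hx⟩, σ.lift_self hx]
    exact one_smul _ _

theorem kappa_eq_one [ConnectedSpace M] [SimplyConnectedSpace M]
    [IsSimpleModule (CliffordAlgebra (cliffordForm ε)) S] (hg : g.IsFlat) : σ.kappa S = 1 := by
  have := finiteDimensional_of_isSimpleModule ε S
  have := IsSimpleModule.nontrivial (CliffordAlgebra (cliffordForm ε)) S
  obtain ⟨x⟩ := (inferInstance : Nonempty M)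
  obtain ⟨a, hx⟩ := σ.cover x
  have h := (LinearEquiv.ofBijective (σ.evalParallel S a x)
    ⟨σ.evalParallel_injective hx, σ.evalParallel_surjective hg hx⟩).finrank_eq
  rw [kappa, h, div_self]
  exact_mod_cast (Module.finrank_pos (R := ℝ) (M := S)).ne'

end SpinStructure

end Gluing

/-! ### The main theorem. -/

theorem mainTheorem9
    {E₁ : Type*} [NormedAddCommGroup E₁] [NormedSpace ℝ E₁] [FiniteDimensional ℝ E₁]
    {H₁ : Type*} [TopologicalSpace H₁] (I₁ : ModelWithCorners ℝ E₁ H₁) [I₁.Boundaryless]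
    (M₁ : Type*) [TopologicalSpace M₁] [ChartedSpace H₁ M₁] [IsManifold I₁ ∞ M₁]
    [T2Space M₁] [SecondCountableTopology M₁] [ConnectedSpace M₁]
    {E₂ : Type*} [NormedAddCommGroup E₂] [NormedSpace ℝ E₂] [FiniteDimensional ℝ E₂]
    {H₂ : Type*} [TopologicalSpace H₂] (I₂ : ModelWithCorners ℝ E₂ H₂) [I₂.Boundaryless]
    (M₂ : Type*) [TopologicalSpace M₂] [ChartedSpace H₂ M₂] [IsManifold I₂ ∞ M₂]
    [T2Space M₂] [SecondCountableTopology M₂] [ConnectedSpace M₂]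
    (g₁ : PseudoRiemannianMetric I₁ M₁) (g₂ : PseudoRiemannianMetric I₂ M₂)
    {ι₁ ι₂ : Type*} [Fintype ι₁] [DecidableEq ι₁] [Fintype ι₂] [DecidableEq ι₂]
    (ε₁ : ι₁ → ℤˣ) (ε₂ : ι₂ → ℤˣ) {A₁ A₂ : Type*}
    (σ₁ : SpinStructure g₁ ε₁ A₁) (σ₂ : SpinStructure g₂ ε₂ A₂)
    -- the real spinor modules of the two factors and of the product
    (S₁ : Type*) [NormedAddCommGroup S₁] [NormedSpace ℝ S₁]
    [Module (CliffordAlgebra (cliffordForm ε₁)) S₁]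
    [IsScalarTower ℝ (CliffordAlgebra (cliffordForm ε₁)) S₁]
    [IsSimpleModule (CliffordAlgebra (cliffordForm ε₁)) S₁]
    (S₂ : Type*) [NormedAddCommGroup S₂] [NormedSpace ℝ S₂]
    [Module (CliffordAlgebra (cliffordForm ε₂)) S₂]
    [IsScalarTower ℝ (CliffordAlgebra (cliffordForm ε₂)) S₂]
    [IsSimpleModule (CliffordAlgebra (cliffordForm ε₂)) S₂]
    (S : Type*) [NormedAddCommGroup S] [NormedSpace ℝ S]
    [Module (CliffordAlgebra (cliffordForm (Sum.elim ε₁ ε₂))) S]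
    [IsScalarTower ℝ (CliffordAlgebra (cliffordForm (Sum.elim ε₁ ε₂))) S]
    [IsSimpleModule (CliffordAlgebra (cliffordForm (Sum.elim ε₁ ε₂))) S] :
    (σ₁.prod σ₂).kappa S = σ₁.kappa S₁ * σ₂.kappa S₂ ∧
    (σ₁.kappa S₁ ≠ 0 → (σ₁.prod σ₂).kappa S = σ₁.kappa S₁ → g₂.IsFlat) ∧
    (SimplyConnectedSpace M₂ → g₂.IsFlat → (σ₁.prod σ₂).kappa S = σ₁.kappa S₁) := by
  refine ⟨SpinStructure.kappa_prod σ₁ σ₂ S₁ S₂ S, fun hne h => ?_, fun _ hflat => ?_⟩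
  · rw [SpinStructure.kappa_prod σ₁ σ₂ S₁ S₂ S] at h
    -- Cancelling the nonzero κ(M₁) from κ(M₁) κ(M₂) = κ(M₁) leaves κ(M₂) = 1.
    exact σ₂.isFlat_of_kappa_eq_one (S := S₂) (mul_right_eq_self₀.1 h |>.resolve_right hne)
  · rw [SpinStructure.kappa_prod σ₁ σ₂ S₁ S₂ S, σ₂.kappa_eq_one hflat, mul_one]
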